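/- Let $n,d,D$ be natural numbers with $d\ge 1$, and let $\epsilon\in(0,1/2)$, $\kappa\ge 1$, $\alpha>0$, $\sigma>0$ be reals with $\epsilon\kappa\ge 1-\epsilon$. Put $\sigma_y^2=\alpha^2+\sigma^2$ and $\delta=\alpha\sqrt\kappa$. *Testing problem.* Samples $z_1,\dots,z_n\in\mathbb R^{d}\times\mathbb R$, $z_i=(x_i,y_i)$, are observed. Under the null $\mathcal Q$ they are i.i.d. $\mathcal N(0,\mathrm{diag}(I_d,\sigma_y^2))$. Under the alternative $\mathcal P$ one draws $v\sim\mathrm{Unif}(S^{d-1})$ and, given $v$, the samples are i.i.d. from $(1-\epsilon)D_v+\epsilon E_v$, where $D_v$ is the law of $(X,Y)$ with $X\sim\mathcal N(0,\Sigma_v)$, $Y=\langle X,\beta_v\rangle+\eta$, and $\eta\sim\mathcal N(0,\sigma^2)$ independent of $X$. It is required that $\Sigma_v\succ0$ has condition number $\kappa$, that $\|\Sigma_v^{1/2}\beta_v\|=\alpha$, that $\mathrm{Var}_{D_v}(Y)=\sigma_y^2$, and that $E_v$ is a probability distribution on $\mathbb R^{d+1}$. *Hard instance.* Take $\beta_v=\delta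 v$, $\Sigma_v=I_d-(1-\tfrac1\kappa)vv^{T}$ and $E_v=\mathcal N(0,\Sigma_{E,v})$ with $$\Sigma_{E,v}=\begin{bmatrix} I_d+\frac{1-\epsilon}{\epsilon}(1-\frac1\kappa)vv^{T} & -\frac{1-\epsilon}{\epsilon}\frac{\delta}{\kappa}v\\ -\frac{1-\epsilon}{\epsilon}\frac{\delta}{\kappa}v^{T} & \frac{\delta^2}{\kappa}+\sigma^2\end{bmatrix}.$$ *Advantage.* $\mathrm{Adv}^{\le D}=\sup_f \mathbb E_{\mathcal P}[f]/\sqrt{\mathbb E_{\mathcal Q}[f^2]}$ over the real polynomials $f$ of degree at most $D$ in the $n(d+1)$ coordinates of the samples with $\mathbb E_{\mathcal Q}[f^2]\neq 0$. **Theorem.** 1. If $d\ge2$, the hard instance satisfies all the requirements of the testing problem. 2. For every unit vector $v$ the matrix $\Sigma_{E,v}$ is positive semidefinite and the first three moments of $(1-\epsilon)D_v+\epsilon E_v$ agree with those of $\mathcal N(0,\mathrm{diag}(I_d,\sigma_y^2))$. Moreover $\mathcal P$ is a probability measure and all its moments are finite. 3. There is an absolute constant $C>0$ such that for all parameters as above,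 for the hard instance, $\mathrm{Adv}^{\le D}$ is finite and $$\left(\mathrm{Adv}^{\le D}\right)^2-1\le C\sum_{\substack{p=4\\ p\text{ even}}}^{D}\ \sum_{m=1}^{\lfloor p/4\rfloor} n^m p^{p/2}\left(\frac{4p}{d}\right)^{p/2}\epsilon^{2m-p}p^{p/2}\sum_{L=0}^{p/2}\left(\frac{\sqrt d}{\kappa}\right)^{L}.$$ 4. If moreover $\epsilon\ge \mathrm{poly}(D)/\sqrt d$, then for the hard instance $\mathrm{Adv}^{\le D}=1+o(1)$ whenever $n\ll\frac{1}{\mathrm{poly}(D)}\min(d\epsilon^2\kappa^2,\epsilon^2d^2)$. Precisely: there is an absolute constant $C\in\mathbb N$ such that for every $\eta>0$ there is $c>0$ such that for all parameters as above with $D^{C}\le\epsilon\sqrt d$ and $n\,D^{C}\le c\,\min(d\epsilon^2\kappa^2,\epsilon^2d^2)$ one has $|\mathrm{Adv}^{\le D}-1|\le\eta$. -/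

import Mathlib

open MeasureTheory ProbabilityTheory
open scoped ENNReal NNReal Matrix

noncomputable section

namespace RobustTesting

/-! ### Low-degree advantage -/

/-- The space `ℝ^{d+1}` of one sample `(x, y)`: the coordinates `Sum.inl i` are the features `x i`,
the coordinate `Sum.inr ()` is the label `y`. -/
abbrev Sample (d : ℕ) : Type := EuclideanSpace ℝ (Fin d ⊕ Unit)

/-- Real polynomials in the `n * (d + 1)` coordinates of `n` samples. -/
abbrev SamplePoly (n d : ℕ) : Type := MvPolynomial (Fin n × (Fin d ⊕ Unit)) ℝ

/-- The value `f(z)` of a polynomial at the `n` samples `z`. -/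
def SamplePoly.value {n d : ℕ} (f : SamplePoly n d) (z : Fin n → Sample d) : ℝ :=
  MvPolynomial.eval (fun ij : Fin n × (Fin d ⊕ Unit) => z ij.1 ij.2) f

/-- The ratios `E_P[f] / √(E_Q[f ^ 2])` over all polynomials `f` of degree at most `D` with
`E_Q[f ^ 2] ≠ 0`. -/
def advantageRatios {n d : ℕ} (P Q : Measure (Fin n → Sample d)) (D : ℕ) : Set ℝ :=
  {r | ∃ f : SamplePoly n d, f.totalDegree ≤ D ∧ 0 < ∫ z, f.value z ^ 2 ∂Q ∧
    r = (∫ z, f.value z ∂P) / √(∫ z, f.value z ^ 2 ∂Q)}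

/-- The degree-`D` advantage `Adv^{≤ D}` for testing `Q` (null) against `P` (alternative). -/
def advantage {n d : ℕ} (P Q : Measure (Fin n → Sample d)) (D : ℕ) : ℝ :=
  sSup (advantageRatios P Q D)

/-! ### Robust linear testing -/

/-- The unit sphere of `ℝ^d`. -/
abbrev UnitSphere (d : ℕ) : Type := Metric.sphere (0 : EuclideanSpace ℝ (Fin d)) 1

/-- The uniform probability measure on the unit sphere: normalized surface measure. -/
def sphereUniform (d : ℕ) : Measure (UnitSphere d) :=
  ((volume : Measure (EuclideanSpace ℝ (Fin d))).toSphere Set.univ)⁻¹ •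
    (volume : Measure (EuclideanSpace ℝ (Fin d))).toSphere

/-- The null law of one sample: `N(0, diag(I_d, σ_y²))` with `σ_y² = α² + σ²`. -/
def nullOne (d : ℕ) (α σ : ℝ) : Measure (Sample d) :=
  multivariateGaussian 0
    (Matrix.fromBlocks (1 : Matrix (Fin d) (Fin d) ℝ) 0 0
      (Matrix.of fun _ _ : Unit => α ^ 2 + σ ^ 2))

/-- The null law `Q` of `n` i.i.d. samples. -/
def nullLaw (n d : ℕ) (α σ : ℝ) : Measure (Fin n → Sample d) :=
  Measure.pi fun _ => nullOne d α σ

/-- The law of `(X, Y)` with `X ∼ N(0, S)`, `Y = ⟨X, b⟩ + η` and `η ∼ N(0, σ²)` independent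
of `X`. -/
def linearModel {d : ℕ} (S : Matrix (Fin d) (Fin d) ℝ) (b : EuclideanSpace ℝ (Fin d)) (σ : ℝ) :
    Measure (Sample d) :=
  ((multivariateGaussian 0 S).prod (gaussianReal 0 ⟨σ ^ 2, sq_nonneg σ⟩)).map
    fun p => WithLp.toLp 2 (Sum.elim (fun i => p.1 i) (fun _ => inner ℝ p.1 b + p.2))

/-- A choice of the regression vectors `β_v`, covariances `Σ_v` and corruptions `E_v`, for `v` on
the unit sphere. -/
structure Choice (d : ℕ) where
  beta : UnitSphere d → EuclideanSpace ℝ (Fin d)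
  cov : UnitSphere d → Matrix (Fin d) (Fin d) ℝ
  corruption : UnitSphere d → Measure (Sample d)

/-- The law `(1 - ε) D_v + ε E_v` of one sample given `v`. -/
def Choice.mixture {d : ℕ} (A : Choice d) (ε σ : ℝ) (v : UnitSphere d) : Measure (Sample d) :=
  ENNReal.ofReal (1 - ε) • linearModel (A.cov v) (A.beta v) σ + ENNReal.ofReal ε • A.corruption v

/-- The alternative law `P` of `n` samples: draw `v` uniformly from the sphere, then, given `v`,
draw `n` i.i.d. samples from `(1 - ε) D_v + ε E_v`. -/
def Choice.alternativeLaw {d : ℕ} (A : Choice d) (n : ℕ) (ε σ : ℝ) :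
    Measure (Fin n → Sample d) :=
  (sphereUniform d).bind fun v => Measure.pi fun _ => A.mixture ε σ v

/-- The condition number `‖S‖ ‖S⁻¹‖` in the spectral norm. -/
def condNumber {d : ℕ} (S : Matrix (Fin d) (Fin d) ℝ) : ℝ :=
  ‖Matrix.toEuclideanCLM (𝕜 := ℝ) S‖ * ‖Matrix.toEuclideanCLM (𝕜 := ℝ) S⁻¹‖

/-- The Mahalanobis norm `‖S^{1/2} b‖ = √(bᵀ S b)`. -/
def mahalanobisNorm {d : ℕ} (S : Matrix (Fin d) (Fin d) ℝ) (b : EuclideanSpace ℝ (Fin d)) : ℝ :=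
  √(b.ofLp ⬝ᵥ (S *ᵥ b.ofLp))

/-- The constraints of the testing problem on `β_v`, `Σ_v`, `E_v`: `Σ_v` is positive definite with
condition number `κ`, the signal strength is `α`, the corruption is a probability distribution, and
the inlier label variance is `σ_y² = α² + σ²`, as under the null. -/
structure Choice.IsValid {d : ℕ} (A : Choice d) (κ α σ : ℝ) : Prop where
  posDef : ∀ v, (A.cov v).PosDef
  condNumber_eq : ∀ v, condNumber (A.cov v) = κ
  mahalanobisNorm_eq : ∀ v, mahalanobisNorm (A.cov v) (A.beta v) = α
  isProbability : ∀ v, IsProbabilityMeasure (A.corruption v)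
  variance_label : ∀ v, variance (fun z : Sample d => z (Sum.inr ()))
    (linearModel (A.cov v) (A.beta v) σ) = α ^ 2 + σ ^ 2

/-! ### The hard instance -/

/-- The covariance `I_d - (1 - 1/κ) v vᵀ` of the clean features. -/
def hardCov {d : ℕ} (κ : ℝ) (v : UnitSphere d) : Matrix (Fin d) (Fin d) ℝ :=
  1 - (1 - 1 / κ) • Matrix.vecMulVec v.1.ofLp v.1.ofLp

/-- The covariance of the Gaussian corruption, in block form. -/
def corruptionCov {d : ℕ} (ε κ δ σ : ℝ) (v : UnitSphere d) :
    Matrix (Fin d ⊕ Unit) (Fin d ⊕ Unit) ℝ :=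
  Matrix.fromBlocks
    (1 + ((1 - ε) / ε * (1 - 1 / κ)) • Matrix.vecMulVec v.1.ofLp v.1.ofLp)
    (Matrix.of fun i _ => -((1 - ε) / ε) * (δ / κ) * v.1 i)
    (Matrix.of fun _ i => -((1 - ε) / ε) * (δ / κ) * v.1 i)
    (Matrix.of fun _ _ => δ ^ 2 / κ + σ ^ 2)

/-- The hard instance: with `δ = α √κ`, take `β_v = δ v`, `Σ_v = I_d - (1 - 1/κ) v vᵀ` and a
centered Gaussian corruption with covariance `corruptionCov`. -/
def hardInstance (d : ℕ) (ε κ α σ : ℝ) : Choice d where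
  beta v := (α * √κ) • v.1
  cov v := hardCov κ v
  corruption v := multivariateGaussian 0 (corruptionCov ε κ (α * √κ) σ v)

/-- The range of the parameters: corruption rate `ε ∈ (0, 1/2)`, condition number `κ ≥ 1`,
`ε κ ≥ 1 - ε`, signal strength `α > 0` and noise level `σ > 0`. -/
structure ParamRange (ε κ α σ : ℝ) : Prop where
  eps_pos : 0 < ε
  eps_lt : ε < 1 / 2
  one_le_kappa : 1 ≤ κ
  eps_kappa : 1 - ε ≤ ε * κ
  alpha_pos : 0 < α
  sigma_pos : 0 < σ

/-- The degree-`D` advantage of the hard instance with `n` samples in dimension `d`. -/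
def hardAdvantage (n d D : ℕ) (ε κ α σ : ℝ) : ℝ :=
  advantage ((hardInstance d ε κ α σ).alternativeLaw n ε σ) (nullLaw n d α σ) D

/-- The explicit sum over even degrees `p`, numbers `m` of active samples and label-degrees `L`. -/
def advantageSum (n d D : ℕ) (ε κ : ℝ) : ℝ :=
  ∑ p ∈ (Finset.Icc 4 D).filter Even, ∑ m ∈ Finset.Icc 1 (p / 4),
    (n : ℝ) ^ m * (p : ℝ) ^ (p / 2) * (4 * (p : ℝ) / d) ^ (p / 2) * ε ^ (2 * (m : ℤ) - (p : ℤ)) *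
      (p : ℝ) ^ (p / 2) * ∑ L ∈ Finset.range (p / 2 + 1), (√(d : ℝ) / κ) ^ L

end RobustTesting

end

open MeasureTheory ProbabilityTheory
open scoped ENNReal NNReal Matrix

noncomputable section

namespace RobustTesting

/-! ### Integration by parts for the standard Gaussian -/

/-! After normalising the label by `σ_y`, a clean sample has covariance `1 + M` and a corrupted one
`1 + t M` with `t = -(1 - ε) / ε`; here `M` couples only the direction `v` and the label, and has no
label variance. A Hermite moment of degree `2k` of a centred Gaussian with covariance `1 + M` is
homogeneous of degree `k` in `M`, and odd ones vanish (`gaussMean_hermMv_spike`, `spikeHerm_mul`).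
The mixture therefore multiplies the clean moment by `(1 - ε) + ε t ^ k`. This is `1` for `k = 0`,
vanishes for `k = 1`, and has size at most `ε⁻¹ ^ (k - 1)` for `k ≥ 2` (`exists_of_mixHerm_ne_zero`,
`abs_mix_coeff_le`). Hence three moments match, and a sample that enters a nonzero coefficient has
degree at least four. The assumption `ε κ ≥ 1 - ε` makes the corruption covariance positive
semidefinite (`ParamRange.corrCoeff_sq_le`).

Products of Hermite polynomials are orthogonal under the null and span the polynomials of bounded
degree, so Cauchy-Schwarz bounds the squared advantage by a sum of squared, normalised Hermite
coefficients of the alternative (`ParamRange.integral_value_sq_le`). Given `v`, such a coefficient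
is a monomial in `v` times a number that depends only on the feature and label degree of each
sample. Squaring the mean over `v` introduces an independent copy `w`, and the multinomial theorem
collapses the sum to moments of `⟨v, w⟩` (`sum_sq_coeff_eq`). Comparison with a Gaussian vector
bounds the moment of even order `q` by `(q / d) ^ (q / 2)`; odd moments vanish.

It remains to count (`sum_pairIdx_le`). For total degree `p`, `m` active samples and label degree
`L` there are at most `n ^ m (p + 1) ^ (2m)` degree patterns, with `4m ≤ p`. The mixture contributes
`ε ^ (2m - p)`, the labels `κ ^ (-L)`, and the overlap of order `p - L` contributes `d ^ (-p/2) √d ^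
L`. When samples are few, the geometric sum in `√d / κ` is controlled by its first or last term, and
these two cases use the two entries of the minimum (`term_bound_of_scale`, `term_le`). -/

/-- The standard Gaussian law on `ι → ℝ`. -/
abbrev stdPi (ι : Type*) [Fintype ι] : Measure (ι → ℝ) := Measure.pi fun _ => gaussianReal 0 1

lemma integrable_pow_gaussianReal (n : ℕ) : Integrable (fun x : ℝ => x ^ n) (gaussianReal 0 1) := by
  have h := (memLp_id_gaussianReal (μ := 0) (v := 1) n).integrable_norm_pow'
  refine h.mono' (by fun_prop) (Filter.Eventually.of_forall fun x => ?_)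
  simp

lemma integrable_eval_gaussianReal (p : Polynomial ℝ) :
    Integrable (fun x : ℝ => p.eval x) (gaussianReal 0 1) := by
  simp_rw [Polynomial.eval_eq_sum_range]
  exact integrable_finsetSum _ fun i _ => (integrable_pow_gaussianReal i).const_mul _

lemma hasDerivAt_gaussianPDFReal (x : ℝ) :
    HasDerivAt (gaussianPDFReal 0 1) (-x * gaussianPDFReal 0 1 x) x := by
  unfold gaussianPDFReal
  have h : HasDerivAt (fun x : ℝ => -(x - 0) ^ 2 / (2 * ((1 : ℝ≥0) : ℝ))) (-x) x := by
    have := (((hasDerivAt_id x).sub_const 0).pow 2).neg.div_const (2 * ((1 : ℝ≥0) : ℝ))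
    refine this.congr_deriv ?_
    simp only [id, NNReal.coe_one]
    ring
  refine (h.exp.const_mul _).congr_deriv ?_
  ring

/-- Gaussian integration by parts in one variable. -/
lemma integral_mul_eval_gaussianReal (p : Polynomial ℝ) :
    ∫ x, x * p.eval x ∂gaussianReal 0 1 = ∫ x, p.derivative.eval x ∂gaussianReal 0 1 := by
  have key (q : Polynomial ℝ) :
      Integrable (fun x => gaussianPDFReal 0 1 x * q.eval x) := by
    have h := integrable_eval_gaussianReal q
    rw [gaussianReal_of_var_ne_zero _ one_ne_zero,
      integrable_withDensity_iff_integrable_smul₀' (by fun_prop)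
        (Filter.Eventually.of_forall fun _ => gaussianPDF_lt_top)] at h
    simpa [toReal_gaussianPDF] using h
  -- The derivative of the density times `p` integrates to zero, and differentiating the density
  -- produces the factor `-x`.
  have h0 := integral_eq_zero_of_hasDerivAt_of_integrable
    (f := fun x => gaussianPDFReal 0 1 x * p.eval x)
    (f' := fun x => gaussianPDFReal 0 1 x * p.derivative.eval x
      - gaussianPDFReal 0 1 x * (Polynomial.X * p).eval x)
    (fun x => by
      refine ((hasDerivAt_gaussianPDFReal x).mul (p.hasDerivAt x)).congr_deriv ?_
      simp only [Polynomial.eval_mul, Polynomial.eval_X]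
      ring) ((key _).sub (key _)) (key _)
  rw [integral_sub (key _) (key _)] at h0
  rw [integral_gaussianReal_eq_integral_smul one_ne_zero,
    integral_gaussianReal_eq_integral_smul one_ne_zero]
  simp only [smul_eq_mul]
  simp only [Polynomial.eval_mul, Polynomial.eval_X] at h0
  linarith

variable {ι κ : Type*} [Fintype κ]

lemma integrable_eval_stdPi (f : MvPolynomial κ ℝ) :
    Integrable (fun g => MvPolynomial.eval g f) (stdPi κ) := by
  induction f using MvPolynomial.induction_on' with
  | monomial m c =>
    simp only [MvPolynomial.eval_monomial]
    simp_rw [Finsupp.prod_fintype m (fun i e => _ ^ e) (fun _ => pow_zero _)]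
    exact (Integrable.fintype_prod fun i => integrable_pow_gaussianReal (m i)).const_mul c
  | add p q hp hq =>
    simp only [map_add]
    exact hp.add hq

lemma integral_monomial_stdPi (m : κ →₀ ℕ) (c : ℝ) :
    ∫ g, MvPolynomial.eval g (MvPolynomial.monomial m c) ∂stdPi κ =
      c * ∏ i, ∫ x, x ^ m i ∂gaussianReal 0 1 := by
  simp only [MvPolynomial.eval_monomial]
  simp_rw [Finsupp.prod_fintype m (fun i e => _ ^ e) (fun _ => pow_zero _)]
  rw [integral_const_mul, integral_fintype_prod_eq_prod (fun i (x : ℝ) => x ^ m i)]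

/-- Integration by parts against `X ^ n`. At `n = 0` the truncated exponent is harmless because its
coefficient is zero. -/
lemma integral_pow_succ_gaussianReal (n : ℕ) :
    ∫ x, x ^ (n + 1) ∂gaussianReal 0 1 = n * ∫ x, x ^ (n - 1) ∂gaussianReal 0 1 := by
  have h := integral_mul_eval_gaussianReal (Polynomial.X ^ n)
  simp only [Polynomial.eval_pow, Polynomial.eval_X, Polynomial.derivative_X_pow,
    Polynomial.eval_mul, Polynomial.eval_C, integral_const_mul] at h
  rw [← h]
  congr 1 with x
  ring

/-- Gaussian integration by parts in several variables. -/
lemma integral_mul_eval_stdPi [DecidableEq κ] (k : κ) (f : MvPolynomial κ ℝ) :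
    ∫ g, MvPolynomial.eval g (MvPolynomial.X k * f) ∂stdPi κ =
      ∫ g, MvPolynomial.eval g (MvPolynomial.pderiv k f) ∂stdPi κ := by
  induction f using MvPolynomial.induction_on' with
  | monomial m c =>
    rw [MvPolynomial.pderiv_monomial, integral_monomial_stdPi, MvPolynomial.X,
      MvPolynomial.monomial_mul, integral_monomial_stdPi,
      ← Finset.mul_prod_erase _ _ (Finset.mem_univ k),
      ← Finset.mul_prod_erase _ _ (Finset.mem_univ k)]
    have h1 (i) (hi : i ∈ Finset.univ.erase k) :
        ∫ x, x ^ ((Finsupp.single k 1 + m : κ →₀ ℕ) i) ∂gaussianReal 0 1 =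
          ∫ x, x ^ ((m - Finsupp.single k 1 : κ →₀ ℕ) i) ∂gaussianReal 0 1 := by
      have : k ≠ i := (Finset.ne_of_mem_erase hi).symm
      simp [this]
    rw [Finset.prod_congr rfl h1]
    have h2 : (Finsupp.single k 1 + m : κ →₀ ℕ) k = m k + 1 := by simp [add_comm]
    have h3 : (m - Finsupp.single k 1 : κ →₀ ℕ) k = m k - 1 := by simp
    rw [h2, h3, integral_pow_succ_gaussianReal]
    ring
  | add p q hp hq =>
    have e1 : ∀ g : κ → ℝ, MvPolynomial.eval g (MvPolynomial.X k * (p + q)) =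
      MvPolynomial.eval g (MvPolynomial.X k * p) + MvPolynomial.eval g (MvPolynomial.X k * q) := by
        intro g; simp [mul_add]
    have e2 : ∀ g : κ → ℝ, MvPolynomial.eval g (MvPolynomial.pderiv k (p + q)) =
      MvPolynomial.eval g (MvPolynomial.pderiv k p) +
        MvPolynomial.eval g (MvPolynomial.pderiv k q) := by intro g; simp
    simp_rw [e1, e2]
    rw [integral_add (integrable_eval_stdPi _) (integrable_eval_stdPi _),
      integral_add (integrable_eval_stdPi _) (integrable_eval_stdPi _), hp, hq]

/-! ### Polynomials in linear images of a standard Gaussian -/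

/-- Substitution of the linear forms given by the rows of `A`. -/
def linSubst (A : Matrix ι κ ℝ) : MvPolynomial ι ℝ →ₐ[ℝ] MvPolynomial κ ℝ :=
  MvPolynomial.aeval fun i => ∑ k, MvPolynomial.C (A i k) * MvPolynomial.X k

lemma eval_linSubst (A : Matrix ι κ ℝ) (f : MvPolynomial ι ℝ) (g : κ → ℝ) :
    MvPolynomial.eval g (linSubst A f) = MvPolynomial.eval (A *ᵥ g) f := by
  induction f using MvPolynomial.induction_on with
  | C c => simp [linSubst]
  | add p q hp hq => simp [hp, hq]
  | mul_X p i hp => rw [map_mul, map_mul, hp]; simp [linSubst, Matrix.mulVec, dotProduct]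

/-- Chain rule. It carries integration by parts from the coordinates of `g` to those of `A g`, where
the entries of `A` assemble into `A * Aᵀ`. -/
lemma pderiv_linSubst [Fintype ι] [DecidableEq κ] (A : Matrix ι κ ℝ) (f : MvPolynomial ι ℝ) (k : κ) :
    MvPolynomial.pderiv k (linSubst A f) =
      ∑ i, MvPolynomial.C (A i k) * linSubst A (MvPolynomial.pderiv i f) := by
  classical
  induction f using MvPolynomial.induction_on with
  | C c => simp [linSubst]
  | add p q hp hq => simp [hp, hq, mul_add, Finset.sum_add_distrib]
  | mul_X p i hp =>
    have hX : MvPolynomial.pderiv k (linSubst A (MvPolynomial.X i)) = MvPolynomial.C (A i k) := by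
      simp only [linSubst, MvPolynomial.aeval_X, map_sum, Derivation.leibniz,
        MvPolynomial.pderiv_C, MvPolynomial.pderiv_X, smul_eq_mul, mul_zero, add_zero]
      rw [Finset.sum_eq_single k]
      · simp
      · intro b _ hb; simp [hb]
      · simp
    rw [map_mul, Derivation.leibniz, hp, hX]
    simp only [Derivation.leibniz, smul_eq_mul, map_add, map_mul, mul_add, Finset.sum_add_distrib]
    congr 1
    · rw [Finset.sum_eq_single i]
      · simp [mul_comm]
      · intro b _ hb; simp [MvPolynomial.pderiv_X, hb.symm]
      · simp
    · rw [Finset.mul_sum]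
      exact Finset.sum_congr rfl fun j _ => by ring

/-- The mean of the polynomial `f` under the law of `A g`, `g` standard Gaussian. -/
def gaussMean (A : Matrix ι κ ℝ) (f : MvPolynomial ι ℝ) : ℝ :=
  ∫ g, MvPolynomial.eval (A *ᵥ g) f ∂stdPi κ

lemma integrable_eval_mulVec (A : Matrix ι κ ℝ) (f : MvPolynomial ι ℝ) :
    Integrable (fun g => MvPolynomial.eval (A *ᵥ g) f) (stdPi κ) := by
  simp_rw [← eval_linSubst]
  exact integrable_eval_stdPi _

lemma gaussMean_sub (A : Matrix ι κ ℝ) (f g : MvPolynomial ι ℝ) :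
    gaussMean A (f - g) = gaussMean A f - gaussMean A g := by
  simp only [gaussMean, map_sub]
  exact integral_sub (integrable_eval_mulVec _ _) (integrable_eval_mulVec _ _)

lemma gaussMean_C_mul (A : Matrix ι κ ℝ) (c : ℝ) (f : MvPolynomial ι ℝ) :
    gaussMean A (MvPolynomial.C c * f) = c * gaussMean A f := by
  simp only [gaussMean, map_mul, MvPolynomial.eval_C, integral_const_mul]

lemma gaussMean_one (A : Matrix ι κ ℝ) : gaussMean A 1 = 1 := by
  simp [gaussMean]

/-- Stein's identity for the law of `A g`, which has covariance `A Aᵀ`. -/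
lemma gaussMean_X_mul [Fintype ι] (A : Matrix ι κ ℝ) (i : ι) (f : MvPolynomial ι ℝ) :
    gaussMean A (MvPolynomial.X i * f) =
      ∑ j, (A * Aᵀ) i j * gaussMean A (MvPolynomial.pderiv j f) := by
  classical
  have h1 : ∀ g : κ → ℝ, MvPolynomial.eval (A *ᵥ g) (MvPolynomial.X i * f) =
      ∑ k, A i k * MvPolynomial.eval g (MvPolynomial.X k * linSubst A f) := by
    intro g
    simp only [map_mul, MvPolynomial.eval_X, eval_linSubst, Matrix.mulVec, dotProduct]
    rw [Finset.sum_mul]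
    exact Finset.sum_congr rfl fun _ _ => by ring
  simp_rw [gaussMean, h1]
  rw [integral_finsetSum _ fun k _ => (integrable_eval_stdPi _).const_mul _]
  simp_rw [integral_const_mul, integral_mul_eval_stdPi, pderiv_linSubst, map_sum, map_mul,
    MvPolynomial.eval_C, eval_linSubst]
  simp_rw [integral_finsetSum _ fun j _ =>
    ((integrable_eval_mulVec A (MvPolynomial.pderiv j f)).const_mul _), integral_const_mul,
    Finset.mul_sum]
  rw [Finset.sum_comm]
  refine Finset.sum_congr rfl fun j _ => ?_
  rw [Matrix.mul_apply, Finset.sum_mul]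
  exact Finset.sum_congr rfl fun k _ => by simp [mul_assoc]

end RobustTesting

namespace RobustTesting

/-! ### Hermite polynomials -/

/-- The probabilists' Hermite polynomials over `ℝ`. -/
def herm (n : ℕ) : Polynomial ℝ := (Polynomial.hermite n).map (Int.castRingHom ℝ)

lemma herm_zero : herm 0 = 1 := by simp [herm]

lemma herm_succ (n : ℕ) :
    herm (n + 1) = Polynomial.X * herm n - Polynomial.derivative (herm n) := by
  simp [herm, Polynomial.hermite_succ, Polynomial.derivative_map]

lemma derivative_herm_succ (n : ℕ) :
    Polynomial.derivative (herm (n + 1)) = Polynomial.C ((n : ℝ) + 1) * herm n := by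
  induction n with
  | zero => simp [herm_succ, herm_zero]
  | succ n ih =>
    rw [herm_succ (n + 1), Polynomial.derivative_sub, Polynomial.derivative_mul, ih,
      Polynomial.derivative_X, Polynomial.derivative_C_mul, herm_succ n]
    push_cast
    simp only [Polynomial.C_add, Polynomial.C_1]
    ring

lemma derivative_herm (n : ℕ) :
    Polynomial.derivative (herm n) = Polynomial.C (n : ℝ) * herm (n - 1) := by
  cases n with
  | zero => simp [herm_zero]
  | succ n => simpa using derivative_herm_succ n

/-- Under the Gaussian, the raising operator `x - d/dx` is adjoint to `d/dx`, which lowers the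
Hermite index. Iteration reduces every pairing to one with an index zero. -/
lemma integral_herm_mul_succ (m n : ℕ) :
    ∫ x, (herm (m + 1)).eval x * (herm n).eval x ∂gaussianReal 0 1 =
      n * ∫ x, (herm m).eval x * (herm (n - 1)).eval x ∂gaussianReal 0 1 := by
  have h := integral_mul_eval_gaussianReal (herm m * herm n)
  have e1 : ∀ x : ℝ, (herm (m + 1)).eval x * (herm n).eval x =
      x * (herm m * herm n).eval x
        - (Polynomial.derivative (herm m) * herm n).eval x := by
    intro x
    simp only [herm_succ, Polynomial.eval_sub, Polynomial.eval_mul, Polynomial.eval_X]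
    ring
  have i1 : Integrable (fun x => x * (herm m * herm n).eval x) (gaussianReal 0 1) := by
    refine (integrable_eval_gaussianReal (Polynomial.X * (herm m * herm n))).congr
      (Filter.Eventually.of_forall fun x => ?_)
    simp only [Polynomial.eval_mul, Polynomial.eval_X]
  simp_rw [e1]
  rw [integral_sub i1 (integrable_eval_gaussianReal _), h,
    ← integral_sub (integrable_eval_gaussianReal _) (integrable_eval_gaussianReal _),
    ← integral_const_mul]
  congr 1 with x
  rw [Polynomial.derivative_mul, derivative_herm n]
  simp only [Polynomial.eval_add, Polynomial.eval_mul, Polynomial.eval_C]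
  ring

/-- Orthogonality of the Hermite polynomials. -/
lemma integral_herm_mul_herm (m n : ℕ) :
    ∫ x, (herm m).eval x * (herm n).eval x ∂gaussianReal 0 1 =
      if m = n then (m.factorial : ℝ) else 0 := by
  induction m generalizing n with
  | zero =>
    cases n with
    | zero => simp [herm_zero]
    | succ n =>
      have := integral_herm_mul_succ n 0
      simp only [Nat.cast_zero, zero_mul] at this
      rw [if_neg (Nat.succ_ne_zero n).symm]
      refine Eq.trans ?_ this
      exact integral_congr_ae (Filter.Eventually.of_forall fun x =>
        mul_comm ((herm 0).eval x) _)
  | succ m ih =>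
    rw [integral_herm_mul_succ, ih]
    cases n with
    | zero => simp
    | succ n =>
      by_cases h : m = n
      · simp [h, Nat.factorial_succ]
      · simp [h]

lemma pderiv_aeval_X_self {ι : Type*} [DecidableEq ι] (i : ι) (p : Polynomial ℝ) :
    MvPolynomial.pderiv i (Polynomial.aeval (MvPolynomial.X i : MvPolynomial ι ℝ) p) =
      Polynomial.aeval (MvPolynomial.X i) (Polynomial.derivative p) := by
  induction p using Polynomial.induction_on' with
  | add p q hp hq => simp [hp, hq]
  | monomial n a =>
    simp [Polynomial.aeval_monomial, Polynomial.derivative_monomial, Derivation.leibniz,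
      MvPolynomial.algebraMap_eq, Derivation.leibniz_pow, MvPolynomial.pderiv_X]
    ring

lemma pderiv_aeval_X_of_ne {ι : Type*} [DecidableEq ι] {i j : ι} (h : i ≠ j) (p : Polynomial ℝ) :
    MvPolynomial.pderiv i (Polynomial.aeval (MvPolynomial.X j : MvPolynomial ι ℝ) p) = 0 := by
  induction p using Polynomial.induction_on' with
  | add p q hp hq => simp [hp, hq]
  | monomial n a =>
    simp [Polynomial.aeval_monomial, Derivation.leibniz,
      MvPolynomial.algebraMap_eq, Derivation.leibniz_pow, MvPolynomial.pderiv_X_of_ne h.symm]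

variable {ι κ : Type*} [Fintype ι] [Fintype κ]

/-- Products of Hermite polynomials in the separate variables. -/
def hermMv (α : ι → ℕ) : MvPolynomial ι ℝ :=
  ∏ j, Polynomial.aeval (MvPolynomial.X j) (herm (α j))

lemma eval_hermMv (α : ι → ℕ) (z : ι → ℝ) :
    MvPolynomial.eval z (hermMv α) = ∏ j, (herm (α j)).eval (z j) := by
  simp only [hermMv, map_prod]
  refine Finset.prod_congr rfl fun j _ => ?_
  have := Polynomial.aeval_algHom_apply (MvPolynomial.aeval (R := ℝ) z) (MvPolynomial.X j)
    (herm (α j))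
  simp only [MvPolynomial.aeval_X, MvPolynomial.aeval_eq_eval, Polynomial.coe_aeval_eq_eval] at this
  rw [this]

lemma hermMv_zero : hermMv (0 : ι → ℕ) = 1 := by simp [hermMv, herm_zero]

lemma hermMv_eq_mul_erase [DecidableEq ι] (α : ι → ℕ) (i : ι) :
    hermMv α = Polynomial.aeval (MvPolynomial.X i) (herm (α i)) *
      ∏ j ∈ Finset.univ.erase i, Polynomial.aeval (MvPolynomial.X j) (herm (α j)) :=
  (Finset.mul_prod_erase _ _ (Finset.mem_univ i)).symm

lemma pderiv_prod_erase [DecidableEq ι] (α : ι → ℕ) (i : ι) :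
    MvPolynomial.pderiv i (∏ j ∈ Finset.univ.erase i,
      Polynomial.aeval (MvPolynomial.X j : MvPolynomial ι ℝ) (herm (α j))) = 0 := by
  refine Finset.prod_induction _ (fun f => MvPolynomial.pderiv i f = 0) ?_ (by simp) ?_
  · intro a b ha hb
    simp [Derivation.leibniz, ha, hb]
  · intro j hj
    exact pderiv_aeval_X_of_ne (Finset.ne_of_mem_erase hj).symm _

lemma prod_erase_congr_herm [DecidableEq ι] {α β : ι → ℕ} {i : ι} (h : ∀ j, j ≠ i → α j = β j) :
    ∏ j ∈ Finset.univ.erase i, Polynomial.aeval (MvPolynomial.X j : MvPolynomial ι ℝ) (herm (α j)) =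
    ∏ j ∈ Finset.univ.erase i, Polynomial.aeval (MvPolynomial.X j) (herm (β j)) :=
  Finset.prod_congr rfl fun j hj => by rw [h j (Finset.ne_of_mem_erase hj)]

lemma pderiv_hermMv [DecidableEq ι] (α : ι → ℕ) (i : ι) :
    MvPolynomial.pderiv i (hermMv α) =
      MvPolynomial.C (α i : ℝ) * hermMv (α - Pi.single i 1) := by
  rw [hermMv_eq_mul_erase α i, hermMv_eq_mul_erase _ i, Derivation.leibniz, pderiv_prod_erase,
    pderiv_aeval_X_self, derivative_herm,
    prod_erase_congr_herm (α := α - Pi.single i 1) (β := α) (fun j hj => by simp [hj])]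
  simp
  ring

/-- The raising operator touches a single factor. Combined with Stein's identity, its derivative
term cancels the identity part of the covariance, so Hermite moments see only the excess covariance.
-/
lemma hermMv_add_single [DecidableEq ι] (α : ι → ℕ) (i : ι) :
    hermMv (α + Pi.single i 1) =
      MvPolynomial.X i * hermMv α - MvPolynomial.pderiv i (hermMv α) := by
  rw [hermMv_eq_mul_erase α i, hermMv_eq_mul_erase _ i, Derivation.leibniz, pderiv_prod_erase,
    pderiv_aeval_X_self,
    prod_erase_congr_herm (α := α + Pi.single i 1) (β := α) (fun j hj => by simp [hj])]
  simp [herm_succ]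
  ring

/-- The Hermite moments of the law of `A g` satisfy the recursion given by `A Aᵀ - 1`. -/
lemma gaussMean_hermMv_add_single [DecidableEq ι] (A : Matrix ι κ ℝ) (α : ι → ℕ) (i : ι) :
    gaussMean A (hermMv (α + Pi.single i 1)) =
      ∑ j, (A * Aᵀ - 1 : Matrix ι ι ℝ) i j * (α j * gaussMean A (hermMv (α - Pi.single j 1))) := by
  rw [hermMv_add_single, gaussMean_sub, gaussMean_X_mul]
  simp_rw [pderiv_hermMv, gaussMean_C_mul, Matrix.sub_apply, sub_mul, Finset.sum_sub_distrib]
  simp [Matrix.one_apply]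

/-- The multi-indices of total degree at most `D`. -/
def multiIdx (ι : Type*) [Fintype ι] [DecidableEq ι] (D : ℕ) : Finset (ι → ℕ) :=
  (Fintype.piFinset fun _ : ι => Finset.range (D + 1)).filter fun α => ∑ j, α j ≤ D

lemma mem_multiIdx [DecidableEq ι] {D : ℕ} {α : ι → ℕ} :
    α ∈ multiIdx ι D ↔ ∑ j, α j ≤ D := by
  simp only [multiIdx, Finset.mem_filter, Fintype.mem_piFinset, Finset.mem_range,
    and_iff_right_iff_imp, Nat.lt_succ_iff]
  exact fun h j => (Finset.single_le_sum (fun _ _ => Nat.zero_le _) (Finset.mem_univ j)).trans h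

/-- The span of the Hermite products of degree at most `D`. -/
def hermSpan (ι : Type*) [Fintype ι] [DecidableEq ι] (D : ℕ) : Submodule ℝ (MvPolynomial ι ℝ) :=
  Submodule.span ℝ (hermMv '' (multiIdx ι D : Set (ι → ℕ)))

lemma hermSpan_mono [DecidableEq ι] {D D' : ℕ} (h : D ≤ D') : hermSpan ι D ≤ hermSpan ι D' :=
  Submodule.span_mono <| Set.image_mono fun _ hα => mem_multiIdx.2 ((mem_multiIdx.1 hα).trans h)

lemma sum_add_single [DecidableEq ι] (α : ι → ℕ) (i : ι) :
    ∑ j, (α + Pi.single i 1 : ι → ℕ) j = ∑ j, α j + 1 := by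
  simp [Finset.sum_add_distrib]

/-- Three-term recurrence: `X_i H_α` is `H_{α + e_i}` plus `α_i H_{α - e_i}`, and neither index
exceeds the degree of `α` by more than one. -/
lemma X_mul_mem_hermSpan [DecidableEq ι] {D : ℕ} (i : ι) {f : MvPolynomial ι ℝ}
    (hf : f ∈ hermSpan ι D) : MvPolynomial.X i * f ∈ hermSpan ι (D + 1) := by
  induction hf using Submodule.span_induction with
  | zero => simp
  | add f g _ _ hf hg => rw [mul_add]; exact add_mem hf hg
  | smul c f _ hf => rw [mul_smul_comm]; exact Submodule.smul_mem _ _ hf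
  | mem f hf =>
    obtain ⟨α, hα, rfl⟩ := hf
    have hα := mem_multiIdx.1 hα
    have h := hermMv_add_single α i
    rw [pderiv_hermMv] at h
    have e : MvPolynomial.X i * hermMv α = hermMv (α + Pi.single i 1) +
      (α i : ℝ) • hermMv (α - Pi.single i 1) := by
      rw [h, MvPolynomial.smul_eq_C_mul]; ring
    rw [e]
    refine add_mem (Submodule.subset_span ⟨_, mem_multiIdx.2 ?_, rfl⟩)
      (Submodule.smul_mem _ _ (Submodule.subset_span ⟨_, mem_multiIdx.2 ?_, rfl⟩))
    · rw [sum_add_single]; lia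
    · exact (Finset.sum_le_sum fun j _ => Nat.sub_le _ _).trans (hα.trans (Nat.le_succ _))

lemma monomial_mem_hermSpan [DecidableEq ι] (D : ℕ) (m : ι →₀ ℕ) (hm : ∑ j, m j = D) (c : ℝ) :
    MvPolynomial.monomial m c ∈ hermSpan ι D := by
  induction D generalizing m with
  | zero =>
    have : m = 0 := by
      ext j
      simpa using (Finset.sum_eq_zero_iff.1 hm) j (Finset.mem_univ j)
    subst this
    have e : MvPolynomial.monomial (0 : ι →₀ ℕ) c = c • hermMv (0 : ι → ℕ) := by
      rw [hermMv_zero, MvPolynomial.smul_eq_C_mul, mul_one]; rfl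
    rw [e]
    exact Submodule.smul_mem _ _ (Submodule.subset_span ⟨_, mem_multiIdx.2 (by simp), rfl⟩)
  | succ D ih =>
    obtain ⟨i, hi⟩ : ∃ i, m i ≠ 0 := by
      by_contra! h
      simp [h] at hm
    have hle : Finsupp.single i 1 ≤ m := Finsupp.single_le_iff.2 (Nat.one_le_iff_ne_zero.2 hi)
    have e : MvPolynomial.monomial m c =
        MvPolynomial.X i * MvPolynomial.monomial (m - Finsupp.single i 1) c := by
      rw [MvPolynomial.X, MvPolynomial.monomial_mul, add_tsub_cancel_of_le hle, one_mul]
    rw [e]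
    refine X_mul_mem_hermSpan i (ih _ ?_)
    have h2 : ∑ j, m j = ∑ j, (m - Finsupp.single i 1 : ι →₀ ℕ) j + 1 := by
      conv_lhs => rw [← tsub_add_cancel_of_le hle]
      simp only [Finsupp.coe_add, Pi.add_apply, Finset.sum_add_distrib]
      simp [Finsupp.single_apply]
    lia

/-- Every polynomial of degree at most `D` is a combination of the Hermite products of degree at
most `D`. -/
lemma exists_eq_sum_hermMv [DecidableEq ι] {D : ℕ} {f : MvPolynomial ι ℝ} (hf : f.totalDegree ≤ D) :
    ∃ c : (ι → ℕ) → ℝ, f = ∑ α ∈ multiIdx ι D, c α • hermMv α := by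
  have h : f ∈ hermSpan ι D := by
    rw [f.as_sum]
    refine sum_mem fun m hm => hermSpan_mono ?_ (monomial_mem_hermSpan _ m rfl _)
    refine le_trans ?_ ((MvPolynomial.le_totalDegree hm).trans hf)
    rw [Finsupp.sum_fintype _ _ (fun _ => rfl)]
  obtain ⟨c, hc⟩ := (Submodule.mem_span_image_finset_iff_exists_fun ℝ).1 h
  refine ⟨fun α => if h : α ∈ multiIdx ι D then c ⟨α, h⟩ else 0, ?_⟩
  rw [← hc, ← Finset.sum_attach (multiIdx ι D)]
  exact Finset.sum_congr rfl fun α _ => by simp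

end RobustTesting

namespace RobustTesting

/-! ### Hermite moments of spiked Gaussian laws -/

/-- The moments of a Gaussian of "variance" `a`, of either sign. -/
def spikeMoment (a : ℝ) : ℕ → ℝ
  | 0 => 1
  | 1 => 0
  | n + 2 => a * (n + 1) * spikeMoment a n

/-- The mixed Hermite moment of degree `q` in the spike direction and degree `j` in the label of a
centered Gaussian with covariance `1 + [[a, b], [b, 0]]`. -/
def spikeHerm (a b : ℝ) (q j : ℕ) : ℝ := b ^ j * q.descFactorial j * spikeMoment a (q - j)

/-- With `spikeHerm_succ_zero`, this is the closed-form side of the recursion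
`gaussMean_hermMv_add_single`: one identity lowers the label degree, the other the spike degree once
no label is left. -/
lemma spikeHerm_succ_right (a b : ℝ) (q j : ℕ) :
    spikeHerm a b q (j + 1) = b * q * spikeHerm a b (q - 1) j := by
  cases q with
  | zero => simp [spikeHerm]
  | succ q =>
    simp only [spikeHerm, Nat.succ_descFactorial_succ, Nat.add_sub_cancel, Nat.add_sub_add_right]
    push_cast
    ring

lemma spikeHerm_succ_zero (a b : ℝ) (q : ℕ) :
    spikeHerm a b (q + 1) 0 = a * q * spikeHerm a b (q - 1) 0 := by
  cases q with
  | zero => simp [spikeHerm, spikeMoment]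
  | succ q => simp [spikeHerm, spikeMoment]

/-- The covariance `[[a v vᵀ, b v], [b vᵀ, 0]]` in excess of the identity. -/
def spikeCov {d : ℕ} (a b : ℝ) (v : Fin d → ℝ) : Matrix (Fin d ⊕ Unit) (Fin d ⊕ Unit) ℝ :=
  Matrix.fromBlocks (a • Matrix.vecMulVec v v) (Matrix.of fun i _ => b * v i)
    (Matrix.of fun _ i => b * v i) 0

/-- The factor `β k` on both sides covers `β k = 0`, where truncated subtraction would leave a
spurious `v k`. -/
lemma prod_pow_sub_single {d : ℕ} (v : Fin d → ℝ) (β : Fin d → ℕ) (k : Fin d) :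
    β k * (v k * ∏ i, v i ^ (β i - (Pi.single k 1 : Fin d → ℕ) i)) = β k * ∏ i, v i ^ β i := by
  rcases Nat.eq_zero_or_pos (β k) with h | h
  · simp [h]
  congr 1
  rw [← Finset.mul_prod_erase _ _ (Finset.mem_univ k),
    ← Finset.mul_prod_erase Finset.univ (fun i => v i ^ β i) (Finset.mem_univ k), ← mul_assoc]
  congr 1
  · simp only [Pi.single_eq_same]
    rw [← pow_succ', Nat.sub_add_cancel h]
  · exact Finset.prod_congr rfl fun i hi => by simp [Finset.ne_of_mem_erase hi]

lemma sum_sub_single {d : ℕ} (β : Fin d → ℕ) (k : Fin d) (h : β k ≠ 0) :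
    ∑ i, (β i - (Pi.single k 1 : Fin d → ℕ) i) = ∑ i, β i - 1 := by
  rw [← Finset.add_sum_erase _ _ (Finset.mem_univ k),
    ← Finset.add_sum_erase Finset.univ β (Finset.mem_univ k)]
  have : ∑ i ∈ Finset.univ.erase k, (β i - (Pi.single k 1 : Fin d → ℕ) i) =
      ∑ i ∈ Finset.univ.erase k, β i :=
    Finset.sum_congr rfl fun i hi => by simp [Finset.ne_of_mem_erase hi]
  rw [this, Pi.single_eq_same]
  lia

variable {κ : Type*} [Fintype κ]

/-- Hermite moments of a spiked Gaussian law. -/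
lemma gaussMean_hermMv_spike {d : ℕ} (A : Matrix (Fin d ⊕ Unit) κ ℝ) (a b : ℝ) (v : Fin d → ℝ)
    (hA : A * Aᵀ = 1 + spikeCov a b v) (α : Fin d ⊕ Unit → ℕ) :
    gaussMean A (hermMv α) = (∏ k, v k ^ α (Sum.inl k)) *
      spikeHerm a b (∑ k, α (Sum.inl k)) (α (Sum.inr ())) := by
  have hrec := gaussMean_hermMv_add_single A
  rw [hA, add_sub_cancel_left] at hrec
  -- the terms of the recursion coming from the features
  have hfeat (α : Fin d ⊕ Unit → ℕ) (k : Fin d)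
      (ih : ∀ α' : Fin d ⊕ Unit → ℕ, ∑ i, α' i ≤ ∑ i, α i → gaussMean A (hermMv α') =
        (∏ k, v k ^ α' (Sum.inl k)) * spikeHerm a b (∑ k, α' (Sum.inl k)) (α' (Sum.inr ()))) :
      v k * (α (Sum.inl k) * gaussMean A (hermMv (α - Pi.single (Sum.inl k) 1))) =
        α (Sum.inl k) * ((∏ k, v k ^ α (Sum.inl k)) *
          spikeHerm a b (∑ k, α (Sum.inl k) - 1) (α (Sum.inr ()))) := by
    by_cases h0 : α (Sum.inl k) = 0
    · simp [h0]
    rw [ih (α - Pi.single (Sum.inl k) 1) (Finset.sum_le_sum fun j _ => Nat.sub_le _ _)]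
    have e (i : Fin d) : (α - Pi.single (Sum.inl k) 1 : Fin d ⊕ Unit → ℕ) (Sum.inl i) =
        α (Sum.inl i) - (Pi.single k 1 : Fin d → ℕ) i := by
      simp [Pi.single_apply]
    have e' : (α - Pi.single (Sum.inl k) 1 : Fin d ⊕ Unit → ℕ) (Sum.inr ()) = α (Sum.inr ()) := by
      simp
    simp_rw [e, e']
    rw [sum_sub_single (fun i => α (Sum.inl i)) k h0]
    have := prod_pow_sub_single v (fun i => α (Sum.inl i)) k
    linear_combination spikeHerm a b (∑ k, α (Sum.inl k) - 1) (α (Sum.inr ())) * this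
  generalize hN : ∑ i, α i = N
  induction N using Nat.strong_induction_on generalizing α with
  | _ N IH =>
    -- Label degree is removed first: the label row of `spikeCov` has zero label entry, so only
    -- feature derivatives occur. Afterwards the label term in a feature row drops out, its
    -- coefficient being the label degree.
    by_cases hy : α (Sum.inr ()) = 0
    swap
    · obtain ⟨β, rfl⟩ : ∃ β : Fin d ⊕ Unit → ℕ, α = β + Pi.single (Sum.inr ()) 1 := by
        refine ⟨α - Pi.single (Sum.inr ()) 1, (tsub_add_cancel_of_le ?_).symm⟩
        intro i
        by_cases hi : i = Sum.inr ()
        · subst hi; simpa using Nat.one_le_iff_ne_zero.2 hy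
        · simp [hi]
      rw [sum_add_single] at hN
      have ih : ∀ α' : Fin d ⊕ Unit → ℕ, ∑ i, α' i ≤ ∑ i, β i → _ :=
        fun α' h => IH _ (by lia) α' rfl
      rw [hrec, Fintype.sum_sum_type]
      simp only [spikeCov, Matrix.fromBlocks_apply₂₁, Matrix.fromBlocks_apply₂₂, Matrix.of_apply,
        Matrix.zero_apply, zero_mul, Finset.sum_const_zero, add_zero, mul_assoc]
      rw [← Finset.mul_sum, Finset.sum_congr rfl fun k _ => hfeat β k ih, ← Finset.sum_mul]
      simp only [Pi.add_apply, ne_eq, reduceCtorEq, not_false_eq_true, Pi.single_eq_of_ne, add_zero,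
        Pi.single_eq_same, spikeHerm_succ_right]
      push_cast
      ring
    · by_cases hx : ∃ k, α (Sum.inl k) ≠ 0
      · obtain ⟨k, hk⟩ := hx
        obtain ⟨β, rfl⟩ : ∃ β : Fin d ⊕ Unit → ℕ, α = β + Pi.single (Sum.inl k) 1 := by
          refine ⟨α - Pi.single (Sum.inl k) 1, (tsub_add_cancel_of_le ?_).symm⟩
          intro i
          by_cases hi : i = Sum.inl k
          · subst hi; simpa using Nat.one_le_iff_ne_zero.2 hk
          · simp [hi]
        have hβ : β (Sum.inr ()) = 0 := by simpa using hy
        rw [sum_add_single] at hN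
        have ih : ∀ α' : Fin d ⊕ Unit → ℕ, ∑ i, α' i ≤ ∑ i, β i → _ :=
          fun α' h => IH _ (by lia) α' rfl
        have e1 : ∑ i, (β + Pi.single (Sum.inl k) 1 : Fin d ⊕ Unit → ℕ) (Sum.inl i) =
            ∑ i, β (Sum.inl i) + 1 := by
          simp [Finset.sum_add_distrib, Pi.single_apply]
        have e2 : ∏ i, v i ^ (β + Pi.single (Sum.inl k) 1 : Fin d ⊕ Unit → ℕ) (Sum.inl i) =
            v k * ∏ i, v i ^ β (Sum.inl i) := by
          simp only [Pi.add_apply, pow_add, Finset.prod_mul_distrib]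
          rw [mul_comm]
          congr 1
          rw [Finset.prod_eq_single k] <;> simp +contextual
        rw [hrec, Fintype.sum_sum_type, e1, e2]
        simp only [spikeCov, Matrix.fromBlocks_apply₁₁, Matrix.fromBlocks_apply₁₂, Matrix.of_apply,
          Matrix.smul_apply, Matrix.vecMulVec_apply, smul_eq_mul, mul_assoc, hβ]
        simp only [Finset.univ_unique, Finset.sum_singleton]
        rw [← Finset.mul_sum, ← Finset.mul_sum,
          Finset.sum_congr rfl fun k _ => hfeat β k ih, ← Finset.sum_mul]
        have hu : β (Sum.inr default) = 0 := hβ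
        rw [hu]
        simp only [Pi.add_apply, ne_eq, reduceCtorEq, not_false_eq_true, Pi.single_eq_of_ne,
          hβ, spikeHerm_succ_zero, add_zero]
        push_cast
        ring
      · push Not at hx
        have : α = 0 := by
          ext i
          rcases i with k | u
          · exact hx k
          · exact hy
        subst this
        simp [hermMv_zero, gaussMean_one, spikeHerm, spikeMoment]

/-! ### Factors of the covariances -/

/-- A matrix `A` for which `A g` has features `g + (τ - 1) ⟨g, v⟩ v` and label `c ⟨g, v⟩ + ρ h`. -/
def spikeFactor {d : ℕ} (v : Fin d → ℝ) (τ c ρ : ℝ) : Matrix (Fin d ⊕ Unit) (Fin d ⊕ Unit) ℝ :=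
  Matrix.fromBlocks (1 + (τ - 1) • Matrix.vecMulVec v v) 0 (Matrix.of fun _ i => c * v i)
    (Matrix.of fun _ _ => ρ)

lemma spikeFactor_mul_transpose {d : ℕ} {v : Fin d → ℝ} (hv : v ⬝ᵥ v = 1) (τ c ρ : ℝ) :
    spikeFactor v τ c ρ * (spikeFactor v τ c ρ)ᵀ =
      Matrix.fromBlocks (1 + (τ ^ 2 - 1) • Matrix.vecMulVec v v) (Matrix.of fun i _ => τ * c * v i)
        (Matrix.of fun _ i => τ * c * v i) (Matrix.of fun _ _ => c ^ 2 + ρ ^ 2) := by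
  have hvv : Matrix.vecMulVec v v * Matrix.vecMulVec v v = Matrix.vecMulVec v v := by
    rw [Matrix.vecMulVec_mul_vecMulVec, hv, one_smul]
  have hv' : ∑ i, v i * v i = 1 := hv
  have hcol (i : Fin d) : ∑ j, (1 + (τ - 1) • Matrix.vecMulVec v v : Matrix (Fin d) (Fin d) ℝ) i j * (c * v j)
      = τ * c * v i := by
    simp only [Matrix.add_apply, Matrix.one_apply, Matrix.smul_apply, Matrix.vecMulVec_apply,
      smul_eq_mul, add_mul, Finset.sum_add_distrib, ite_mul, one_mul, zero_mul,
      Finset.sum_ite_eq, Finset.mem_univ, if_true]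
    have : ∑ j, (τ - 1) * (v i * v j) * (c * v j) = (τ - 1) * c * v i * ∑ j, v j * v j := by
      rw [Finset.mul_sum]; exact Finset.sum_congr rfl fun _ _ => by ring
    rw [this, hv']
    ring
  rw [spikeFactor, Matrix.fromBlocks_transpose, Matrix.fromBlocks_multiply]
  congr 1
  · simp only [Matrix.transpose_add, Matrix.transpose_one, Matrix.transpose_smul,
      Matrix.transpose_vecMulVec, Matrix.transpose_zero, Matrix.mul_zero, add_zero]
    simp only [add_mul, mul_add, Matrix.mul_one, Matrix.one_mul, Matrix.smul_mul, Matrix.mul_smul,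
      hvv]
    module
  · ext i u
    simp only [Matrix.add_apply, Matrix.mul_apply, Matrix.transpose_apply, Matrix.of_apply,
      Matrix.zero_apply, zero_mul, Finset.sum_const_zero, add_zero]
    exact hcol i
  · ext u i
    simp only [Matrix.add_apply, Matrix.mul_apply, Matrix.transpose_apply, Matrix.of_apply,
      Matrix.zero_apply, mul_zero, Finset.sum_const_zero, add_zero]
    rw [← hcol i]
    exact Finset.sum_congr rfl fun j _ => mul_comm _ _
  · ext u w
    simp only [Matrix.add_apply, Matrix.mul_apply, Matrix.transpose_apply, Matrix.of_apply,
      Finset.univ_unique, Finset.sum_singleton]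
    have : ∑ j, c * v j * (c * v j) = c ^ 2 * ∑ j, v j * v j := by
      rw [Finset.mul_sum]; exact Finset.sum_congr rfl fun _ _ => by ring
    rw [this, hv']
    ring

lemma spikeFactor_mul_transpose_eq {d : ℕ} {v : Fin d → ℝ} (hv : v ⬝ᵥ v = 1) {τ c ρ a b : ℝ}
    (ha : τ ^ 2 = 1 + a) (hb : τ * c = b) (hc : c ^ 2 + ρ ^ 2 = 1) :
    spikeFactor v τ c ρ * (spikeFactor v τ c ρ)ᵀ = 1 + spikeCov a b v := by
  rw [spikeFactor_mul_transpose hv, ha, hb, hc, spikeCov, ← Matrix.fromBlocks_one,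
    Matrix.fromBlocks_add]
  congr 1
  · simp
  · simp
  · simp
  · ext u w; simp

end RobustTesting

namespace RobustTesting

/-! ### Gaussian laws as images of the standard Gaussian -/

variable {ι : Type*} [Fintype ι]

/-- The law of `A g`, `g` standard Gaussian. -/
def gaussLaw (A : Matrix ι ι ℝ) : Measure (EuclideanSpace ℝ ι) :=
  (stdPi ι).map fun g => WithLp.toLp 2 (A *ᵥ g)

lemma measurable_toLp_mulVec (A : Matrix ι ι ℝ) :
    Measurable fun g : ι → ℝ => (WithLp.toLp 2 (A *ᵥ g) : EuclideanSpace ℝ ι) := by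
  fun_prop

instance (A : Matrix ι ι ℝ) : IsProbabilityMeasure (gaussLaw A) :=
  Measure.isProbabilityMeasure_map (measurable_toLp_mulVec A).aemeasurable

lemma charFun_gaussLaw (A : Matrix ι ι ℝ) (t : EuclideanSpace ℝ ι) :
    charFun (gaussLaw A) t =
      Complex.exp (-((t.ofLp ⬝ᵥ ((A * Aᵀ) *ᵥ t.ofLp) : ℝ) : ℂ) / 2) := by
  have h1 : charFun (gaussLaw A) t =
      charFun (stdGaussian (EuclideanSpace ℝ ι)) (WithLp.toLp 2 (Aᵀ *ᵥ t.ofLp)) := by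
    rw [charFun_apply, charFun_apply, gaussLaw, ← map_pi_eq_stdGaussian,
      integral_map (measurable_toLp_mulVec A).aemeasurable (by fun_prop),
      integral_map (by fun_prop) (by fun_prop)]
    congr 1 with g
    congr 3
    simp only [EuclideanSpace.inner_eq_star_dotProduct, star_trivial]
    rw [Matrix.dotProduct_mulVec, Matrix.mulVec_transpose]
  rw [h1, charFun_stdGaussian, ← Complex.ofReal_pow, EuclideanSpace.real_norm_sq_eq]
  have h2 : ∑ i, (Aᵀ *ᵥ t.ofLp) i ^ 2 = t.ofLp ⬝ᵥ ((A * Aᵀ) *ᵥ t.ofLp) := by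
    rw [← Matrix.mulVec_mulVec, Matrix.dotProduct_mulVec, ← Matrix.mulVec_transpose]
    exact Finset.sum_congr rfl fun i _ => sq _
  rw [← h2]

lemma posSemidef_mul_transpose (A : Matrix ι ι ℝ) : (A * Aᵀ).PosSemidef := by
  simpa using Matrix.posSemidef_self_mul_conjTranspose A

/-- The characteristic function of `A g` depends on `A` only through `A * Aᵀ`, so any convenient
square factor of the covariance may be used. -/
lemma multivariateGaussian_eq_gaussLaw [DecidableEq ι] {S : Matrix ι ι ℝ} (A : Matrix ι ι ℝ)
    (h : A * Aᵀ = S) : multivariateGaussian 0 S = gaussLaw A := by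
  subst h
  apply Measure.ext_of_charFun (E := EuclideanSpace ℝ ι)
  ext t
  rw [charFun_gaussLaw, charFun_multivariateGaussian (posSemidef_mul_transpose A)]
  congr 1
  simp
  ring

lemma sphere_dotProduct_self {d : ℕ} (v : UnitSphere d) : v.1.ofLp ⬝ᵥ v.1.ofLp = 1 := by
  have h := EuclideanSpace.real_norm_sq_eq v.1
  rw [norm_eq_of_mem_sphere] at h
  rw [dotProduct]
  simp_rw [← sq]
  linarith

lemma vecMulVec_mulVec_self {d : ℕ} (v x : Fin d → ℝ) :
    Matrix.vecMulVec v v *ᵥ x = (v ⬝ᵥ x) • v := by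
  ext i
  simp [Matrix.vecMulVec_mulVec, mul_comm]

lemma hardCov_quadForm {d : ℕ} (κ : ℝ) (v : UnitSphere d) (x : Fin d → ℝ) :
    x ⬝ᵥ (hardCov κ v *ᵥ x) = x ⬝ᵥ x - (1 - 1 / κ) * (v.1.ofLp ⬝ᵥ x) ^ 2 := by
  rw [hardCov, Matrix.sub_mulVec, Matrix.smul_mulVec, vecMulVec_mulVec_self, Matrix.one_mulVec,
    dotProduct_sub, dotProduct_smul, dotProduct_smul, dotProduct_comm x v.1.ofLp]
  simp only [smul_eq_mul]
  ring

/-- It is the feature block of `A * Aᵀ` for the factor that contracts the direction `v` by `κ ^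
(-1/2)`. -/
lemma hardCov_posSemidef {d : ℕ} {κ : ℝ} (hκ : 1 ≤ κ) (v : UnitSphere d) :
    (hardCov κ v).PosSemidef := by
  have h0 : 0 < κ := by linarith
  have hv := sphere_dotProduct_self v
  have e := congrArg Matrix.toBlocks₁₁ (spikeFactor_mul_transpose hv (√κ)⁻¹ 0 0)
  rw [Matrix.toBlocks_fromBlocks₁₁] at e
  have h := (posSemidef_mul_transpose (spikeFactor v.1.ofLp (√κ)⁻¹ 0 0)).submatrix
    (Sum.inl : Fin d → Fin d ⊕ Unit)
  change (Matrix.toBlocks₁₁ _).PosSemidef at h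
  rw [e, inv_pow, Real.sq_sqrt h0.le] at h
  convert h using 1
  rw [hardCov]
  module

lemma linearModel_eq {d : ℕ} (S : Matrix (Fin d) (Fin d) ℝ) (b : EuclideanSpace ℝ (Fin d))
    (σ : ℝ) : linearModel S b σ =
      ((multivariateGaussian 0 S).prod (gaussianReal 0 (σ ^ 2).toNNReal)).map
        fun p => WithLp.toLp 2 (Sum.elim (fun i => p.1 i) (fun _ => inner ℝ p.1 b + p.2)) := by
  have h : (σ ^ 2).toNNReal = ⟨σ ^ 2, sq_nonneg σ⟩ := Real.toNNReal_of_nonneg _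
  rw [h]
  rfl

lemma measurable_linearModel_map {d : ℕ} (b : EuclideanSpace ℝ (Fin d)) :
    Measurable fun p : EuclideanSpace ℝ (Fin d) × ℝ => (WithLp.toLp 2
      (Sum.elim (fun i => p.1 i) (fun _ => inner ℝ p.1 b + p.2)) : Sample d) := by
  refine (WithLp.measurable_toLp 2 _).comp (measurable_pi_iff.2 ?_)
  rintro (i | u)
  · simp only [Sum.elim_inl]; fun_prop
  · simp only [Sum.elim_inr]; fun_prop

instance {d : ℕ} (S : Matrix (Fin d) (Fin d) ℝ) (b : EuclideanSpace ℝ (Fin d)) (σ : ℝ) :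
    IsProbabilityMeasure (linearModel S b σ) := by
  rw [linearModel_eq]
  exact Measure.isProbabilityMeasure_map (measurable_linearModel_map b).aemeasurable

/-- Pairing a test vector `(x, y)` with the sample gives `⟨X, x + y b⟩ + y η`, a sum of two
independent terms, so the characteristic function factors. -/
lemma charFun_linearModel {d : ℕ} {S : Matrix (Fin d) (Fin d) ℝ} (hS : S.PosSemidef)
    (b : EuclideanSpace ℝ (Fin d)) (σ : ℝ) (t : Sample d) :
    charFun (linearModel S b σ) t =
      Complex.exp (-(((((fun i => t (Sum.inl i)) + t (Sum.inr ()) • b.ofLp) ⬝ᵥ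
        (S *ᵥ ((fun i => t (Sum.inl i)) + t (Sum.inr ()) • b.ofLp)) +
          σ ^ 2 * t (Sum.inr ()) ^ 2 : ℝ)) : ℂ) / 2) := by
  set w : EuclideanSpace ℝ (Fin d) :=
    WithLp.toLp 2 ((fun i => t (Sum.inl i)) + t (Sum.inr ()) • b.ofLp) with hw
  have h1 : charFun (linearModel S b σ) t = charFun (multivariateGaussian 0 S) w *
      charFun (gaussianReal 0 (σ ^ 2).toNNReal) (t (Sum.inr ())) := by
    rw [charFun_apply, charFun_apply, charFun_apply, linearModel_eq,
      integral_map (measurable_linearModel_map b).aemeasurable (by fun_prop), ← integral_prod_mul]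
    congr 1 with p
    rw [← Complex.exp_add]
    congr 1
    rw [← add_mul, ← Complex.ofReal_add]
    congr 2
    simp only [EuclideanSpace.inner_eq_star_dotProduct, star_trivial, hw, dotProduct,
      Fintype.sum_sum_type, Pi.add_apply, Pi.smul_apply, smul_eq_mul, Sum.elim_inl,
      Sum.elim_inr, add_mul, Finset.sum_add_distrib, Finset.univ_unique, Finset.sum_singleton]
    simp only [Finset.mul_sum, mul_add, mul_assoc, RCLike.inner_apply, conj_trivial]
    ring_nf
  rw [h1, charFun_multivariateGaussian hS, charFun_gaussianReal, ← Complex.exp_add]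
  congr 1
  simp [hw, max_eq_left (sq_nonneg σ)]
  ring

/-- Contracting the direction `v` of a standard Gaussian `g` by `κ ^ (-1/2)` gives the features `X`.
Then `⟨X, α √κ v⟩ = α ⟨g, v⟩`, which is why the label coefficient is `α`. -/
lemma linearModel_hard_eq_gaussLaw {d : ℕ} {κ : ℝ} (hκ : 1 ≤ κ) (α σ : ℝ) (v : UnitSphere d) :
    linearModel (hardCov κ v) ((α * √κ) • v.1) σ =
      gaussLaw (spikeFactor v.1.ofLp (√κ)⁻¹ α σ) := by
  have h0 : 0 < κ := by linarith
  have hs : √κ ^ 2 = κ := Real.sq_sqrt h0.le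
  have hs0 : √κ ≠ 0 := (Real.sqrt_pos.2 h0).ne'
  apply Measure.ext_of_charFun (E := Sample d)
  ext t
  rw [charFun_gaussLaw, charFun_linearModel (hardCov_posSemidef hκ v),
    spikeFactor_mul_transpose (sphere_dotProduct_self v)]
  congr 4
  obtain ⟨x, y, hxy⟩ : ∃ (x : Fin d → ℝ) (y : ℝ), t.ofLp = Sum.elim x fun _ => y :=
    ⟨fun i => t (Sum.inl i), t (Sum.inr ()), by ext (i | u) <;> rfl⟩
  have hv := sphere_dotProduct_self v
  rw [hardCov_quadForm, hxy, Matrix.fromBlocks_mulVec]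
  simp only [Sum.elim_inl, Sum.elim_inr, Function.comp_def]
  have hx : (1 + ((√κ)⁻¹ ^ 2 - 1) • Matrix.vecMulVec v.1.ofLp v.1.ofLp) *ᵥ x =
      x + ((√κ)⁻¹ ^ 2 - 1) • (v.1.ofLp ⬝ᵥ x) • v.1.ofLp := by
    rw [Matrix.add_mulVec, Matrix.smul_mulVec, vecMulVec_mulVec_self, Matrix.one_mulVec]
  have hc : (Matrix.of fun (i : Fin d) (_ : Unit) => (√κ)⁻¹ * α * v.1 i) *ᵥ (fun _ => y) =
      ((√κ)⁻¹ * α * y) • v.1.ofLp := by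
    ext i; simp [Matrix.mulVec, dotProduct]; ring
  have hr : (Matrix.of fun (_ : Unit) (i : Fin d) => (√κ)⁻¹ * α * v.1 i) *ᵥ x =
      fun _ => (√κ)⁻¹ * α * (v.1.ofLp ⬝ᵥ x) := by
    ext i; simp [Matrix.mulVec, dotProduct, Finset.mul_sum, mul_assoc]
  have hy : (Matrix.of fun (_ _ : Unit) => α ^ 2 + σ ^ 2) *ᵥ (fun _ => y) =
      fun _ => (α ^ 2 + σ ^ 2) * y := by
    ext i; simp [Matrix.mulVec, dotProduct]
  rw [hx, hc, hr, hy, sumElim_dotProduct_sumElim]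
  simp only [dotProduct_add, add_dotProduct, dotProduct_smul, smul_dotProduct, smul_eq_mul, hv,
    WithLp.ofLp_smul, dotProduct_comm x v.1.ofLp]
  simp only [dotProduct, Finset.univ_unique, Finset.sum_singleton]
  have hi : (√κ)⁻¹ ^ 2 = 1 / κ := by rw [inv_pow, hs, one_div]
  have hi' : √κ * (1 / κ) = (√κ)⁻¹ := by
    field_simp; exact hs
  rw [hi]
  have h3 : (√κ)^2 * (1/κ) = 1 := by rw [hs]; field_simp
  linear_combination (2 * α * y * (∑ i, v.1.ofLp i * x i)) * hi' + α^2 * y^2 * h3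

end RobustTesting

namespace RobustTesting

/-! ### Scaled Hermite products -/

/-- The product of the Hermite polynomials of degrees `β j` in the variables `z j / s j`. -/
def scaledHerm {ι : Type*} [Fintype ι] (s : ι → ℝ) (β : ι → ℕ) (z : EuclideanSpace ℝ ι) : ℝ :=
  ∏ j, (herm (β j)).eval (z j / s j)

/-- The matrix `A` with its `i`-th row divided by `s i`. -/
def rowDiv {ι : Type*} (s : ι → ℝ) (A : Matrix ι ι ℝ) : Matrix ι ι ℝ :=
  Matrix.of fun i k => A i k / s i

section
variable {ι : Type*} [Fintype ι]

lemma continuous_scaledHerm (s : ι → ℝ) (β : ι → ℕ) : Continuous (scaledHerm s β) := by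
  unfold scaledHerm
  refine continuous_finsetProd _ fun j _ => (Polynomial.continuous _).comp ?_
  fun_prop

lemma continuous_scaledHerm_mul (s : ι → ℝ) (β β' : ι → ℕ) :
    Continuous fun z => scaledHerm s β z * scaledHerm s β' z :=
  (continuous_scaledHerm s β).mul (continuous_scaledHerm s β')

lemma scaledHerm_toLp_mulVec (s : ι → ℝ) (A : Matrix ι ι ℝ) (β : ι → ℕ) (g : ι → ℝ) :
    scaledHerm s β (WithLp.toLp 2 (A *ᵥ g)) =
      MvPolynomial.eval (rowDiv s A *ᵥ g) (hermMv β) := by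
  rw [eval_hermMv, scaledHerm]
  refine Finset.prod_congr rfl fun j _ => ?_
  congr 1
  simp only [Matrix.mulVec, dotProduct, Finset.sum_div, rowDiv, Matrix.of_apply]
  exact Finset.sum_congr rfl fun k _ => by ring

lemma integral_scaledHerm_gaussLaw (s : ι → ℝ) (A : Matrix ι ι ℝ) (β : ι → ℕ) :
    ∫ z, scaledHerm s β z ∂gaussLaw A = gaussMean (rowDiv s A) (hermMv β) := by
  rw [gaussLaw, integral_map (measurable_toLp_mulVec A).aemeasurable
    (continuous_scaledHerm s β).aestronglyMeasurable, gaussMean]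
  simp_rw [scaledHerm_toLp_mulVec]

lemma integrable_scaledHerm_gaussLaw (s : ι → ℝ) (A : Matrix ι ι ℝ) (β : ι → ℕ) :
    Integrable (scaledHerm s β) (gaussLaw A) := by
  rw [gaussLaw, integrable_map_measure (continuous_scaledHerm s β).aestronglyMeasurable
    (measurable_toLp_mulVec A).aemeasurable]
  refine (integrable_eval_mulVec (rowDiv s A) (hermMv β)).congr
    (Filter.Eventually.of_forall fun g => ?_)
  exact (scaledHerm_toLp_mulVec s A β g).symm

lemma scaledHerm_toLp_diagonal [DecidableEq ι] {s : ι → ℝ} (hs : ∀ i, s i ≠ 0) (β : ι → ℕ)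
    (g : ι → ℝ) : scaledHerm s β (WithLp.toLp 2 (Matrix.diagonal s *ᵥ g)) =
      ∏ j, (herm (β j)).eval (g j) := by
  refine Finset.prod_congr rfl fun j _ => ?_
  congr 1
  simp [Matrix.mulVec_diagonal, mul_div_cancel_left₀ _ (hs j)]

lemma integrable_scaledHerm_mul_diagonal [DecidableEq ι] {s : ι → ℝ} (hs : ∀ i, s i ≠ 0)
    (β β' : ι → ℕ) :
    Integrable (fun z => scaledHerm s β z * scaledHerm s β' z)
      (gaussLaw (Matrix.diagonal s)) := by
  rw [gaussLaw, integrable_map_measure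
    (continuous_scaledHerm_mul s β β').aestronglyMeasurable (measurable_toLp_mulVec _).aemeasurable]
  refine (integrable_eval_stdPi (hermMv β * hermMv β')).congr
    (Filter.Eventually.of_forall fun g => ?_)
  simp only [map_mul, eval_hermMv, Function.comp_apply, scaledHerm_toLp_diagonal hs]

/-- Orthogonality of the scaled Hermite products. -/
lemma integral_scaledHerm_mul_diagonal [DecidableEq ι] {s : ι → ℝ} (hs : ∀ i, s i ≠ 0)
    (β β' : ι → ℕ) :
    ∫ z, scaledHerm s β z * scaledHerm s β' z ∂gaussLaw (Matrix.diagonal s) =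
      if β = β' then ∏ j, ((β j).factorial : ℝ) else 0 := by
  rw [gaussLaw, integral_map (measurable_toLp_mulVec _).aemeasurable
    (continuous_scaledHerm_mul s β β').aestronglyMeasurable]
  simp_rw [scaledHerm_toLp_diagonal hs, ← Finset.prod_mul_distrib]
  rw [integral_fintype_prod_eq_prod
    (fun j (x : ℝ) => (herm (β j)).eval x * (herm (β' j)).eval x)]
  simp_rw [integral_herm_mul_herm]
  split_ifs with h
  · simp [h]
  · obtain ⟨j, hj⟩ := Function.ne_iff.1 h
    exact Finset.prod_eq_zero (Finset.mem_univ j) (if_neg hj)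

end

/-! ### The laws of one sample -/

/-- The scale `(1, …, 1, s)` of the coordinates of one sample. -/
def labelScale (d : ℕ) (s : ℝ) : Fin d ⊕ Unit → ℝ := Sum.elim (fun _ => 1) fun _ => s

lemma labelScale_ne_zero {d : ℕ} {s : ℝ} (hs : s ≠ 0) (i : Fin d ⊕ Unit) :
    labelScale d s i ≠ 0 := by
  rcases i with i | u
  · exact one_ne_zero
  · exact hs

lemma rowDiv_spikeFactor {d : ℕ} (s : ℝ) (v : Fin d → ℝ) (τ c ρ : ℝ) :
    rowDiv (labelScale d s) (spikeFactor v τ c ρ) = spikeFactor v τ (c / s) (ρ / s) := by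
  ext (i | i) (k | k) <;> simp [rowDiv, labelScale, spikeFactor]
  ring

/-- The standard deviation of the label. -/
def labelDev (α σ : ℝ) : ℝ := √(α ^ 2 + σ ^ 2)

lemma labelDev_sq (α σ : ℝ) : labelDev α σ ^ 2 = α ^ 2 + σ ^ 2 := Real.sq_sqrt (by positivity)

lemma labelDev_pos {α σ : ℝ} (hα : 0 < α) : 0 < labelDev α σ := Real.sqrt_pos.2 (by positivity)

lemma nullOne_eq_gaussLaw (d : ℕ) (α σ : ℝ) :
    nullOne d α σ = gaussLaw (Matrix.diagonal (labelScale d (labelDev α σ))) := by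
  refine multivariateGaussian_eq_gaussLaw _ ?_
  rw [Matrix.diagonal_transpose, Matrix.diagonal_mul_diagonal]
  ext (i | i) (k | k)
  · simp [Matrix.diagonal_apply, Matrix.one_apply, labelScale]
  · simp
  · simp
  · simp [labelScale, ← sq, labelDev_sq]

/-- The standard deviation of the corruption along the spike. -/
def corrDev (ε κ : ℝ) : ℝ := √(1 + (1 - ε) / ε * (1 - 1 / κ))

/-- The coefficient of the label of the corruption along the spike. -/
def corrCoeff (ε κ α : ℝ) : ℝ := -((1 - ε) / ε) * (α * (√κ)⁻¹) / corrDev ε κ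

/-- The standard deviation of the label noise of the corruption. -/
def corrNoise (ε κ α σ : ℝ) : ℝ := √(α ^ 2 + σ ^ 2 - corrCoeff ε κ α ^ 2)

section
variable {ε κ α σ : ℝ}

lemma ParamRange.kappa_pos (h : ParamRange ε κ α σ) : 0 < κ := by linarith [h.one_le_kappa]

lemma ParamRange.ratio_pos (h : ParamRange ε κ α σ) : 0 < (1 - ε) / ε :=
  div_pos (by linarith [h.eps_lt]) h.eps_pos

lemma ParamRange.ratio_le (h : ParamRange ε κ α σ) : (1 - ε) / ε ≤ κ := by
  rw [div_le_iff₀ h.eps_pos]; linarith [h.eps_kappa]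

lemma ParamRange.corrDev_sq (h : ParamRange ε κ α σ) :
    corrDev ε κ ^ 2 = 1 + (1 - ε) / ε * (1 - 1 / κ) := by
  refine Real.sq_sqrt ?_
  have h1 : 1 / κ ≤ 1 := (div_le_one h.kappa_pos).2 h.one_le_kappa
  have := mul_nonneg h.ratio_pos.le (sub_nonneg.2 h1)
  linarith

lemma ParamRange.ratio_le_corrDev_sq (h : ParamRange ε κ α σ) :
    (1 - ε) / ε ≤ corrDev ε κ ^ 2 := by
  rw [h.corrDev_sq]
  have : (1 - ε) / ε * (1 / κ) ≤ 1 := by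
    rw [mul_one_div]; exact (div_le_one h.kappa_pos).2 h.ratio_le
  linarith

lemma ParamRange.corrDev_pos (h : ParamRange ε κ α σ) : 0 < corrDev ε κ := by
  have h1 : 0 < corrDev ε κ ^ 2 := h.ratio_pos.trans_le h.ratio_le_corrDev_sq
  exact lt_of_le_of_ne (Real.sqrt_nonneg _) fun h0 => by
    rw [← h0] at h1; simp at h1

/-- This makes the label noise variance of the corruption nonnegative. With `r = (1 - ε) / ε` and `τ
= corrDev ε κ`, the left side is `α²` times `r / κ` times `r / τ²`. The bound `r ≤ κ` makes the
first ratio at most one, and also the second, as `τ² = 1 + r - r / κ`. -/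
lemma ParamRange.corrCoeff_sq_le (h : ParamRange ε κ α σ) : corrCoeff ε κ α ^ 2 ≤ α ^ 2 := by
  have hr := h.ratio_pos
  have e : corrCoeff ε κ α ^ 2 = α ^ 2 * ((((1 - ε) / ε) / κ) * ((1 - ε) / ε / corrDev ε κ ^ 2)) := by
    rw [corrCoeff, div_pow, mul_pow, mul_pow, inv_pow, Real.sq_sqrt h.kappa_pos.le]
    ring
  rw [e]
  have h1 : (1 - ε) / ε / κ ≤ 1 := (div_le_one h.kappa_pos).2 h.ratio_le
  have h2 : (1 - ε) / ε / corrDev ε κ ^ 2 ≤ 1 :=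
    (div_le_one (pow_pos h.corrDev_pos 2)).2 h.ratio_le_corrDev_sq
  have h3 : 0 ≤ (1 - ε) / ε / corrDev ε κ ^ 2 := by positivity
  have := mul_le_one₀ h1 h3 h2
  nlinarith [sq_nonneg α]

lemma ParamRange.corrNoise_sq (h : ParamRange ε κ α σ) :
    corrCoeff ε κ α ^ 2 + corrNoise ε κ α σ ^ 2 = α ^ 2 + σ ^ 2 := by
  rw [corrNoise, Real.sq_sqrt]
  · ring
  · nlinarith [h.corrCoeff_sq_le, sq_nonneg σ]

lemma ParamRange.corrDev_mul_corrCoeff (h : ParamRange ε κ α σ) :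
    corrDev ε κ * corrCoeff ε κ α = -((1 - ε) / ε) * (α * (√κ)⁻¹) := by
  rw [corrCoeff, mul_div_cancel₀ _ h.corrDev_pos.ne']

/-- The explicit factor serves twice: it proves positive semidefiniteness, and it writes the
corruption as a linear image of the standard Gaussian. -/
lemma ParamRange.corrupt_factor (h : ParamRange ε κ α σ) {d : ℕ} (v : UnitSphere d) :
    spikeFactor v.1.ofLp (corrDev ε κ) (corrCoeff ε κ α) (corrNoise ε κ α σ) *
      (spikeFactor v.1.ofLp (corrDev ε κ) (corrCoeff ε κ α) (corrNoise ε κ α σ))ᵀ =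
      corruptionCov ε κ (α * √κ) σ v := by
  have hκ := h.kappa_pos
  have hs : √κ * √κ = κ := Real.mul_self_sqrt hκ.le
  have hs0 : √κ ≠ 0 := (Real.sqrt_pos.2 hκ).ne'
  have e1 : α * √κ / κ = α * (√κ)⁻¹ := by
    field_simp; rw [sq, hs]
  have e2 : (α * √κ) ^ 2 / κ = α ^ 2 := by
    rw [mul_pow, sq (√κ), hs]; field_simp
  rw [spikeFactor_mul_transpose (sphere_dotProduct_self v), h.corrDev_sq, h.corrDev_mul_corrCoeff,
    h.corrNoise_sq, corruptionCov, e1, e2, add_sub_cancel_left]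

/-- The spike of the clean samples in the direction of `v`. -/
def cleanVar (κ : ℝ) : ℝ := 1 / κ - 1

/-- The correlation of the normalised label with the spike. -/
def cleanCorr (κ α σ : ℝ) : ℝ := α * (√κ)⁻¹ / labelDev α σ

/-- The mixed Hermite moments of the mixture. -/
def mixHerm (ε a b : ℝ) (q j : ℕ) : ℝ :=
  (1 - ε) * spikeHerm a b q j + ε * spikeHerm (-((1 - ε) / ε) * a) (-((1 - ε) / ε) * b) q j

instance (ε κ α σ : ℝ) (d : ℕ) (v : UnitSphere d) :
    IsProbabilityMeasure ((hardInstance d ε κ α σ).corruption v) := by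
  unfold hardInstance; infer_instance

lemma ParamRange.isProbabilityMeasure_mixture (h : ParamRange ε κ α σ) {d : ℕ}
    (v : UnitSphere d) : IsProbabilityMeasure ((hardInstance d ε κ α σ).mixture ε σ v) := by
  constructor
  simp only [Choice.mixture, Measure.add_apply, Measure.smul_apply, measure_univ, smul_eq_mul,
    mul_one]
  rw [← ENNReal.ofReal_add (by linarith [h.eps_lt]) h.eps_pos.le]
  simp

lemma ParamRange.mixture_eq (h : ParamRange ε κ α σ) {d : ℕ} (v : UnitSphere d) :
    (hardInstance d ε κ α σ).mixture ε σ v =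
      ENNReal.ofReal (1 - ε) • gaussLaw (spikeFactor v.1.ofLp (√κ)⁻¹ α σ) +
      ENNReal.ofReal ε • gaussLaw
        (spikeFactor v.1.ofLp (corrDev ε κ) (corrCoeff ε κ α) (corrNoise ε κ α σ)) := by
  rw [Choice.mixture]
  simp only [hardInstance]
  rw [linearModel_hard_eq_gaussLaw h.one_le_kappa,
    multivariateGaussian_eq_gaussLaw _ (h.corrupt_factor v)]

lemma ParamRange.integrable_scaledHerm_mixture (h : ParamRange ε κ α σ) {d : ℕ}
    (v : UnitSphere d) (s : Fin d ⊕ Unit → ℝ) (β : Fin d ⊕ Unit → ℕ) :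
    Integrable (scaledHerm s β) ((hardInstance d ε κ α σ).mixture ε σ v) := by
  rw [h.mixture_eq]
  exact ((integrable_scaledHerm_gaussLaw _ _ _).smul_measure ENNReal.ofReal_ne_top).add_measure
    ((integrable_scaledHerm_gaussLaw _ _ _).smul_measure ENNReal.ofReal_ne_top)

/-- The Hermite moments of one sample of the alternative, given `v`. -/
lemma ParamRange.integral_scaledHerm_mixture (h : ParamRange ε κ α σ) {d : ℕ}
    (v : UnitSphere d) (β : Fin d ⊕ Unit → ℕ) :
    ∫ z, scaledHerm (labelScale d (labelDev α σ)) β z ∂(hardInstance d ε κ α σ).mixture ε σ v =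
      (∏ k, v.1 k ^ β (Sum.inl k)) * mixHerm ε (cleanVar κ) (cleanCorr κ α σ)
        (∑ k, β (Sum.inl k)) (β (Sum.inr ())) := by
  have hs := labelDev_pos (σ := σ) h.alpha_pos
  have hs2 := labelDev_sq α σ
  have hs2' : 0 < labelDev α σ ^ 2 := by positivity
  have hκ := h.kappa_pos
  have hv := sphere_dotProduct_self v
  rw [h.mixture_eq, integral_add_measure
    ((integrable_scaledHerm_gaussLaw _ _ _).smul_measure ENNReal.ofReal_ne_top)
    ((integrable_scaledHerm_gaussLaw _ _ _).smul_measure ENNReal.ofReal_ne_top),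
    integral_smul_measure, integral_smul_measure, integral_scaledHerm_gaussLaw,
    integral_scaledHerm_gaussLaw, rowDiv_spikeFactor, rowDiv_spikeFactor,
    gaussMean_hermMv_spike _ (cleanVar κ) (cleanCorr κ α σ) v.1.ofLp
      (spikeFactor_mul_transpose_eq hv ?_ ?_ ?_),
    -- The excess covariance of the corruption is exactly `-(1 - ε) / ε` times that of the clean
    -- law, in both its entries.
    gaussMean_hermMv_spike _ (-((1 - ε) / ε) * cleanVar κ) (-((1 - ε) / ε) * cleanCorr κ α σ)
      v.1.ofLp (spikeFactor_mul_transpose_eq hv ?_ ?_ ?_),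
    ENNReal.toReal_ofReal (by linarith [h.eps_lt]), ENNReal.toReal_ofReal h.eps_pos.le, mixHerm]
  · simp only [smul_eq_mul]
    ring
  · rw [h.corrDev_sq, cleanVar]; ring
  · rw [← mul_div_assoc, h.corrDev_mul_corrCoeff, cleanCorr]; ring
  · rw [div_pow, div_pow, ← add_div, h.corrNoise_sq, hs2, div_self (hs2 ▸ hs2'.ne')]
  · rw [inv_pow, Real.sq_sqrt hκ.le, cleanVar]; ring
  · rw [cleanCorr]; ring
  · rw [div_pow, div_pow, ← add_div, hs2, div_self (hs2 ▸ hs2'.ne')]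

end

end RobustTesting

namespace RobustTesting

/-! ### Size of the Hermite moments of the mixture -/

lemma spikeMoment_mul (t a : ℝ) (e : ℕ) :
    spikeMoment (t * a) (2 * e) = t ^ e * spikeMoment a (2 * e) := by
  induction e with
  | zero => simp [spikeMoment]
  | succ e ih =>
    simp only [Nat.mul_succ, spikeMoment, ih]
    ring

lemma spikeMoment_odd (a : ℝ) (e : ℕ) : spikeMoment a (2 * e + 1) = 0 := by
  induction e with
  | zero => rfl
  | succ e ih =>
    rw [show 2 * (e + 1) + 1 = (2 * e + 1) + 2 by ring, spikeMoment, ih, mul_zero]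

/-- Each step of the recursion gains at most `(n + 1)²`, below the growth `(n + 2) (n + 1)` of the
factorial. -/
lemma spikeMoment_sq_le {a : ℝ} (ha : a ^ 2 ≤ 1) : ∀ n : ℕ, spikeMoment a n ^ 2 ≤ n.factorial
  | 0 => by simp [spikeMoment]
  | 1 => by simp [spikeMoment]
  | n + 2 => by
    have ih := spikeMoment_sq_le ha n
    have h1 : spikeMoment a (n + 2) ^ 2 = a ^ 2 * (((n : ℝ) + 1) ^ 2 * spikeMoment a n ^ 2) := by
      rw [spikeMoment]; ring
    have h2 : ((n + 2).factorial : ℝ) = ((n : ℝ) + 2) * (n + 1) * n.factorial := by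
      rw [Nat.factorial_succ, Nat.factorial_succ]; push_cast; ring
    rw [h1, h2]
    have h3 : (0 : ℝ) ≤ ((n : ℝ) + 1) ^ 2 * spikeMoment a n ^ 2 := by positivity
    calc a ^ 2 * (((n : ℝ) + 1) ^ 2 * spikeMoment a n ^ 2)
        ≤ 1 * (((n : ℝ) + 1) ^ 2 * spikeMoment a n ^ 2) := by gcongr
      _ ≤ ((n : ℝ) + 1) ^ 2 * n.factorial := by rw [one_mul]; gcongr
      _ ≤ ((n : ℝ) + 2) * (n + 1) * n.factorial := by
        gcongr
        nlinarith [(Nat.cast_nonneg n : (0 : ℝ) ≤ n)]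

lemma spikeHerm_eq_zero_of_lt (a b : ℝ) {q j : ℕ} (h : q < j) : spikeHerm a b q j = 0 := by
  simp [spikeHerm, Nat.descFactorial_of_lt h]

lemma spikeHerm_eq_zero_of_odd (a b : ℝ) (j e : ℕ) : spikeHerm a b (j + (2 * e + 1)) j = 0 := by
  simp [spikeHerm, spikeMoment_odd]

/-- Homogeneity in the covariance, of order half the total degree `2 (j + e)`. This lets the two
components of the mixture share one Hermite moment up to a scalar. -/
lemma spikeHerm_mul (t a b : ℝ) (j e : ℕ) :
    spikeHerm (t * a) (t * b) (j + 2 * e) j = t ^ (j + e) * spikeHerm a b (j + 2 * e) j := by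
  simp only [spikeHerm, Nat.add_sub_cancel_left, spikeMoment_mul, mul_pow, pow_add]
  ring

/-- Of the two descending factorials in the square, one joins the bound `n!` on the moment to form
`(j + n)!`; the other is `j!` times a binomial coefficient, hence at most `j! 2 ^ (j + n)`. -/
lemma spikeHerm_sq_le {a b x : ℝ} (ha : a ^ 2 ≤ 1) (hb : b ^ 2 ≤ x) (j n : ℕ) :
    spikeHerm a b (j + n) j ^ 2 ≤
      ((j + n).factorial * j.factorial : ℝ) * (2 ^ (j + n) * x ^ j) := by
  have h1 : (((j + n).descFactorial j : ℕ) : ℝ) * n.factorial = (j + n).factorial := by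
    have := Nat.factorial_mul_descFactorial (Nat.le_add_right j n)
    rw [Nat.add_sub_cancel_left] at this
    exact_mod_cast (mul_comm _ _).trans this
  have h2 : (((j + n).descFactorial j : ℕ) : ℝ) ≤ j.factorial * 2 ^ (j + n) := by
    rw [Nat.descFactorial_eq_factorial_mul_choose]
    push_cast
    gcongr
    exact_mod_cast Nat.choose_le_two_pow _ _
  have h3 : (b ^ j) ^ 2 ≤ x ^ j := by
    rw [← pow_mul, mul_comm, pow_mul]
    exact pow_le_pow_left₀ (sq_nonneg b) hb j
  have hx : 0 ≤ x := (sq_nonneg b).trans hb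
  rw [spikeHerm, Nat.add_sub_cancel_left]
  calc (b ^ j * ((j + n).descFactorial j : ℕ) * spikeMoment a n) ^ 2
      = (b ^ j) ^ 2 * (((j + n).descFactorial j : ℕ) : ℝ) *
          ((((j + n).descFactorial j : ℕ) : ℝ) * spikeMoment a n ^ 2) := by ring
    _ ≤ x ^ j * (j.factorial * 2 ^ (j + n)) *
          ((((j + n).descFactorial j : ℕ) : ℝ) * n.factorial) := by
        gcongr
        exact spikeMoment_sq_le ha n
    _ = _ := by rw [h1]; ring

lemma abs_mix_coeff_le {ε : ℝ} (h0 : 0 < ε) (h1 : ε < 1) {k : ℕ} (hk : 2 ≤ k) :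
    |(1 - ε) + ε * (-((1 - ε) / ε)) ^ k| ≤ ε⁻¹ ^ (k - 1) := by
  obtain ⟨m, rfl⟩ : ∃ m, k = m + 2 := ⟨k - 2, by lia⟩
  have hx : 1 ≤ ε⁻¹ := (one_le_inv₀ h0).2 h1.le
  have hε : ε * ε⁻¹ = 1 := mul_inv_cancel₀ h0.ne'
  have hp : 1 ≤ ε⁻¹ ^ m := one_le_pow₀ hx
  have hq : (1 - ε) ^ (m + 2) ≤ 1 - ε := by
    simpa using pow_le_pow_of_le_one (by linarith : 0 ≤ 1 - ε) (by linarith) (by lia : 1 ≤ m + 2)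
  have e : ε * |(-((1 - ε) / ε)) ^ (m + 2)| = (1 - ε) ^ (m + 2) * ε⁻¹ ^ (m + 1) := by
    rw [abs_pow, abs_neg, abs_of_nonneg (div_nonneg (by linarith) h0.le), div_eq_mul_inv, mul_pow,
      pow_succ ε⁻¹ (m + 1)]
    linear_combination ((1 - ε) ^ (m + 2) * ε⁻¹ ^ (m + 1)) * hε
  calc |(1 - ε) + ε * (-((1 - ε) / ε)) ^ (m + 2)|
      ≤ |1 - ε| + |ε * (-((1 - ε) / ε)) ^ (m + 2)| := abs_add_le _ _
    _ = (1 - ε) + (1 - ε) ^ (m + 2) * ε⁻¹ ^ (m + 1) := by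
      rw [abs_mul, abs_of_pos h0, e, abs_of_nonneg (by linarith : 0 ≤ 1 - ε)]
    -- Weakening `1 - ε` to `ε⁻¹ ^ m` makes the sum collapse exactly: the first term cancels `-ε *
    -- ε⁻¹ ^ (m + 1)`.
    _ ≤ ε⁻¹ ^ m + (1 - ε) * ε⁻¹ ^ (m + 1) := by
      gcongr
      linarith
    _ = ε⁻¹ ^ (m + 2 - 1) := by
      rw [show m + 2 - 1 = m + 1 by lia, pow_succ]
      linear_combination (-ε⁻¹ ^ m) * hε

lemma mixHerm_eq (ε a b : ℝ) (j e : ℕ) :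
    mixHerm ε a b (j + 2 * e) j =
      ((1 - ε) + ε * (-((1 - ε) / ε)) ^ (j + e)) * spikeHerm a b (j + 2 * e) j := by
  rw [mixHerm, spikeHerm_mul]
  ring

lemma mixHerm_zero_zero (ε a b : ℝ) : mixHerm ε a b 0 0 = 1 := by
  simp [mixHerm, spikeHerm, spikeMoment]

/-- The mixed moments vanish, but in even degrees `2 k` with `k = 0` or `k ≥ 2`, and label degree at
most `k`. -/
lemma exists_of_mixHerm_ne_zero {ε a b : ℝ} (hε : ε ≠ 0) {q j : ℕ} (h : mixHerm ε a b q j ≠ 0) :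
    ∃ e, q = j + 2 * e ∧ (j + e = 0 ∨ 2 ≤ j + e) := by
  have hle : j ≤ q := by
    by_contra! hlt
    exact h (by simp [mixHerm, spikeHerm_eq_zero_of_lt _ _ hlt])
  obtain ⟨m, rfl⟩ := Nat.exists_eq_add_of_le hle
  rcases Nat.even_or_odd' m with ⟨e, rfl | rfl⟩
  · refine ⟨e, rfl, ?_⟩
    by_contra! hc
    have h1 : j + e = 1 := by lia
    apply h
    rw [mixHerm_eq, h1, pow_one]
    have : (1 - ε) + ε * -((1 - ε) / ε) = 0 := by field_simp; ring
    rw [this, zero_mul]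
  · exact absurd (by simp [mixHerm, spikeHerm_eq_zero_of_odd]) h

/-- The weight of degrees `(q, j)` in the advantage. -/
def mixWeight (ε a b : ℝ) (q j : ℕ) : ℝ :=
  mixHerm ε a b q j ^ 2 / (q.factorial * j.factorial)

lemma mixWeight_nonneg (ε a b : ℝ) (q j : ℕ) : 0 ≤ mixWeight ε a b q j := by
  unfold mixWeight; positivity

lemma mixWeight_zero_zero (ε a b : ℝ) : mixWeight ε a b 0 0 = 1 := by
  simp [mixWeight, mixHerm_zero_zero]

/-- The factorials of `spikeHerm_sq_le` cancel against the Hermite normalisation, leaving only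
exponential factors in the degrees. -/
lemma mixWeight_le {ε a b x : ℝ} (h0 : 0 < ε) (h1 : ε < 1) (ha : a ^ 2 ≤ 1) (hb : b ^ 2 ≤ x)
    {j e : ℕ} (hk : 2 ≤ j + e) :
    mixWeight ε a b (j + 2 * e) j ≤
      ε⁻¹ ^ (2 * (j + e) - 2) * (2 ^ (j + 2 * e) * x ^ j) := by
  have hx : 0 ≤ x := (sq_nonneg b).trans hb
  have hi : 0 < ε⁻¹ := inv_pos.2 h0
  rw [mixWeight, div_le_iff₀ (by positivity), mixHerm_eq, mul_pow]
  have e1 := abs_mix_coeff_le h0 h1 hk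
  have e2 : ((1 - ε) + ε * (-((1 - ε) / ε)) ^ (j + e)) ^ 2 ≤ ε⁻¹ ^ (2 * (j + e) - 2) := by
    rw [← sq_abs, show 2 * (j + e) - 2 = (j + e - 1) * 2 by lia, pow_mul]
    exact pow_le_pow_left₀ (abs_nonneg _) e1 2
  calc _ ≤ ε⁻¹ ^ (2 * (j + e) - 2) * (((j + 2 * e).factorial * j.factorial : ℝ) *
        (2 ^ (j + 2 * e) * x ^ j)) :=
        mul_le_mul e2 (spikeHerm_sq_le ha hb j (2 * e)) (sq_nonneg _) (by positivity)
    _ = _ := by ring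

lemma cleanVar_sq_le {κ : ℝ} (h : 1 ≤ κ) : cleanVar κ ^ 2 ≤ 1 := by
  have h1 : 1 / κ ≤ 1 := (div_le_one (by linarith)).2 h
  have h2 : 0 < 1 / κ := by positivity
  rw [cleanVar]
  nlinarith

/-- The signal share `α² / σ_y²` of the label variance is at most one. The remaining `1 / κ` is what
each unit of label degree gains. -/
lemma cleanCorr_sq_le {κ α σ : ℝ} (h : 1 ≤ κ) (hα : 0 < α) : cleanCorr κ α σ ^ 2 ≤ κ⁻¹ := by
  have h0 : 0 < κ := by linarith
  have hs : 0 < labelDev α σ ^ 2 := pow_pos (labelDev_pos hα) 2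
  rw [cleanCorr, div_pow, mul_pow, inv_pow, Real.sq_sqrt h0.le, div_le_iff₀ hs, labelDev_sq,
    mul_comm]
  have : 0 < κ⁻¹ := by positivity
  gcongr
  nlinarith [sq_nonneg σ]

end RobustTesting

namespace RobustTesting

/-! ### Moments of the uniform law on the sphere -/

lemma isProbabilityMeasure_sphereUniform {d : ℕ} (hd : 1 ≤ d) :
    IsProbabilityMeasure (sphereUniform d) := by
  have : Nonempty (Fin d) := ⟨⟨0, hd⟩⟩
  constructor
  rw [sphereUniform, Measure.smul_apply, smul_eq_mul]
  refine ENNReal.inv_mul_cancel ?_ (measure_ne_top _ _)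
  rw [Measure.measure_univ_ne_zero]
  exact Measure.toSphere_ne_zero _

lemma integrable_of_continuous_sphere {d : ℕ} (hd : 1 ≤ d) {f : UnitSphere d → ℝ}
    (hf : Continuous f) : Integrable f (sphereUniform d) := by
  have := isProbabilityMeasure_sphereUniform hd
  exact hf.integrable_of_hasCompactSupport (HasCompactSupport.of_compactSpace _)

/-- Integration in polar coordinates of the product of a radial and an angular function. -/
lemma integral_polar {d : ℕ} (hd : 1 ≤ d) (F : ℝ → ℝ) (f : UnitSphere d → ℝ)
    (G : EuclideanSpace ℝ (Fin d) → ℝ)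
    (hG : ∀ (v : UnitSphere d) (r : ℝ), 0 < r → G (r • v.1) = F r * f v) :
    ∫ x, G x = (∫ x : EuclideanSpace ℝ (Fin d), F ‖x‖) * ∫ v, f v ∂sphereUniform d := by
  have : Nonempty (Fin d) := ⟨⟨0, hd⟩⟩
  have key (f : UnitSphere d → ℝ) (G : EuclideanSpace ℝ (Fin d) → ℝ)
      (hG : ∀ (v : UnitSphere d) (r : ℝ), 0 < r → G (r • v.1) = F r * f v) :
      ∫ x, G x = (∫ v, f v ∂(volume : Measure (EuclideanSpace ℝ (Fin d))).toSphere) *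
        ∫ r : Set.Ioi (0 : ℝ), F r ∂Measure.volumeIoiPow
          (Module.finrank ℝ (EuclideanSpace ℝ (Fin d)) - 1) := by
    rw [← integral_prod_mul,
      ← ((volume : Measure
        (EuclideanSpace ℝ (Fin d))).measurePreserving_homeomorphUnitSphereProd).integral_comp
        (homeomorphUnitSphereProd (EuclideanSpace ℝ (Fin d))).measurableEmbedding]
    have hG0 : ∫ x, G x = ∫ x : ({0}ᶜ : Set (EuclideanSpace ℝ (Fin d))), G x
        ∂Measure.comap Subtype.val volume := by
      rw [integral_subtype_comap (measurableSet_singleton (0 : EuclideanSpace ℝ (Fin d))).compl G,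
        restrict_compl_singleton]
    rw [hG0]
    apply integral_congr_ae
    refine Filter.Eventually.of_forall fun x => ?_
    have hx : x.1 ≠ 0 := x.2
    set p := homeomorphUnitSphereProd (EuclideanSpace ℝ (Fin d)) x with hp
    have := hG p.1 p.2.1 p.2.2
    dsimp only
    rw [mul_comm, ← this]
    congr 1
    simp [hp, smul_smul, mul_inv_cancel₀ (norm_ne_zero_iff.2 hx)]
  -- The choice `f = 1` expresses the radial integral through the total surface mass, which the
  -- normalisation of the uniform law then cancels.
  have h1 := key (fun _ => 1) (fun x => F ‖x‖) (fun v r hr => by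
    rw [norm_smul, norm_eq_of_mem_sphere, mul_one, mul_one, Real.norm_of_nonneg hr.le])
  rw [key f G hG, h1, sphereUniform, integral_smul_measure]
  have h0 : (volume : Measure (EuclideanSpace ℝ (Fin d))).toSphere.real Set.univ ≠ 0 := by
    rw [measureReal_def, ENNReal.toReal_ne_zero, Ne, Measure.measure_univ_eq_zero]
    exact ⟨Measure.toSphere_ne_zero _, measure_ne_top _ _⟩
  simp only [integral_const, smul_eq_mul, mul_one, ENNReal.toReal_inv]
  rw [← measureReal_def]
  field_simp

/-- The density of the standard Gaussian law, as a function of the norm. -/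
def gaussRadial (d : ℕ) (r : ℝ) : ℝ := (√(2 * Real.pi))⁻¹ ^ d * Real.exp (-r ^ 2 / 2)

lemma gaussRadial_norm {d : ℕ} (x : EuclideanSpace ℝ (Fin d)) :
    gaussRadial d ‖x‖ = ∏ i, gaussianPDFReal 0 1 (x i) := by
  simp only [gaussianPDFReal, Finset.prod_mul_distrib, ← Real.exp_sum]
  rw [gaussRadial, EuclideanSpace.real_norm_sq_eq]
  congr 1
  · simp
  · congr 1
    rw [← Finset.sum_div, ← Finset.sum_neg_distrib]
    simp

/-- Gaussian means become Lebesgue integrals with a radial weight, to which polar coordinates apply.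
-/
lemma integral_eval_gaussRadial {d : ℕ} (f : MvPolynomial (Fin d) ℝ) :
    ∫ x : EuclideanSpace ℝ (Fin d), gaussRadial d ‖x‖ * MvPolynomial.eval x.ofLp f =
      ∫ g, MvPolynomial.eval g f ∂stdPi (Fin d) := by
  have h0 (f : MvPolynomial (Fin d) ℝ) :
      ∫ x : EuclideanSpace ℝ (Fin d), gaussRadial d ‖x‖ * MvPolynomial.eval x.ofLp f =
      ∫ x : Fin d → ℝ, (∏ i, gaussianPDFReal 0 1 (x i)) * MvPolynomial.eval x f := by
    rw [← (EuclideanSpace.volume_preserving_symm_measurableEquiv_toLp (Fin d)).integral_comp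
      (MeasurableEquiv.measurableEmbedding _)]
    exact integral_congr_ae (Filter.Eventually.of_forall fun x => by
      simp only [gaussRadial_norm]; rfl)
  have h1 (n : ℕ) : Integrable fun x => gaussianPDFReal 0 1 x * x ^ n := by
    have h := integrable_pow_gaussianReal n
    rw [gaussianReal_of_var_ne_zero _ one_ne_zero,
      integrable_withDensity_iff_integrable_smul₀' (by fun_prop)
        (Filter.Eventually.of_forall fun _ => gaussianPDF_lt_top)] at h
    simpa [toReal_gaussianPDF] using h
  have h2 (m : Fin d →₀ ℕ) (c : ℝ) (x : Fin d → ℝ) :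
      (∏ i, gaussianPDFReal 0 1 (x i)) * MvPolynomial.eval x (MvPolynomial.monomial m c) =
        c * ∏ i, gaussianPDFReal 0 1 (x i) * x i ^ m i := by
    rw [MvPolynomial.eval_monomial, Finsupp.prod_fintype m (fun i e => _ ^ e)
      (fun _ => pow_zero _), Finset.prod_mul_distrib]
    ring
  have h3 (f : MvPolynomial (Fin d) ℝ) : Integrable fun x : Fin d → ℝ =>
      (∏ i, gaussianPDFReal 0 1 (x i)) * MvPolynomial.eval x f := by
    induction f using MvPolynomial.induction_on' with
    | monomial m c =>
      simp_rw [h2]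
      exact (Integrable.fintype_prod fun i => h1 (m i)).const_mul c
    | add p q hp hq =>
      simp only [map_add, mul_add]
      exact hp.add hq
  rw [h0]
  clear h0
  induction f using MvPolynomial.induction_on' with
  | monomial m c =>
    simp_rw [h2]
    rw [integral_const_mul, integral_fintype_prod_volume_eq_prod
      (fun i (x : ℝ) => gaussianPDFReal 0 1 x * x ^ m i), integral_monomial_stdPi]
    congr 1
    refine Finset.prod_congr rfl fun i _ => ?_
    rw [integral_gaussianReal_eq_integral_smul one_ne_zero]
    rfl
  | add p q hp hq =>
    simp only [map_add, mul_add]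
    rw [integral_add (h3 p) (h3 q), integral_add (integrable_eval_stdPi _)
      (integrable_eval_stdPi _)]
    rw [hp, hq]

/-- The squared norm as a polynomial. -/
def normSqPoly (d : ℕ) : MvPolynomial (Fin d) ℝ := ∑ i, MvPolynomial.X i ^ 2

lemma eval_normSqPoly {d : ℕ} (x : Fin d → ℝ) :
    MvPolynomial.eval x (normSqPoly d) = ∑ i, x i ^ 2 := by simp [normSqPoly]

/-- Jensen's inequality in tangent form: Bernoulli's inequality at `‖g‖² / d`, whose mean is one, is
integrated. -/
lemma le_integral_normSqPoly_pow {d : ℕ} (hd : 1 ≤ d) (s : ℕ) :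
    (d : ℝ) ^ s ≤ ∫ g, MvPolynomial.eval g (normSqPoly d ^ s) ∂stdPi (Fin d) := by
  have hd0 : (0 : ℝ) < d := by exact_mod_cast hd
  have hi : Integrable (fun g : Fin d → ℝ => (∑ i, g i ^ 2)) (stdPi (Fin d)) := by
    simpa only [eval_normSqPoly] using integrable_eval_stdPi (normSqPoly d)
  have h1 : ∫ g : Fin d → ℝ, ∑ i, g i ^ 2 ∂stdPi (Fin d) = d := by
    have h2 (i : Fin d) : ∫ g : Fin d → ℝ, g i ^ 2 ∂stdPi (Fin d) = 1 := by
      have h := integral_mul_eval_stdPi i (MvPolynomial.X i : MvPolynomial (Fin d) ℝ)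
      simpa [← sq] using h
    rw [integral_finsetSum]
    · simp [h2]
    · intro i _
      exact (integrable_eval_stdPi (MvPolynomial.X i ^ 2)).congr
        (Filter.Eventually.of_forall fun g => by simp)
  have hsub : Integrable (fun g : Fin d → ℝ => s * ((∑ i, g i ^ 2) / d - 1)) (stdPi (Fin d)) :=
    ((hi.div_const _).sub (integrable_const _)).const_mul _
  have h3 : ∫ g : Fin d → ℝ, (d : ℝ) ^ s * (1 + s * ((∑ i, g i ^ 2) / d - 1)) ∂stdPi (Fin d) =
      (d : ℝ) ^ s := by
    rw [integral_const_mul, integral_add (integrable_const _) hsub, integral_const_mul,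
      integral_sub (hi.div_const _) (integrable_const _), integral_div, h1]
    simp [hd0.ne']
  rw [← h3]
  refine integral_mono ?_ (integrable_eval_stdPi _) fun g => ?_
  · exact ((integrable_const _).add hsub).const_mul _
  · have hn : 0 ≤ (∑ i, g i ^ 2) / d := by positivity
    have h4 := one_add_mul_le_pow (a := (∑ i, g i ^ 2) / d - 1) (by linarith) s
    rw [add_sub_cancel, div_pow, le_div_iff₀ (by positivity)] at h4
    simp only [map_pow, eval_normSqPoly]
    linarith

/-- The marginal `⟨w, g⟩` has variance one, so Stein's identity for the one-row matrix `w` yields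
the recursion of Gaussian moments. -/
lemma integral_dotProduct_pow_stdPi {d : ℕ} (w : UnitSphere d) (q : ℕ) :
    ∫ g, (w.1.ofLp ⬝ᵥ g) ^ q ∂stdPi (Fin d) = spikeMoment 1 q := by
  set A : Matrix Unit (Fin d) ℝ := Matrix.of fun _ i => w.1 i
  have hA : (A * Aᵀ) () () = 1 := sphere_dotProduct_self w
  have h (q : ℕ) : ∫ g, (w.1.ofLp ⬝ᵥ g) ^ q ∂stdPi (Fin d) =
      gaussMean A (MvPolynomial.X () ^ q) := by
    simp [gaussMean, A, Matrix.mulVec]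
  simp_rw [h]
  have hstep (q : ℕ) : gaussMean A (MvPolynomial.X () ^ (q + 1)) =
      q * gaussMean A (MvPolynomial.X () ^ (q - 1)) := by
    rw [pow_succ', gaussMean_X_mul]
    simp only [Finset.univ_unique, Finset.sum_singleton]
    rw [show (A * Aᵀ) () default = 1 from hA, one_mul, ← gaussMean_C_mul]
    congr 1
    simp
  induction q using Nat.strong_induction_on with
  | _ q ih =>
    match q, ih with
    | 0, _ => simp [gaussMean_one, spikeMoment]
    | 1, _ => simpa [spikeMoment] using hstep 0
    | q + 2, ih =>
      rw [hstep (q + 1), Nat.add_sub_cancel, ih q (by lia), spikeMoment]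
      push_cast
      ring

/-- The moments of a one-dimensional marginal of the uniform law on the sphere. -/
def sphereMoment {d : ℕ} (w : UnitSphere d) (q : ℕ) : ℝ :=
  ∫ v, (w.1.ofLp ⬝ᵥ v.1.ofLp) ^ q ∂sphereUniform d

/-- The extra power `‖x‖ ^ k` makes the total degree even, so that the radial factor is the mean of
a polynomial. It is used with `k = 0` for even `q` and `k = 1` for odd `q`. -/
lemma integral_gaussRadial_mul_pow {d : ℕ} (hd : 1 ≤ d) (w : UnitSphere d) (k q s : ℕ)
    (hs : k + q = 2 * s) :
    ∫ x : EuclideanSpace ℝ (Fin d), gaussRadial d ‖x‖ * ‖x‖ ^ k * (w.1.ofLp ⬝ᵥ x.ofLp) ^ q =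
      (∫ g, MvPolynomial.eval g (normSqPoly d ^ s) ∂stdPi (Fin d)) * sphereMoment w q := by
  rw [← integral_eval_gaussRadial, sphereMoment, integral_polar hd
    (fun r => gaussRadial d r * r ^ (2 * s)) (fun v => (w.1.ofLp ⬝ᵥ v.1.ofLp) ^ q)]
  · congr 2 with x
    rw [map_pow, eval_normSqPoly, ← EuclideanSpace.real_norm_sq_eq, pow_mul]
  · intro v r hr
    rw [norm_smul, norm_eq_of_mem_sphere, mul_one, Real.norm_of_nonneg hr.le, WithLp.ofLp_smul,
      dotProduct_smul, smul_eq_mul, ← hs, pow_add, mul_pow]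
    ring

/-- Reflection `x ↦ -x` kills the corresponding integral over the whole space, and the radial factor
is nonzero. -/
lemma sphereMoment_odd {d : ℕ} (hd : 1 ≤ d) (w : UnitSphere d) {q : ℕ} (hq : Odd q) :
    sphereMoment w q = 0 := by
  obtain ⟨s, hs⟩ := hq
  have h := integral_gaussRadial_mul_pow hd w 1 q (s + 1) (by lia)
  have h0 : ∫ x : EuclideanSpace ℝ (Fin d),
      gaussRadial d ‖x‖ * ‖x‖ ^ 1 * (w.1.ofLp ⬝ᵥ x.ofLp) ^ q = 0 := by
    have := integral_neg_eq_self (fun x : EuclideanSpace ℝ (Fin d) =>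
      gaussRadial d ‖x‖ * ‖x‖ ^ 1 * (w.1.ofLp ⬝ᵥ x.ofLp) ^ q) volume
    have hodd : Odd q := ⟨s, hs⟩
    simp only [norm_neg, WithLp.ofLp_neg, dotProduct_neg, hodd.neg_pow, mul_neg,
      integral_neg] at this
    linarith
  have hpos : (0 : ℝ) < d ^ (s + 1) := pow_pos (by exact_mod_cast hd) _
  have := hpos.trans_le (le_integral_normSqPoly_pow hd (s + 1))
  rw [h0] at h
  exact (mul_eq_zero.1 h.symm).resolve_left this.ne'

/-- The Gaussian moment is the product `1 * 3 * ... * (2s - 1)`, with `s` factors below `2s`. -/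
lemma spikeMoment_one_le (s : ℕ) : spikeMoment 1 (2 * s) ≤ (2 * s : ℝ) ^ s := by
  induction s with
  | zero => simp [spikeMoment]
  | succ s ih =>
    rw [Nat.mul_succ, spikeMoment, one_mul, pow_succ']
    push_cast
    have h1 : (2 * s : ℝ) ^ s ≤ (2 * (s + 1)) ^ s :=
      pow_le_pow_left₀ (by positivity) (by linarith) s
    exact mul_le_mul (by linarith) (ih.trans h1) (by
      have : ∀ s : ℕ, 0 ≤ spikeMoment 1 (2 * s) := fun s => by
        induction s with
        | zero => simp [spikeMoment]
        | succ s ih => rw [Nat.mul_succ, spikeMoment]; positivity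
      exact this s) (by positivity)

lemma sphereMoment_nonneg {d : ℕ} (hd : 1 ≤ d) (w : UnitSphere d) (q : ℕ) :
    0 ≤ sphereMoment w q := by
  rcases Nat.even_or_odd q with hq | hq
  · exact integral_nonneg fun v => hq.pow_nonneg _
  · exact (sphereMoment_odd hd w hq).ge

/-- Norm and direction of a Gaussian vector are independent, so the sphere moment is the moment of
`⟨w, g⟩` divided by that of `‖g‖`, and the latter is at least `d ^ s`. -/
lemma sphereMoment_even_le {d : ℕ} (hd : 1 ≤ d) (w : UnitSphere d) (s : ℕ) :
    sphereMoment w (2 * s) ≤ (2 * s : ℝ) ^ s / d ^ s := by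
  have h := integral_gaussRadial_mul_pow hd w 0 (2 * s) s (by lia)
  have hpos : (0 : ℝ) < d ^ s := pow_pos (by exact_mod_cast hd) _
  have h1 : ∫ x : EuclideanSpace ℝ (Fin d),
      gaussRadial d ‖x‖ * ‖x‖ ^ 0 * (w.1.ofLp ⬝ᵥ x.ofLp) ^ (2 * s) = spikeMoment 1 (2 * s) := by
    rw [← integral_dotProduct_pow_stdPi w]
    have := integral_eval_gaussRadial
      ((∑ i, MvPolynomial.C (w.1 i) * MvPolynomial.X i : MvPolynomial (Fin d) ℝ) ^ (2 * s))
    simp only [map_pow, map_sum, map_mul, MvPolynomial.eval_C, MvPolynomial.eval_X] at this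
    simp only [pow_zero, mul_one]
    exact this
  rw [le_div_iff₀ hpos]
  calc sphereMoment w (2 * s) * d ^ s ≤ sphereMoment w (2 * s) *
        ∫ g, MvPolynomial.eval g (normSqPoly d ^ s) ∂stdPi (Fin d) :=
        mul_le_mul_of_nonneg_left (le_integral_normSqPoly_pow hd s) (sphereMoment_nonneg hd w _)
    _ = spikeMoment 1 (2 * s) := by rw [mul_comm, ← h, h1]
    _ ≤ _ := spikeMoment_one_le s

end RobustTesting

namespace RobustTesting

/-! ### The alternative law as a mixture -/

/-- The mass of a set is the mass of a section of its preimage under the jointly measurable map `(ω,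
g) ↦ A ω g`. This feeds the construction of a kernel in `v`. -/
lemma measurable_gaussLaw {ι Ω : Type*} [Fintype ι] [MeasurableSpace Ω] {A : Ω → Matrix ι ι ℝ}
    (hA : ∀ i j, Measurable fun ω => A ω i j) : Measurable fun ω => gaussLaw (A ω) := by
  have hF : Measurable fun p : Ω × (ι → ℝ) =>
      (WithLp.toLp 2 (A p.1 *ᵥ p.2) : EuclideanSpace ℝ ι) := by
    refine (WithLp.measurable_toLp 2 _).comp (measurable_pi_iff.2 fun i => ?_)
    simp only [Matrix.mulVec, dotProduct]
    exact Finset.measurable_sum _ fun j _ =>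
      ((hA i j).comp measurable_fst).mul ((measurable_pi_apply j).comp measurable_snd)
  refine Measure.measurable_of_measurable_coe _ fun s hs => ?_
  have h := measurable_measure_prodMk_left (ν := stdPi ι) (hF hs)
  have e : (fun ω => gaussLaw (A ω) s) = fun ω => stdPi ι (Prod.mk ω ⁻¹'
      ((fun p : Ω × (ι → ℝ) => (WithLp.toLp 2 (A p.1 *ᵥ p.2) : EuclideanSpace ℝ ι)) ⁻¹' s)) := by
    ext ω
    rw [gaussLaw, Measure.map_apply (measurable_toLp_mulVec _) hs]
    rfl
  rw [e]
  exact h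

/-- Boxes form a generating π-system, and on a box the product measure is a finite product of
measurable functions. -/
lemma measurable_pi_measure {Ω E : Type*} [MeasurableSpace Ω] [MeasurableSpace E] (n : ℕ)
    {K : Ω → Measure E} [∀ ω, IsProbabilityMeasure (K ω)] (hK : Measurable K) :
    Measurable fun ω => Measure.pi fun _ : Fin n => K ω := by
  refine Measurable.measure_of_isPiSystem_of_isProbabilityMeasure generateFrom_pi.symm
    isPiSystem_pi ?_
  rintro _ ⟨s, hs, rfl⟩
  simp_rw [Measure.pi_pi]
  exact Finset.measurable_prod _ fun i _ =>
    (Measure.measurable_coe (hs i (Set.mem_univ i))).comp hK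

lemma measurable_spikeFactor {d : ℕ} (τ c ρ : ℝ) (i k : Fin d ⊕ Unit) :
    Measurable fun v : UnitSphere d => spikeFactor v.1.ofLp τ c ρ i k := by
  have h (i : Fin d) : Measurable fun v : UnitSphere d => v.1 i := by fun_prop
  rcases i with i | i <;> rcases k with k | k <;>
    simp only [spikeFactor, Matrix.fromBlocks_apply₁₁, Matrix.fromBlocks_apply₁₂,
      Matrix.fromBlocks_apply₂₁, Matrix.fromBlocks_apply₂₂, Matrix.add_apply, Matrix.smul_apply,
      Matrix.vecMulVec_apply, Matrix.of_apply, Matrix.zero_apply, smul_eq_mul] <;> fun_prop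

section
variable {ε κ α σ : ℝ}

lemma ParamRange.measurable_mixture (h : ParamRange ε κ α σ) (d : ℕ) :
    Measurable fun v => (hardInstance d ε κ α σ).mixture ε σ v := by
  simp_rw [h.mixture_eq]
  refine Measure.measurable_of_measurable_coe _ fun s hs => ?_
  simp only [Measure.add_apply, Measure.smul_apply, smul_eq_mul]
  exact (((Measure.measurable_coe hs).comp
    (measurable_gaussLaw (measurable_spikeFactor _ _ _))).const_mul _).add
    (((Measure.measurable_coe hs).comp
    (measurable_gaussLaw (measurable_spikeFactor _ _ _))).const_mul _)

/-- The law of `n` samples of the alternative, as a kernel from the sphere. -/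
def ParamRange.sampleKernel (h : ParamRange ε κ α σ) (n d : ℕ) :
    Kernel (UnitSphere d) (Fin n → Sample d) where
  toFun v := Measure.pi fun _ => (hardInstance d ε κ α σ).mixture ε σ v
  measurable' := by
    have := fun v => h.isProbabilityMeasure_mixture (d := d) v
    exact measurable_pi_measure n (h.measurable_mixture d)

lemma ParamRange.sampleKernel_apply (h : ParamRange ε κ α σ) (n d : ℕ) (v : UnitSphere d) :
    h.sampleKernel n d v = Measure.pi fun _ => (hardInstance d ε κ α σ).mixture ε σ v := rfl

lemma ParamRange.isMarkovKernel_sampleKernel (h : ParamRange ε κ α σ) (n d : ℕ) :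
    IsMarkovKernel (h.sampleKernel n d) := by
  refine ⟨fun v => ?_⟩
  have := fun v => h.isProbabilityMeasure_mixture (d := d) v
  rw [sampleKernel_apply]
  infer_instance

lemma ParamRange.alternativeLaw_eq (h : ParamRange ε κ α σ) (n d : ℕ) :
    (hardInstance d ε κ α σ).alternativeLaw n ε σ =
      (sphereUniform d).bind (h.sampleKernel n d) := rfl

lemma ParamRange.isProbabilityMeasure_alternativeLaw (h : ParamRange ε κ α σ) (n : ℕ) {d : ℕ}
    (hd : 1 ≤ d) :
    IsProbabilityMeasure ((hardInstance d ε κ α σ).alternativeLaw n ε σ) := by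
  have := h.isMarkovKernel_sampleKernel n d
  have := isProbabilityMeasure_sphereUniform hd
  rw [h.alternativeLaw_eq]
  infer_instance

end

/-! ### Hermite expansions of functions of the samples -/

/-- The product over the samples of the scaled Hermite products. -/
def sampleHerm {n d : ℕ} (s : Fin d ⊕ Unit → ℝ) (α : Fin n × (Fin d ⊕ Unit) → ℕ)
    (z : Fin n → Sample d) : ℝ :=
  ∏ i, scaledHerm s (fun j => α (i, j)) (z i)

/-- Rescaling variables only multiplies each coefficient by a constant. Thus passing to the
normalised label costs no degree. -/
lemma totalDegree_aeval_C_mul_X_le {J : Type*} [Fintype J] (s : J → ℝ) (f : MvPolynomial J ℝ) :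
    (MvPolynomial.aeval (fun j => MvPolynomial.C (s j) * MvPolynomial.X j) f :
      MvPolynomial J ℝ).totalDegree ≤ f.totalDegree := by
  conv_lhs => rw [f.as_sum, map_sum]
  refine MvPolynomial.totalDegree_finsetSum_le fun m hm => ?_
  have e : MvPolynomial.aeval (fun j => MvPolynomial.C (s j) * MvPolynomial.X j)
      (MvPolynomial.monomial m (f.coeff m)) =
      (MvPolynomial.monomial m (f.coeff m * ∏ j, s j ^ m j) : MvPolynomial J ℝ) := by
    rw [MvPolynomial.aeval_monomial, Finsupp.prod_fintype _ _ (fun _ => pow_zero _)]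
    simp_rw [mul_pow]
    rw [Finset.prod_mul_distrib, MvPolynomial.monomial_eq (s := m),
      Finsupp.prod_fintype _ _ (fun _ => pow_zero _), MvPolynomial.algebraMap_eq]
    simp [mul_assoc]
  rw [e]
  refine (MvPolynomial.totalDegree_monomial_le _ _).trans ?_
  exact MvPolynomial.le_totalDegree hm

/-- Every polynomial of degree at most `D` is a combination of the products of Hermite polynomials
in the scaled variables of degree at most `D`. -/
lemma exists_eval_eq_sum_herm {J : Type*} [Fintype J] [DecidableEq J] {D : ℕ} {s : J → ℝ}
    (hs : ∀ j, s j ≠ 0) {f : MvPolynomial J ℝ} (hf : f.totalDegree ≤ D) :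
    ∃ c : (J → ℕ) → ℝ, ∀ z : J → ℝ,
      MvPolynomial.eval z f = ∑ α ∈ multiIdx J D, c α * ∏ j, (herm (α j)).eval (z j / s j) := by
  obtain ⟨c, hc⟩ := exists_eq_sum_hermMv ((totalDegree_aeval_C_mul_X_le s f).trans hf)
  refine ⟨c, fun z => ?_⟩
  have h1 : MvPolynomial.eval z f = MvPolynomial.eval (fun j => z j / s j)
      (MvPolynomial.aeval (fun j => MvPolynomial.C (s j) * MvPolynomial.X j) f) := by
    rw [MvPolynomial.aeval_def, MvPolynomial.algebraMap_eq, MvPolynomial.eval_eval₂]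
    rw [MvPolynomial.eval, MvPolynomial.coe_eval₂Hom]
    congr 1
    · ext; simp
    · ext j
      simp [mul_div_cancel₀ _ (hs j)]
  rw [h1, hc, map_sum]
  refine Finset.sum_congr rfl fun α _ => ?_
  rw [MvPolynomial.smul_eval, eval_hermMv]

lemma exists_value_eq_sum_sampleHerm {n d D : ℕ} {s : Fin d ⊕ Unit → ℝ} (hs : ∀ j, s j ≠ 0)
    {f : SamplePoly n d} (hf : f.totalDegree ≤ D) :
    ∃ c : (Fin n × (Fin d ⊕ Unit) → ℕ) → ℝ, ∀ z,
      f.value z = ∑ α ∈ multiIdx (Fin n × (Fin d ⊕ Unit)) D, c α * sampleHerm s α z := by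
  obtain ⟨c, hc⟩ := exists_eval_eq_sum_herm
    (s := fun ij : Fin n × (Fin d ⊕ Unit) => s ij.2) (fun ij => hs ij.2) hf
  refine ⟨c, fun z => ?_⟩
  rw [SamplePoly.value, hc]
  refine Finset.sum_congr rfl fun α _ => ?_
  rw [Fintype.prod_prod_type]
  rfl

end RobustTesting

namespace RobustTesting

/-! ### Hermite coefficients of the null and of the alternative -/

/-- The monomial in `v` in the Hermite moment of index `α` of the samples, given `v`. -/
def featMonomial {n d : ℕ} (α : Fin n × (Fin d ⊕ Unit) → ℕ) (v : UnitSphere d) : ℝ :=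
  ∏ i, ∏ k, v.1 k ^ α (i, Sum.inl k)

lemma continuous_featMonomial {n d : ℕ} (α : Fin n × (Fin d ⊕ Unit) → ℕ) :
    Continuous (featMonomial α) := by
  unfold featMonomial
  refine continuous_finsetProd _ fun i _ => continuous_finsetProd _ fun k _ => ?_
  fun_prop

/-- The pairs of the feature degree and the label degree of each sample. -/
def degPairs {n d : ℕ} (α : Fin n × (Fin d ⊕ Unit) → ℕ) (i : Fin n) : ℕ × ℕ :=
  (∑ k, α (i, Sum.inl k), α (i, Sum.inr ()))

/-- The factor in the Hermite moment of the samples that does not depend on `v`. -/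
def mixProd {n : ℕ} (ε a b : ℝ) (t : Fin n → ℕ × ℕ) : ℝ := ∏ i, mixHerm ε a b (t i).1 (t i).2

section
variable {ε κ α σ : ℝ}

lemma ParamRange.integrable_sampleHerm (h : ParamRange ε κ α σ) {n d : ℕ}
    (s : Fin d ⊕ Unit → ℝ) (β : Fin n × (Fin d ⊕ Unit) → ℕ) (v : UnitSphere d) :
    Integrable (sampleHerm s β) (h.sampleKernel n d v) := by
  have := fun v => h.isProbabilityMeasure_mixture (d := d) v
  rw [h.sampleKernel_apply]
  exact Integrable.fintype_prod fun i => h.integrable_scaledHerm_mixture v s _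

lemma ParamRange.integral_sampleHerm (h : ParamRange ε κ α σ) {n d : ℕ}
    (β : Fin n × (Fin d ⊕ Unit) → ℕ) (v : UnitSphere d) :
    ∫ z, sampleHerm (labelScale d (labelDev α σ)) β z ∂h.sampleKernel n d v =
      featMonomial β v * mixProd ε (cleanVar κ) (cleanCorr κ α σ) (degPairs β) := by
  have := fun v => h.isProbabilityMeasure_mixture (d := d) v
  rw [h.sampleKernel_apply]
  simp only [sampleHerm]
  rw [integral_fintype_prod_eq_prod
    (fun i => scaledHerm (labelScale d (labelDev α σ)) fun j => β (i, j)), featMonomial, mixProd,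
    ← Finset.prod_mul_distrib]
  exact Finset.prod_congr rfl fun i _ => h.integral_scaledHerm_mixture v _

lemma ParamRange.integrable_value_sampleKernel (h : ParamRange ε κ α σ) {n d : ℕ}
    (f : SamplePoly n d) (v : UnitSphere d) : Integrable f.value (h.sampleKernel n d v) := by
  obtain ⟨c, hc⟩ := exists_value_eq_sum_sampleHerm (s := fun _ => 1) (fun _ => one_ne_zero)
    (le_refl f.totalDegree)
  rw [show f.value = _ from funext hc]
  exact integrable_finsetSum _ fun β _ => (h.integrable_sampleHerm _ _ v).const_mul _

lemma ParamRange.integral_value_sampleKernel (h : ParamRange ε κ α σ) {n d D : ℕ}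
    {f : SamplePoly n d} {c : (Fin n × (Fin d ⊕ Unit) → ℕ) → ℝ}
    (hc : ∀ z, f.value z = ∑ β ∈ multiIdx (Fin n × (Fin d ⊕ Unit)) D,
      c β * sampleHerm (labelScale d (labelDev α σ)) β z) (v : UnitSphere d) :
    ∫ z, f.value z ∂h.sampleKernel n d v = ∑ β ∈ multiIdx (Fin n × (Fin d ⊕ Unit)) D,
      c β * (featMonomial β v * mixProd ε (cleanVar κ) (cleanCorr κ α σ) (degPairs β)) := by
  simp_rw [hc]
  rw [integral_finsetSum _ fun β _ => (h.integrable_sampleHerm _ _ v).const_mul _]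
  simp_rw [integral_const_mul, h.integral_sampleHerm]

/-- The conditional mean is a polynomial in `v`, hence integrable over the compact sphere. -/
lemma ParamRange.continuous_integral_value (h : ParamRange ε κ α σ) {n d : ℕ}
    (f : SamplePoly n d) : Continuous fun v => ∫ z, f.value z ∂h.sampleKernel n d v := by
  obtain ⟨c, hc⟩ := exists_value_eq_sum_sampleHerm
    (labelScale_ne_zero (d := d) (labelDev_pos (σ := σ) h.alpha_pos).ne') (le_refl f.totalDegree)
  simp_rw [h.integral_value_sampleKernel hc]
  exact continuous_finsetSum _ fun β _ =>
    continuous_const.mul ((continuous_featMonomial β).mul continuous_const)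

lemma continuous_value {n d : ℕ} (f : SamplePoly n d) : Continuous f.value := by
  unfold SamplePoly.value
  exact (MvPolynomial.continuous_eval f).comp (by fun_prop)

/-- All moments of the alternative law are finite. -/
lemma ParamRange.integrable_value_alternativeLaw (h : ParamRange ε κ α σ) {n d : ℕ} (hd : 1 ≤ d)
    (f : SamplePoly n d) :
    Integrable f.value ((hardInstance d ε κ α σ).alternativeLaw n ε σ) := by
  have := h.isMarkovKernel_sampleKernel n d
  have := isProbabilityMeasure_sphereUniform hd
  rw [h.alternativeLaw_eq, Measure.integrable_comp_iff (continuous_value f).aestronglyMeasurable]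
  refine ⟨Filter.Eventually.of_forall fun v => h.integrable_value_sampleKernel f v, ?_⟩
  have hsq (z : Fin n → Sample d) : f.value z ^ 2 = SamplePoly.value (f ^ 2) z := by
    simp [SamplePoly.value]
  -- The mean of `|f|` given `v` is dominated by that of `1 + f ^ 2`, which is again the mean of a
  -- polynomial and so continuous in `v`.
  refine (integrable_of_continuous_sphere hd
    ((h.continuous_integral_value (n := n) (f ^ 2)).const_add 1)).mono'
    (StronglyMeasurable.integral_kernel
      (continuous_value f).stronglyMeasurable.norm).aestronglyMeasurable
    (Filter.Eventually.of_forall fun v => ?_)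
  rw [Real.norm_of_nonneg (integral_nonneg fun _ => norm_nonneg _)]
  have h1 : ∫ z, (1 + SamplePoly.value (f ^ 2) z) ∂h.sampleKernel n d v =
      1 + ∫ z, SamplePoly.value (f ^ 2) z ∂h.sampleKernel n d v := by
    rw [integral_add (integrable_const _) (h.integrable_value_sampleKernel _ v)]
    simp
  rw [← h1]
  refine integral_mono (h.integrable_value_sampleKernel f v).norm
    ((integrable_const _).add (h.integrable_value_sampleKernel _ v)) fun z => ?_
  simp only [← hsq, Real.norm_eq_abs]
  nlinarith [sq_nonneg (|f.value z| - 1), sq_abs (f.value z)]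

/-- The Hermite coefficients of the alternative. -/
lemma ParamRange.integral_value_alternativeLaw (h : ParamRange ε κ α σ) {n d D : ℕ} (hd : 1 ≤ d)
    {f : SamplePoly n d} {c : (Fin n × (Fin d ⊕ Unit) → ℕ) → ℝ}
    (hc : ∀ z, f.value z = ∑ β ∈ multiIdx (Fin n × (Fin d ⊕ Unit)) D,
      c β * sampleHerm (labelScale d (labelDev α σ)) β z) :
    ∫ z, f.value z ∂(hardInstance d ε κ α σ).alternativeLaw n ε σ =
      ∑ β ∈ multiIdx (Fin n × (Fin d ⊕ Unit)) D, c β *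
        ((∫ v, featMonomial β v ∂sphereUniform d) *
          mixProd ε (cleanVar κ) (cleanCorr κ α σ) (degPairs β)) := by
  have hi := h.integrable_value_alternativeLaw hd f
  rw [h.alternativeLaw_eq] at hi ⊢
  rw [Measure.comp_eq_comp_const_apply] at hi ⊢
  rw [Kernel.integral_comp hi, Kernel.const_apply]
  simp_rw [h.integral_value_sampleKernel hc]
  rw [integral_finsetSum _ fun β _ => ((integrable_of_continuous_sphere hd
    (continuous_featMonomial β)).mul_const _).const_mul _]
  simp_rw [integral_const_mul, integral_mul_const]

/-- Orthogonality of the Hermite products of the samples under the null. -/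
lemma integral_sampleHerm_mul_nullLaw {n d : ℕ} (hα : 0 < α)
    (β β' : Fin n × (Fin d ⊕ Unit) → ℕ) :
    ∫ z, sampleHerm (labelScale d (labelDev α σ)) β z *
        sampleHerm (labelScale d (labelDev α σ)) β' z ∂nullLaw n d α σ =
      if β = β' then ∏ ij, ((β ij).factorial : ℝ) else 0 := by
  have hs := labelScale_ne_zero (d := d) (labelDev_pos (σ := σ) hα).ne'
  simp only [sampleHerm, ← Finset.prod_mul_distrib, nullLaw, nullOne_eq_gaussLaw]
  rw [integral_fintype_prod_eq_prod (fun i z =>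
    scaledHerm (labelScale d (labelDev α σ)) (fun j => β (i, j)) z *
      scaledHerm (labelScale d (labelDev α σ)) (fun j => β' (i, j)) z)]
  simp_rw [integral_scaledHerm_mul_diagonal hs]
  split_ifs with h
  · subst h
    simp [Fintype.prod_prod_type]
  · obtain ⟨⟨i, j⟩, hij⟩ := Function.ne_iff.1 h
    exact Finset.prod_eq_zero (Finset.mem_univ i) (if_neg fun e => hij (congrFun e j))

lemma integrable_sampleHerm_mul_nullLaw {n d : ℕ} (hα : 0 < α)
    (β β' : Fin n × (Fin d ⊕ Unit) → ℕ) :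
    Integrable (fun z => sampleHerm (labelScale d (labelDev α σ)) β z *
        sampleHerm (labelScale d (labelDev α σ)) β' z) (nullLaw n d α σ) := by
  have hs := labelScale_ne_zero (d := d) (labelDev_pos (σ := σ) hα).ne'
  simp only [sampleHerm, ← Finset.prod_mul_distrib, nullLaw, nullOne_eq_gaussLaw]
  exact Integrable.fintype_prod (f := fun i z =>
    scaledHerm (labelScale d (labelDev α σ)) (fun j => β (i, j)) z *
      scaledHerm (labelScale d (labelDev α σ)) (fun j => β' (i, j)) z)
    fun i => integrable_scaledHerm_mul_diagonal hs _ _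

/-- Parseval's identity under the null. -/
lemma integral_value_sq_nullLaw {n d D : ℕ} (hα : 0 < α)
    {f : SamplePoly n d} {c : (Fin n × (Fin d ⊕ Unit) → ℕ) → ℝ}
    (hc : ∀ z, f.value z = ∑ β ∈ multiIdx (Fin n × (Fin d ⊕ Unit)) D,
      c β * sampleHerm (labelScale d (labelDev α σ)) β z) :
    ∫ z, f.value z ^ 2 ∂nullLaw n d α σ =
      ∑ β ∈ multiIdx (Fin n × (Fin d ⊕ Unit)) D, c β ^ 2 * ∏ ij, ((β ij).factorial : ℝ) := by
  have e (z : Fin n → Sample d) : f.value z ^ 2 =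
      ∑ β ∈ multiIdx (Fin n × (Fin d ⊕ Unit)) D, ∑ β' ∈ multiIdx (Fin n × (Fin d ⊕ Unit)) D,
        c β * c β' * (sampleHerm (labelScale d (labelDev α σ)) β z *
          sampleHerm (labelScale d (labelDev α σ)) β' z) := by
    rw [sq, hc, Finset.sum_mul_sum]
    exact Finset.sum_congr rfl fun _ _ => Finset.sum_congr rfl fun _ _ => by ring
  simp_rw [e]
  rw [integral_finsetSum _ fun β _ => integrable_finsetSum _ fun β' _ =>
    (integrable_sampleHerm_mul_nullLaw hα β β').const_mul _]
  refine Finset.sum_congr rfl fun β hβ => ?_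
  rw [integral_finsetSum _ fun β' _ => (integrable_sampleHerm_mul_nullLaw hα β β').const_mul _]
  simp_rw [integral_const_mul, integral_sampleHerm_mul_nullLaw hα]
  rw [Finset.sum_eq_single β]
  · simp [sq]
  · intro b _ hb; simp [hb.symm]
  · exact fun h => absurd hβ h

/-- The low-degree likelihood ratio bound: the squared advantage is at most the sum of the squared
Hermite coefficients. -/
lemma ParamRange.integral_value_sq_le (h : ParamRange ε κ α σ) {n d D : ℕ} (hd : 1 ≤ d)
    {f : SamplePoly n d} (hf : f.totalDegree ≤ D) :
    (∫ z, f.value z ∂(hardInstance d ε κ α σ).alternativeLaw n ε σ) ^ 2 ≤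
      (∫ z, f.value z ^ 2 ∂nullLaw n d α σ) *
      ∑ β ∈ multiIdx (Fin n × (Fin d ⊕ Unit)) D,
        ((∫ v, featMonomial β v ∂sphereUniform d) *
          mixProd ε (cleanVar κ) (cleanCorr κ α σ) (degPairs β)) ^ 2 /
            ∏ ij, ((β ij).factorial : ℝ) := by
  obtain ⟨c, hc⟩ := exists_value_eq_sum_sampleHerm
    (labelScale_ne_zero (d := d) (labelDev_pos (σ := σ) h.alpha_pos).ne') hf
  rw [h.integral_value_alternativeLaw hd hc, integral_value_sq_nullLaw h.alpha_pos hc]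
  -- Cauchy-Schwarz, with `β!` placed on the null side and its inverse on the side of the
  -- alternative.
  refine Finset.sum_sq_le_sum_mul_sum_of_sq_le_mul _ (fun β _ => by positivity)
    (fun β _ => by positivity) fun β _ => le_of_eq ?_
  have : ∏ ij, ((β ij).factorial : ℝ) ≠ 0 :=
    Finset.prod_ne_zero_iff.2 fun ij _ => by exact_mod_cast (Nat.factorial_pos _).ne'
  field_simp

end

end RobustTesting

namespace RobustTesting

/-! ### Summation over the Hermite indices with given degrees -/

/-- The mean of `⟨v, w⟩ ^ q` for independent uniform `v`, `w` on the sphere. -/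
def overlapMoment (d q : ℕ) : ℝ := ∫ w, sphereMoment w q ∂sphereUniform d

/-- The Hermite index with feature degrees `γ` and label degrees `l`. -/
def joinIdx {n d : ℕ} (γ : Fin n → Fin d → ℕ) (l : Fin n → ℕ) : Fin n × (Fin d ⊕ Unit) → ℕ :=
  fun ij => Sum.elim (γ ij.1) (fun _ => l ij.1) ij.2

lemma featMonomial_joinIdx {n d : ℕ} (γ : Fin n → Fin d → ℕ) (l : Fin n → ℕ) (v : UnitSphere d) :
    featMonomial (joinIdx γ l) v = ∏ i, ∏ k, v.1 k ^ γ i k := rfl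

/-- One multinomial expansion per sample, followed by distributing the product over the sums. The
label degrees `l` are arbitrary because `featMonomial` ignores them. -/
lemma dotProduct_pow_sum_eq {n d : ℕ} (q : Fin n → ℕ) (l : Fin n → ℕ) (w v : UnitSphere d) :
    (w.1.ofLp ⬝ᵥ v.1.ofLp) ^ ∑ i, q i =
      ∑ γ ∈ Fintype.piFinset fun i => Finset.piAntidiag Finset.univ (q i),
        (∏ i, (Nat.multinomial Finset.univ (γ i) : ℝ)) *
          featMonomial (joinIdx γ l) w * featMonomial (joinIdx γ l) v := by
  rw [← Finset.prod_pow_eq_pow_sum, dotProduct]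
  simp_rw [Finset.sum_pow_eq_sum_piAntidiag]
  rw [Finset.prod_univ_sum]
  refine Finset.sum_congr rfl fun γ _ => ?_
  simp only [featMonomial_joinIdx, Finset.prod_mul_distrib, mul_pow, mul_assoc]

/-- The multinomial theorem for the moments of the overlap. -/
lemma sum_multinomial_featMonomial {n d : ℕ} (hd : 1 ≤ d) (q l : Fin n → ℕ) :
    ∑ γ ∈ Fintype.piFinset fun i => Finset.piAntidiag Finset.univ (q i),
        (∏ i, (Nat.multinomial Finset.univ (γ i) : ℝ)) *
          (∫ v, featMonomial (joinIdx γ l) v ∂sphereUniform d) ^ 2 = overlapMoment d (∑ i, q i) := by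
  rw [overlapMoment]
  simp_rw [sphereMoment, dotProduct_pow_sum_eq q l]
  have hi (γ : Fin n → Fin d → ℕ) : Integrable (featMonomial (joinIdx γ l)) (sphereUniform d) :=
    integrable_of_continuous_sphere hd (continuous_featMonomial _)
  simp_rw [integral_finsetSum _ fun γ _ => (hi γ).const_mul _, integral_const_mul]
  rw [integral_finsetSum _ fun γ _ => ((hi γ).const_mul _).mul_const _]
  simp_rw [integral_mul_const, integral_const_mul]
  exact Finset.sum_congr rfl fun γ _ => by ring

/-- The degree pairs of `n` samples of total degree at most `D`. -/
def pairIdx (n D : ℕ) : Finset (Fin n → ℕ × ℕ) :=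
  (Fintype.piFinset fun _ => Finset.range (D + 1) ×ˢ Finset.range (D + 1)).filter
    fun t => ∑ i, ((t i).1 + (t i).2) ≤ D

lemma mem_pairIdx {n D : ℕ} {t : Fin n → ℕ × ℕ} :
    t ∈ pairIdx n D ↔ ∑ i, ((t i).1 + (t i).2) ≤ D := by
  simp only [pairIdx, Finset.mem_filter, Fintype.mem_piFinset, Finset.mem_product,
    Finset.mem_range, and_iff_right_iff_imp, Nat.lt_succ_iff]
  intro h i
  have := (Finset.single_le_sum (f := fun i => (t i).1 + (t i).2) (fun _ _ => Nat.zero_le _)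
    (Finset.mem_univ i)).trans h
  lia

lemma sum_degPairs {n d : ℕ} (β : Fin n × (Fin d ⊕ Unit) → ℕ) :
    ∑ i, ((degPairs β i).1 + (degPairs β i).2) = ∑ ij, β ij := by
  simp [degPairs, Fintype.sum_prod_type]

/-- The squared Hermite coefficients of the alternative, summed over the indices of degree at most
`D`, in terms of the degrees of the samples. -/
lemma sum_sq_coeff_eq {n d D : ℕ} (hd : 1 ≤ d) (ε a b : ℝ) :
    ∑ β ∈ multiIdx (Fin n × (Fin d ⊕ Unit)) D,
        ((∫ v, featMonomial β v ∂sphereUniform d) * mixProd ε a b (degPairs β)) ^ 2 /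
            ∏ ij, ((β ij).factorial : ℝ) =
      ∑ t ∈ pairIdx n D, (∏ i, mixWeight ε a b (t i).1 (t i).2) *
        overlapMoment d (∑ i, (t i).1) := by
  -- Grouping by degree pairs: on a fibre the label degrees are fixed, so an index amounts to its
  -- feature part, and the inverse feature factorials are a multinomial coefficient over the
  -- factorial of the feature degree.
  rw [← Finset.sum_fiberwise_of_maps_to (s := multiIdx (Fin n × (Fin d ⊕ Unit)) D)
    (t := pairIdx n D) (g := degPairs)
    (fun β hβ => mem_pairIdx.2 (by rw [sum_degPairs]; exact mem_multiIdx.1 hβ))]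
  refine Finset.sum_congr rfl fun t ht => ?_
  rw [← sum_multinomial_featMonomial hd _ (fun i => (t i).2), Finset.mul_sum]
  refine Finset.sum_nbij' (fun β i k => β (i, Sum.inl k)) (fun γ => joinIdx γ fun i => (t i).2)
    ?_ ?_ ?_ ?_ ?_
  · intro β hβ
    obtain ⟨-, hβ⟩ := Finset.mem_filter.1 hβ
    simp [Fintype.mem_piFinset, Finset.mem_piAntidiag, ← hβ, degPairs]
  · intro γ hγ
    have h1 (i : Fin n) : ∑ k, γ i k = (t i).1 := by
      have := Fintype.mem_piFinset.1 hγ i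
      simpa [Finset.mem_piAntidiag] using this
    have h2 : degPairs (joinIdx γ fun i => (t i).2) = t := by
      ext i
      · exact h1 i
      · rfl
    refine Finset.mem_filter.2 ⟨mem_multiIdx.2 ?_, h2⟩
    rw [← sum_degPairs, h2]
    exact mem_pairIdx.1 ht
  · intro β hβ
    obtain ⟨-, rfl⟩ := Finset.mem_filter.1 hβ
    ext ⟨i, k | u⟩ <;> rfl
  · intro γ _
    rfl
  · intro β hβ
    obtain ⟨-, rfl⟩ := Finset.mem_filter.1 hβ
    have hβe : joinIdx (fun i k => β (i, Sum.inl k)) (fun i => (degPairs β i).2) = β := by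
      ext ⟨i, k | u⟩ <;> rfl
    rw [hβe]
    have h1 (i : Fin n) : (∏ k, ((β (i, Sum.inl k)).factorial : ℝ)) *
        Nat.multinomial Finset.univ (fun k => β (i, Sum.inl k)) =
          ((degPairs β i).1.factorial : ℝ) := by
      exact_mod_cast Nat.multinomial_spec Finset.univ fun k => β (i, Sum.inl k)
    have h2 : ∏ ij, ((β ij).factorial : ℝ) = (∏ i, ∏ k, ((β (i, Sum.inl k)).factorial : ℝ)) *
        ∏ i, ((degPairs β i).2.factorial : ℝ) := by
      simp [Fintype.prod_prod_type, Finset.prod_mul_distrib, degPairs]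
    have h3 : (∏ i, ∏ k, ((β (i, Sum.inl k)).factorial : ℝ)) *
        ∏ i, (Nat.multinomial Finset.univ (fun k => β (i, Sum.inl k)) : ℝ) =
          ∏ i, ((degPairs β i).1.factorial : ℝ) := by
      rw [← Finset.prod_mul_distrib]
      exact Finset.prod_congr rfl fun i _ => h1 i
    simp only [mixWeight, mixProd, Finset.prod_div_distrib, Finset.prod_mul_distrib,
      Finset.prod_pow]
    rw [h2, ← h3]
    have p1 : (∏ i, ∏ k, ((β (i, Sum.inl k)).factorial : ℝ)) ≠ 0 :=
      Finset.prod_ne_zero_iff.2 fun i _ => Finset.prod_ne_zero_iff.2 fun k _ => by positivity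
    have p2 : ∏ i, ((degPairs β i).2.factorial : ℝ) ≠ 0 :=
      Finset.prod_ne_zero_iff.2 fun i _ => by positivity
    have p3 : ∏ i, (Nat.multinomial Finset.univ (fun k => β (i, Sum.inl k)) : ℝ) ≠ 0 :=
      Finset.prod_ne_zero_iff.2 fun i _ => by
        exact_mod_cast (Nat.multinomial_pos _ _).ne'
    field_simp

lemma overlapMoment_zero {d : ℕ} (hd : 1 ≤ d) : overlapMoment d 0 = 1 := by
  have := isProbabilityMeasure_sphereUniform hd
  simp [overlapMoment, sphereMoment]

lemma overlapMoment_odd {d : ℕ} (hd : 1 ≤ d) {q : ℕ} (hq : Odd q) : overlapMoment d q = 0 := by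
  simp [overlapMoment, sphereMoment_odd hd _ hq]

lemma overlapMoment_nonneg {d : ℕ} (hd : 1 ≤ d) (q : ℕ) : 0 ≤ overlapMoment d q :=
  integral_nonneg fun w => sphereMoment_nonneg hd w q

lemma overlapMoment_even_le {d : ℕ} (hd : 1 ≤ d) (s : ℕ) :
    overlapMoment d (2 * s) ≤ (2 * s : ℝ) ^ s / d ^ s := by
  have := isProbabilityMeasure_sphereUniform hd
  have h := integral_mono_of_nonneg (μ := sphereUniform d)
    (Filter.Eventually.of_forall fun w => sphereMoment_nonneg hd w (2 * s))
    (integrable_const ((2 * s : ℝ) ^ s / d ^ s))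
    (Filter.Eventually.of_forall fun w => sphereMoment_even_le hd w s)
  rw [overlapMoment]
  simpa using h

end RobustTesting

namespace RobustTesting

/-! ### Counting degree pairs -/

/-- The total degree of a tuple of degree pairs. -/
def totDeg {n : ℕ} (t : Fin n → ℕ × ℕ) : ℕ := ∑ i, ((t i).1 + (t i).2)

/-- The samples of nonzero degree. -/
def activeSet {n : ℕ} (t : Fin n → ℕ × ℕ) : Finset (Fin n) := Finset.univ.filter fun i => t i ≠ 0

/-- The total label degree. -/
def labelDeg {n : ℕ} (t : Fin n → ℕ × ℕ) : ℕ := ∑ i, (t i).2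

/-- Choose the active samples in at most `n ^ m` ways; each then has at most `(p + 1) ^ 2` degree
pairs, and the others have none to choose. -/
lemma card_tuples_le {n : ℕ} (S : Finset (Fin n → ℕ × ℕ)) (p m : ℕ)
    (hS : ∀ t ∈ S, totDeg t = p ∧ (activeSet t).card = m) :
    S.card ≤ n ^ m * (p + 1) ^ (2 * m) := by
  have hsub : S ⊆ (Finset.powersetCard m (Finset.univ : Finset (Fin n))).biUnion fun A =>
      Fintype.piFinset fun i => if i ∈ A then Finset.range (p + 1) ×ˢ Finset.range (p + 1)
        else {0} := by
    intro t ht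
    obtain ⟨hp, hm⟩ := hS t ht
    refine Finset.mem_biUnion.2 ⟨activeSet t,
      Finset.mem_powersetCard.2 ⟨Finset.subset_univ _, hm⟩, Fintype.mem_piFinset.2 fun i => ?_⟩
    split_ifs with hi
    · have := Finset.single_le_sum (f := fun i => (t i).1 + (t i).2) (fun _ _ => Nat.zero_le _)
        (Finset.mem_univ i)
      have h1 : (t i).1 + (t i).2 ≤ p := hp ▸ this
      simp only [Finset.mem_product, Finset.mem_range]
      lia
    · simpa [activeSet] using hi
  refine (Finset.card_le_card hsub).trans (Finset.card_biUnion_le.trans ?_)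
  have h2 : ∀ A ∈ Finset.powersetCard m (Finset.univ : Finset (Fin n)),
      (Fintype.piFinset fun i => if i ∈ A then Finset.range (p + 1) ×ˢ Finset.range (p + 1)
        else {(0 : ℕ × ℕ)}).card = (p + 1) ^ (2 * m) := by
    intro A hA
    rw [Fintype.card_piFinset]
    have h3 (i : Fin n) : (if i ∈ A then Finset.range (p + 1) ×ˢ Finset.range (p + 1)
        else {(0 : ℕ × ℕ)}).card = if i ∈ A then (p + 1) ^ 2 else 1 := by
      split_ifs <;> simp [sq]
    simp_rw [h3]
    rw [Finset.prod_ite]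
    simp [(Finset.mem_powersetCard.1 hA).2, pow_mul]
  rw [Finset.sum_congr rfl h2, Finset.sum_const, Finset.card_powersetCard, Finset.card_univ,
    Fintype.card_fin, smul_eq_mul]
  exact Nat.mul_le_mul_right _ (Nat.choose_le_pow n m)

/-- The degree pairs with nonzero contribution. -/
lemma stats_of_prod_ne_zero {n : ℕ} {ε a b : ℝ} (hε : ε ≠ 0) {t : Fin n → ℕ × ℕ}
    (ht : ∏ i, mixWeight ε a b (t i).1 (t i).2 ≠ 0) :
    ∃ e : Fin n → ℕ, ∀ i, (t i).1 = (t i).2 + 2 * e i ∧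
      ((t i).2 + e i = 0 ∨ 2 ≤ (t i).2 + e i) := by
  have h (i : Fin n) := Finset.prod_ne_zero_iff.1 ht i (Finset.mem_univ i)
  have h' (i : Fin n) : mixHerm ε a b (t i).1 (t i).2 ≠ 0 := fun h0 => h i (by
    simp [mixWeight, h0])
  choose e he using fun i => exists_of_mixHerm_ne_zero hε (h' i)
  exact ⟨e, he⟩

section
variable {n : ℕ} {t : Fin n → ℕ × ℕ} {e : Fin n → ℕ}

lemma totDeg_eq (he : ∀ i, (t i).1 = (t i).2 + 2 * e i ∧
      ((t i).2 + e i = 0 ∨ 2 ≤ (t i).2 + e i)) : totDeg t = 2 * ∑ i, ((t i).2 + e i) := by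
  rw [totDeg, Finset.mul_sum]
  exact Finset.sum_congr rfl fun i _ => by rw [(he i).1]; ring

lemma labelDeg_le (he : ∀ i, (t i).1 = (t i).2 + 2 * e i ∧
      ((t i).2 + e i = 0 ∨ 2 ≤ (t i).2 + e i)) : labelDeg t ≤ totDeg t / 2 := by
  rw [totDeg_eq he, Nat.mul_div_cancel_left _ two_pos]
  exact Finset.sum_le_sum fun i _ => Nat.le_add_right _ _

lemma card_activeSet_eq : (activeSet t).card = ∑ i, if t i ≠ 0 then 1 else 0 := by
  rw [activeSet, Finset.card_filter]

/-- Each active sample saves two powers of `ε⁻¹`; for an inactive one the truncated difference `0 -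
2` is zero, as needed. The sum is the exponent in `prod_mixWeight_le`. -/
lemma sum_sub_two (he : ∀ i, (t i).1 = (t i).2 + 2 * e i ∧
      ((t i).2 + e i = 0 ∨ 2 ≤ (t i).2 + e i)) :
    ∑ i, (2 * ((t i).2 + e i) - 2) + 2 * (activeSet t).card = totDeg t := by
  rw [totDeg_eq he, card_activeSet_eq, Finset.mul_sum, Finset.mul_sum, ← Finset.sum_add_distrib]
  refine Finset.sum_congr rfl fun i _ => ?_
  obtain ⟨h1, h2⟩ := he i
  by_cases h : t i = 0
  · simp only [h, Prod.fst_zero, Prod.snd_zero] at h1 h2 ⊢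
    simp
    lia
  · have : (t i).2 + e i ≠ 0 := fun h0 => h (Prod.ext (by simp; lia) (by simp; lia))
    rw [if_pos h]
    lia

/-- Matching of the second moments forces every active sample to have degree at least four. -/
lemma four_mul_card_le (he : ∀ i, (t i).1 = (t i).2 + 2 * e i ∧
      ((t i).2 + e i = 0 ∨ 2 ≤ (t i).2 + e i)) : 4 * (activeSet t).card ≤ totDeg t := by
  rw [totDeg_eq he, card_activeSet_eq, Finset.mul_sum, Finset.mul_sum]
  refine Finset.sum_le_sum fun i _ => ?_
  obtain ⟨h1, h2⟩ := he i
  by_cases h : t i = 0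
  · simp [h]
  · have : (t i).2 + e i ≠ 0 := fun h0 => h (Prod.ext (by simp; lia) (by simp; lia))
    rw [if_pos h]
    lia

lemma card_activeSet_pos (ht : t ≠ 0) : 1 ≤ (activeSet t).card := by
  obtain ⟨i, hi⟩ := Function.ne_iff.1 ht
  exact Finset.card_pos.2 ⟨i, by simpa [activeSet] using hi⟩

lemma prod_mixWeight_le {ε a b x : ℝ} (h0 : 0 < ε) (h1 : ε < 1) (ha : a ^ 2 ≤ 1) (hb : b ^ 2 ≤ x)
    (he : ∀ i, (t i).1 = (t i).2 + 2 * e i ∧ ((t i).2 + e i = 0 ∨ 2 ≤ (t i).2 + e i)) :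
    ∏ i, mixWeight ε a b (t i).1 (t i).2 ≤
      ε⁻¹ ^ (totDeg t - 2 * (activeSet t).card) * (2 ^ (∑ i, (t i).1) * x ^ labelDeg t) := by
  have e1 : totDeg t - 2 * (activeSet t).card = ∑ i, (2 * ((t i).2 + e i) - 2) := by
    rw [← sum_sub_two he, Nat.add_sub_cancel]
  rw [e1, labelDeg, ← Finset.prod_pow_eq_pow_sum, ← Finset.prod_pow_eq_pow_sum,
    ← Finset.prod_pow_eq_pow_sum, ← Finset.prod_mul_distrib, ← Finset.prod_mul_distrib]
  refine Finset.prod_le_prod (fun i _ => mixWeight_nonneg _ _ _ _ _) fun i _ => ?_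
  obtain ⟨h2, h3 | h3⟩ := he i
  · have h4 : (t i).2 = 0 := by lia
    have h5 : e i = 0 := by lia
    rw [h2, h4, h5]
    simp [mixWeight_zero_zero]
  · rw [h2]
    exact mixWeight_le h0 h1 ha hb h3

/-- Label degree `L` lowers the overlap order to `p - L`, which costs `√d ^ L` compared with `d ^
(-p/2)`. For odd `L` the moment vanishes. -/
lemma overlapMoment_le {d : ℕ} (hd : 1 ≤ d) {p L : ℕ} (hp : 1 ≤ p) (he : Even p) (hL : L ≤ p) :
    overlapMoment d (p - L) ≤ (p : ℝ) ^ (p / 2) * (1 / d) ^ (p / 2) * √(d : ℝ) ^ L := by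
  have hd0 : (0 : ℝ) < d := by exact_mod_cast hd
  rcases Nat.even_or_odd L with hl | hl
  · obtain ⟨k, rfl⟩ := he
    obtain ⟨l, rfl⟩ := hl
    have e1 : k + k - (l + l) = 2 * (k - l) := by lia
    have e2 : (k + k) / 2 = k := by lia
    rw [e1, e2]
    refine (overlapMoment_even_le hd (k - l)).trans ?_
    have e3 : √(d : ℝ) ^ (l + l) = (d : ℝ) ^ l := by
      rw [pow_add, ← mul_pow, Real.mul_self_sqrt hd0.le]
    have e4 : (1 / (d : ℝ)) ^ k * d ^ l = 1 / d ^ (k - l) := by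
      obtain ⟨r, rfl⟩ := Nat.exists_eq_add_of_le (show l ≤ k by lia)
      rw [Nat.add_sub_cancel_left, one_div, inv_pow, pow_add]
      field_simp
    rw [e3, mul_assoc, e4, mul_one_div]
    gcongr
    have h1 : (2 * ((k - l : ℕ) : ℝ)) ^ (k - l) ≤ ((k + k : ℕ) : ℝ) ^ (k - l) := by
      gcongr
      exact_mod_cast (by lia : 2 * (k - l) ≤ k + k)
    refine h1.trans (pow_le_pow_right₀ (by exact_mod_cast hp) (Nat.sub_le _ _))
  · rw [overlapMoment_odd hd (Nat.Even.sub_odd hL he hl)]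
    positivity

end

/-- Since `p + 1 ≤ p ^ 2`, the count of degree pairs is at most `p ^ (4m)`; this accounts for the
two factors `p ^ (p / 2)` outside the overlap bound. -/
lemma pow_count_le {p m : ℕ} (hp : 4 ≤ p) (hm : 4 * m ≤ p) :
    ((p : ℝ) + 1) ^ (2 * m) ≤ (p : ℝ) ^ p := by
  have hp' : (4 : ℝ) ≤ p := by exact_mod_cast hp
  calc ((p : ℝ) + 1) ^ (2 * m) ≤ ((p : ℝ) ^ 2) ^ (2 * m) := by
        gcongr
        nlinarith
    _ = (p : ℝ) ^ (4 * m) := by rw [← pow_mul]; ring_nf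
    _ ≤ (p : ℝ) ^ p := pow_le_pow_right₀ (by linarith) hm

/-- The bound on the sum of the squared Hermite coefficients of the alternative. -/
lemma sum_pairIdx_le {n d D : ℕ} (hd : 1 ≤ d) {ε κ a b : ℝ} (h0 : 0 < ε) (h1 : ε < 1)
    (hκ : 0 < κ) (ha : a ^ 2 ≤ 1) (hb : b ^ 2 ≤ κ⁻¹) :
    ∑ t ∈ pairIdx n D, (∏ i, mixWeight ε a b (t i).1 (t i).2) * overlapMoment d (∑ i, (t i).1) ≤
      1 + advantageSum n d D ε κ := by
  classical
  set T : (Fin n → ℕ × ℕ) → ℝ := fun t =>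
    (∏ i, mixWeight ε a b (t i).1 (t i).2) * overlapMoment d (∑ i, (t i).1) with hT
  have hd0 : (0 : ℝ) < d := by exact_mod_cast hd
  have hzero : (0 : Fin n → ℕ × ℕ) ∈ pairIdx n D := mem_pairIdx.2 (by simp)
  -- The zero tuple corresponds to the constant polynomial and gives the `1`.
  rw [← Finset.add_sum_erase _ _ hzero]
  have hT0 : T 0 = 1 := by simp [hT, mixWeight_zero_zero, overlapMoment_zero hd]
  change T 0 + ∑ t ∈ (pairIdx n D).erase 0, T t ≤ _
  -- Vanishing terms are dropped because the degree constraints hold only where the weight is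
  -- nonzero.
  rw [hT0, ← Finset.sum_filter_ne_zero]
  gcongr
  set S := ((pairIdx n D).erase 0).filter fun t => T t ≠ 0 with hSdef
  have hS (t) (ht : t ∈ S) : t ≠ 0 ∧ totDeg t ≤ D ∧
      ∏ i, mixWeight ε a b (t i).1 (t i).2 ≠ 0 := by
    rw [hSdef, Finset.mem_filter, Finset.mem_erase, mem_pairIdx] at ht
    exact ⟨ht.1.1, ht.1.2, left_ne_zero_of_mul ht.2⟩
  -- The label factor `κ⁻¹ ^ L` meets `√d ^ L` from the overlap. The factor `2 ^ p` will become the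
  -- `4 ^ (p / 2)` of the target.
  have hbound (t) (ht : t ∈ S) : T t ≤ ε⁻¹ ^ (totDeg t - 2 * (activeSet t).card) *
      (2 ^ totDeg t * ((totDeg t : ℝ) ^ (totDeg t / 2) * (1 / d) ^ (totDeg t / 2))) *
        (√(d : ℝ) / κ) ^ labelDeg t := by
    obtain ⟨hne, -, hw⟩ := hS t ht
    obtain ⟨e, he⟩ := stats_of_prod_ne_zero h0.ne' hw
    have hlab := labelDeg_le he
    have hcard := four_mul_card_le he
    have hpos := card_activeSet_pos hne
    have hq : ∑ i, (t i).1 = totDeg t - labelDeg t := by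
      rw [totDeg, labelDeg, Finset.sum_add_distrib, Nat.add_sub_cancel]
    have h2 := prod_mixWeight_le h0 h1 ha hb he
    have h3 := overlapMoment_le hd (p := totDeg t) (L := labelDeg t) (by lia)
      (by rw [totDeg_eq he]; exact even_two_mul _) (by lia)
    rw [← hq] at h3
    have h4 : (2 : ℝ) ^ (∑ i, (t i).1) ≤ 2 ^ totDeg t :=
      pow_le_pow_right₀ one_le_two (by lia)
    have hi : 0 < ε⁻¹ := inv_pos.2 h0
    have hκi : 0 < κ⁻¹ := inv_pos.2 hκ
    calc T t ≤ (ε⁻¹ ^ (totDeg t - 2 * (activeSet t).card) *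
          (2 ^ (∑ i, (t i).1) * κ⁻¹ ^ labelDeg t)) *
          ((totDeg t : ℝ) ^ (totDeg t / 2) * (1 / d) ^ (totDeg t / 2) * √(d : ℝ) ^ labelDeg t) :=
          mul_le_mul h2 h3 (overlapMoment_nonneg hd _) (by positivity)
      _ ≤ (ε⁻¹ ^ (totDeg t - 2 * (activeSet t).card) *
          (2 ^ totDeg t * κ⁻¹ ^ labelDeg t)) *
          ((totDeg t : ℝ) ^ (totDeg t / 2) * (1 / d) ^ (totDeg t / 2) *
            √(d : ℝ) ^ labelDeg t) := by gcongr
      _ = _ := by rw [div_eq_mul_inv (√(d : ℝ)), mul_pow]; ring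
  rw [advantageSum, ← Finset.sum_fiberwise_of_maps_to (g := totDeg)
    (t := (Finset.Icc 4 D).filter Even) (fun t ht => by
      obtain ⟨hne, hle, hw⟩ := hS t ht
      obtain ⟨e, he⟩ := stats_of_prod_ne_zero h0.ne' hw
      have hcard := four_mul_card_le he
      have hpos := card_activeSet_pos hne
      exact Finset.mem_filter.2 ⟨Finset.mem_Icc.2 ⟨by lia, hle⟩, by
        rw [totDeg_eq he]; exact even_two_mul _⟩)]
  refine Finset.sum_le_sum fun p hp => ?_
  obtain ⟨hp1, hpe⟩ := Finset.mem_filter.1 hp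
  have hp4 := (Finset.mem_Icc.1 hp1).1
  rw [← Finset.sum_fiberwise_of_maps_to (g := fun t => (activeSet t).card)
    (t := Finset.Icc 1 (p / 4)) (fun t ht => by
      obtain ⟨hts, rfl⟩ := Finset.mem_filter.1 ht
      obtain ⟨hne, hle, hw⟩ := hS t hts
      obtain ⟨e, he⟩ := stats_of_prod_ne_zero h0.ne' hw
      have hcard := four_mul_card_le he
      exact Finset.mem_Icc.2 ⟨card_activeSet_pos hne, by lia⟩)]
  refine Finset.sum_le_sum fun m hm => ?_
  have hm4 : 4 * m ≤ p := by
    have := (Finset.mem_Icc.1 hm).2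
    lia
  rw [← Finset.sum_fiberwise_of_maps_to (g := labelDeg)
    (t := Finset.range (p / 2 + 1)) (fun t ht => by
      obtain ⟨ht, -⟩ := Finset.mem_filter.1 ht
      obtain ⟨hts, rfl⟩ := Finset.mem_filter.1 ht
      obtain ⟨hne, hle, hw⟩ := hS t hts
      obtain ⟨e, he⟩ := stats_of_prod_ne_zero h0.ne' hw
      exact Finset.mem_range.2 (Nat.lt_succ_of_le (labelDeg_le he))), Finset.mul_sum]
  refine Finset.sum_le_sum fun L _ => ?_
  set S' := ((S.filter fun t => totDeg t = p).filter fun t => (activeSet t).card = m).filter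
    fun t => labelDeg t = L with hS'
  have hmem (t) (ht : t ∈ S') : t ∈ S ∧ totDeg t = p ∧ (activeSet t).card = m ∧
      labelDeg t = L := by
    simp only [hS', Finset.mem_filter] at ht
    tauto
  have hcard : (S'.card : ℝ) ≤ (n : ℝ) ^ m * ((p : ℝ) + 1) ^ (2 * m) := by
    exact_mod_cast card_tuples_le S' p m fun t ht => ⟨(hmem t ht).2.1, (hmem t ht).2.2.1⟩
  have hi : 0 < ε⁻¹ := inv_pos.2 h0
  have hp0 : (0 : ℝ) < p := by exact_mod_cast (by lia : 0 < p)
  calc ∑ t ∈ S', T t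
      ≤ ∑ t ∈ S', ε⁻¹ ^ (p - 2 * m) * (2 ^ p * ((p : ℝ) ^ (p / 2) * (1 / d) ^ (p / 2))) *
          (√(d : ℝ) / κ) ^ L := by
        refine Finset.sum_le_sum fun t ht => ?_
        obtain ⟨hts, rfl, rfl, rfl⟩ := hmem t ht
        exact hbound t hts
    _ = S'.card * (ε⁻¹ ^ (p - 2 * m) * (2 ^ p * ((p : ℝ) ^ (p / 2) * (1 / d) ^ (p / 2))) *
          (√(d : ℝ) / κ) ^ L) := by rw [Finset.sum_const, nsmul_eq_mul]
    _ ≤ ((n : ℝ) ^ m * (p : ℝ) ^ p) * (ε⁻¹ ^ (p - 2 * m) *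
          (2 ^ p * ((p : ℝ) ^ (p / 2) * (1 / d) ^ (p / 2))) * (√(d : ℝ) / κ) ^ L) := by
        gcongr
        exact hcard.trans (mul_le_mul_of_nonneg_left (pow_count_le hp4 hm4) (by positivity))
    _ = _ := by
        have e1 : ε ^ (2 * (m : ℤ) - (p : ℤ)) = ε⁻¹ ^ (p - 2 * m) := by
          rw [inv_pow, ← zpow_natCast ε, ← zpow_neg]
          congr 1
          push_cast [Nat.cast_sub (by lia : 2 * m ≤ p)]
          ring
        obtain ⟨k, rfl⟩ := hpe
        have e2 : (k + k) / 2 = k := by lia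
        rw [e1, e2]
        have e3 : (2 : ℝ) ^ (k + k) = 4 ^ k := by
          rw [pow_add, ← mul_pow]; norm_num
        have e4 : (4 * ((k + k : ℕ) : ℝ) / d) ^ k = 4 ^ k * ((k + k : ℕ) : ℝ) ^ k * (1 / d) ^ k := by
          rw [← mul_pow, ← mul_pow, mul_one_div]
        rw [e3, pow_add, e4]
        ring

end RobustTesting

namespace RobustTesting

/-! ### The advantage of the hard instance -/

lemma advantageSum_nonneg (n d D : ℕ) {ε κ : ℝ} (hε : 0 ≤ ε) (hκ : 0 ≤ κ) :
    0 ≤ advantageSum n d D ε κ := by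
  unfold advantageSum
  positivity

section
variable {ε κ α σ : ℝ}

lemma ParamRange.sq_integral_le (h : ParamRange ε κ α σ) {n d D : ℕ} (hd : 1 ≤ d)
    {f : SamplePoly n d} (hf : f.totalDegree ≤ D) :
    (∫ z, f.value z ∂(hardInstance d ε κ α σ).alternativeLaw n ε σ) ^ 2 ≤
      (∫ z, f.value z ^ 2 ∂nullLaw n d α σ) * (1 + advantageSum n d D ε κ) := by
  refine (h.integral_value_sq_le hd hf).trans ?_
  rw [sum_sq_coeff_eq hd]
  exact mul_le_mul_of_nonneg_left
    (sum_pairIdx_le hd h.eps_pos (by linarith [h.eps_lt]) h.kappa_pos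
      (cleanVar_sq_le h.one_le_kappa) (cleanCorr_sq_le h.one_le_kappa h.alpha_pos))
    (integral_nonneg fun _ => sq_nonneg _)

lemma ParamRange.le_of_mem_advantageRatios (h : ParamRange ε κ α σ) {n d D : ℕ} (hd : 1 ≤ d)
    {r : ℝ} (hr : r ∈ advantageRatios ((hardInstance d ε κ α σ).alternativeLaw n ε σ)
      (nullLaw n d α σ) D) : r ≤ √(1 + advantageSum n d D ε κ) := by
  obtain ⟨f, hf, hpos, rfl⟩ := hr
  rw [div_le_iff₀ (Real.sqrt_pos.2 hpos), ← Real.sqrt_mul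
    (by linarith [advantageSum_nonneg n d D h.eps_pos.le h.kappa_pos.le]), mul_comm]
  exact Real.le_sqrt_of_sq_le (h.sq_integral_le hd hf)

lemma ParamRange.bddAbove_advantageRatios (h : ParamRange ε κ α σ) (n : ℕ) {d : ℕ} (D : ℕ)
    (hd : 1 ≤ d) : BddAbove (advantageRatios ((hardInstance d ε κ α σ).alternativeLaw n ε σ)
      (nullLaw n d α σ) D) :=
  ⟨_, fun _ hr => h.le_of_mem_advantageRatios hd hr⟩

lemma isProbabilityMeasure_nullLaw (n d : ℕ) (α σ : ℝ) :
    IsProbabilityMeasure (nullLaw n d α σ) := by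
  unfold nullLaw
  simp_rw [nullOne_eq_gaussLaw]
  infer_instance

lemma ParamRange.one_mem_advantageRatios (h : ParamRange ε κ α σ) (n : ℕ) {d : ℕ} (D : ℕ)
    (hd : 1 ≤ d) : 1 ∈ advantageRatios ((hardInstance d ε κ α σ).alternativeLaw n ε σ)
      (nullLaw n d α σ) D := by
  have := isProbabilityMeasure_nullLaw n d α σ
  have := h.isProbabilityMeasure_alternativeLaw n hd
  refine ⟨1, by simp, ?_, ?_⟩ <;> simp [SamplePoly.value]

lemma ParamRange.one_le_hardAdvantage (h : ParamRange ε κ α σ) (n : ℕ) {d : ℕ} (D : ℕ)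
    (hd : 1 ≤ d) : 1 ≤ hardAdvantage n d D ε κ α σ :=
  le_csSup (h.bddAbove_advantageRatios n D hd) (h.one_mem_advantageRatios n D hd)

lemma ParamRange.hardAdvantage_sq_le (h : ParamRange ε κ α σ) (n : ℕ) {d : ℕ} (D : ℕ)
    (hd : 1 ≤ d) : hardAdvantage n d D ε κ α σ ^ 2 - 1 ≤ advantageSum n d D ε κ := by
  have h1 := h.one_le_hardAdvantage n D hd
  have h2 : hardAdvantage n d D ε κ α σ ≤ √(1 + advantageSum n d D ε κ) :=
    csSup_le ⟨1, h.one_mem_advantageRatios n D hd⟩ fun r hr => h.le_of_mem_advantageRatios hd hr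
  have h3 := pow_le_pow_left₀ (by linarith) h2 2
  rw [Real.sq_sqrt (by linarith [advantageSum_nonneg n d D h.eps_pos.le h.kappa_pos.le])] at h3
  linarith

end

/-! ### The sum in the regime of few samples -/

/-- Here `ν = n ε²`, and `w` is `ε² d` or `√d κ ε²` according to the regime. Writing `k = 2m + r`,
each of the `m` samples absorbs `w⁻¹ ^ 2` and the other `r` factors `w⁻¹` are small by themselves;
every group gains `X ^ (-12)`, enough for all polynomial factors. -/
lemma term_bound_of_scale {X c ν w : ℝ} {k m : ℕ} (hX : 4 ≤ X) (hkX : 2 * (k : ℝ) ≤ X)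
    (hk : 2 ≤ k) (hm : 1 ≤ m) (hmk : 2 * m ≤ k) (hc0 : 0 ≤ c) (hc1 : c ≤ 1) (hν : 0 ≤ ν)
    (hw : X ^ 12 ≤ w) (hνw : ν * X ^ 12 ≤ c * w ^ 2) :
    ν ^ m * w⁻¹ ^ k * ((2 * (k : ℝ)) ^ (3 * k) * 4 ^ k * (k + 1)) * X ^ 2 ≤ c := by
  obtain ⟨r, rfl⟩ := Nat.exists_eq_add_of_le hmk
  have hX0 : 0 < X := by linarith
  have hX1 : 1 ≤ X := by linarith
  have hX12 : 0 < X ^ 12 := by positivity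
  have hw0 : 0 < w := hX12.trans_le hw
  set k := 2 * m + r with hkdef
  have h1 : ν * w⁻¹ ^ 2 ≤ c * (X ^ 12)⁻¹ := by
    rw [inv_pow, ← div_eq_mul_inv, ← div_eq_mul_inv, div_le_div_iff₀ (by positivity) hX12]
    exact hνw
  have h2 : ν ^ m * w⁻¹ ^ k ≤ c * (X ^ 12)⁻¹ ^ (m + r) := by
    calc ν ^ m * w⁻¹ ^ k = (ν * w⁻¹ ^ 2) ^ m * w⁻¹ ^ r := by
          rw [mul_pow, ← pow_mul, mul_assoc, ← pow_add]
      _ ≤ (c * (X ^ 12)⁻¹) ^ m * (X ^ 12)⁻¹ ^ r := by gcongr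
      _ = c ^ m * (X ^ 12)⁻¹ ^ (m + r) := by rw [mul_pow, pow_add]; ring
      _ ≤ c * (X ^ 12)⁻¹ ^ (m + r) := by
          gcongr
          exact pow_le_of_le_one hc0 hc1 (by lia)
  have hk1 : (k : ℝ) + 1 ≤ X ^ k := by
    have h2k : (2 : ℝ) ≤ k := by exact_mod_cast hk
    have : X ≤ X ^ k := le_self_pow₀ hX1 (by lia)
    linarith
  -- The four factors cost `3k + k + k + k` powers of `X`; the last uses `2 ≤ k`. The gain `12 (m +
  -- r)` is at least `6 (2m + r)`.
  have h3 : (2 * (k : ℝ)) ^ (3 * k) * 4 ^ k * (k + 1) * X ^ 2 ≤ X ^ (6 * k) := by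
    calc (2 * (k : ℝ)) ^ (3 * k) * 4 ^ k * (k + 1) * X ^ 2
        ≤ X ^ (3 * k) * X ^ k * X ^ k * X ^ k := by
          gcongr
      _ = X ^ (6 * k) := by rw [← pow_add, ← pow_add, ← pow_add]; congr 1; ring
  have h4 : X ^ (6 * k) ≤ X ^ (12 * (m + r)) := pow_le_pow_right₀ hX1 (by lia)
  calc ν ^ m * w⁻¹ ^ k * ((2 * (k : ℝ)) ^ (3 * k) * 4 ^ k * (k + 1)) * X ^ 2
      = (ν ^ m * w⁻¹ ^ k) * ((2 * (k : ℝ)) ^ (3 * k) * 4 ^ k * (k + 1) * X ^ 2) := by ring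
    _ ≤ (c * (X ^ 12)⁻¹ ^ (m + r)) * X ^ (12 * (m + r)) :=
        mul_le_mul h2 (h3.trans h4) (by positivity) (by positivity)
    _ = c := by
        rw [inv_pow, ← pow_mul]
        field_simp

lemma sum_pow_le_of_le_one {x : ℝ} (h0 : 0 ≤ x) (h1 : x ≤ 1) (k : ℕ) :
    ∑ L ∈ Finset.range (k + 1), x ^ L ≤ k + 1 := by
  calc ∑ L ∈ Finset.range (k + 1), x ^ L ≤ ∑ L ∈ Finset.range (k + 1), (1 : ℝ) :=
        Finset.sum_le_sum fun L _ => pow_le_one₀ h0 h1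
    _ = k + 1 := by simp

lemma sum_pow_le_of_one_le {x : ℝ} (h1 : 1 ≤ x) (k : ℕ) :
    ∑ L ∈ Finset.range (k + 1), x ^ L ≤ (k + 1) * x ^ k := by
  calc ∑ L ∈ Finset.range (k + 1), x ^ L ≤ ∑ L ∈ Finset.range (k + 1), x ^ k :=
        Finset.sum_le_sum fun L hL =>
          pow_le_pow_right₀ h1 (Nat.lt_succ_iff.1 (Finset.mem_range.1 hL))
    _ = (k + 1) * x ^ k := by simp

/-- In the regime of few samples, each term of the sum is small. -/
lemma term_le {n d D : ℕ} (hd : 1 ≤ d) {ε κ c : ℝ} (h0 : 0 < ε) (h1 : ε < 1 / 2) (hκ : 1 ≤ κ)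
    (hεκ : 1 - ε ≤ ε * κ) (hc0 : 0 ≤ c) (hc1 : c ≤ 1) (hD : (D : ℝ) ^ 13 ≤ ε * √(d : ℝ))
    (hn : (n : ℝ) * (D : ℝ) ^ 13 ≤ c * min (d * ε ^ 2 * κ ^ 2) (ε ^ 2 * d ^ 2))
    {k m : ℕ} (hk : 2 ≤ k) (hkD : 2 * k ≤ D) (hm : 1 ≤ m) (hmk : 2 * m ≤ k) :
    (n : ℝ) ^ m * ((2 * k : ℕ) : ℝ) ^ k * (4 * ((2 * k : ℕ) : ℝ) / d) ^ k *
      ε ^ (2 * (m : ℤ) - ((2 * k : ℕ) : ℤ)) * ((2 * k : ℕ) : ℝ) ^ k *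
        ∑ L ∈ Finset.range (k + 1), (√(d : ℝ) / κ) ^ L ≤ c / (D : ℝ) ^ 2 := by
  have hd0 : (0 : ℝ) < d := by exact_mod_cast hd
  have hκ0 : 0 < κ := by linarith
  have hX : (4 : ℝ) ≤ D := by exact_mod_cast (by lia : 4 ≤ D)
  have hX0 : (0 : ℝ) < D := by linarith
  have hX1 : (1 : ℝ) ≤ D := by linarith
  have hkX : 2 * (k : ℝ) ≤ D := by exact_mod_cast hkD
  have hs0 : 0 < √(d : ℝ) := Real.sqrt_pos.2 hd0
  have hss : √(d : ℝ) ^ 2 = d := Real.sq_sqrt hd0.le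
  have hX12 : (D : ℝ) ^ 12 ≤ (D : ℝ) ^ 13 := pow_le_pow_right₀ hX1 (by norm_num)
  have hn12 : (n : ℝ) * (D : ℝ) ^ 12 ≤ (n : ℝ) * (D : ℝ) ^ 13 := by gcongr
  have e1 : ε ^ (2 * (m : ℤ) - ((2 * k : ℕ) : ℤ)) = (ε ^ 2) ^ m * ((ε ^ 2)⁻¹) ^ k := by
    rw [zpow_sub₀ h0.ne', zpow_natCast, pow_mul, inv_pow, div_eq_mul_inv]
    congr 1
    rw [← pow_mul]
    exact_mod_cast zpow_natCast ε (2 * m)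
  have hone : 1 ≤ (D : ℝ) ^ 13 := one_le_pow₀ hX1
  rw [le_div_iff₀ (by positivity)]
  have e2 : (((2 * k : ℕ) : ℝ)) = 2 * k := by push_cast; ring
  have e5 : (2 * (k : ℝ)) ^ (3 * k) =
      (2 * (k : ℝ)) ^ k * (2 * (k : ℝ)) ^ k * (2 * (k : ℝ)) ^ k := by
    rw [← pow_add, ← pow_add]
    congr 1
    ring
  rw [e1, e2]
  -- The geometric sum is controlled by `L = 0` or by `L = k`; the first case needs the bound `ε²
  -- d²` on the samples, the second `d ε² κ²`.
  rcases le_total (√(d : ℝ) / κ) 1 with hle | hge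
  · have hy : (D : ℝ) ^ 12 ≤ ε ^ 2 * d := by
      have : ε ^ 2 * d = (ε * √(d : ℝ)) ^ 2 := by rw [mul_pow, hss]
      rw [this]
      nlinarith
    have hνw : (n : ℝ) * ε ^ 2 * (D : ℝ) ^ 12 ≤ c * (ε ^ 2 * d) ^ 2 := by
      have h2 := hn12.trans (hn.trans (mul_le_mul_of_nonneg_left (min_le_right _ _) hc0))
      nlinarith [mul_le_mul_of_nonneg_left h2 (sq_nonneg ε)]
    have key := term_bound_of_scale hX hkX hk hm hmk hc0 hc1 (by positivity) hy hνw
    refine le_trans ?_ key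
    have hsum := sum_pow_le_of_le_one (by positivity) hle k
    calc _ ≤ (n : ℝ) ^ m * (2 * (k : ℝ)) ^ k * (4 * (2 * (k : ℝ)) / d) ^ k *
          ((ε ^ 2) ^ m * ((ε ^ 2)⁻¹) ^ k) * (2 * (k : ℝ)) ^ k * (k + 1) * (D : ℝ) ^ 2 := by
          gcongr
      _ = _ := by
          rw [div_eq_mul_inv, mul_pow (4 * (2 * (k : ℝ))), mul_pow 4 (2 * (k : ℝ)),
            mul_pow (n : ℝ), mul_inv (ε ^ 2), mul_pow (ε ^ 2)⁻¹, e5]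
          generalize (2 * (k : ℝ)) ^ k = P
          generalize (ε ^ 2)⁻¹ ^ k = Q
          ring
  · have hz : (D : ℝ) ^ 12 ≤ √(d : ℝ) * κ * ε ^ 2 := by
      -- The loss of a factor two here is paid by the thirteenth power of `D`.
      have h2 : 1 / 2 ≤ ε * κ := by linarith
      have h3 : (D : ℝ) ^ 12 * 2 ≤ (D : ℝ) ^ 13 := by
        rw [pow_succ (D : ℝ) 12]
        gcongr
        linarith
      have h4 : (ε * √(d : ℝ)) * (1 / 2) ≤ (ε * √(d : ℝ)) * (ε * κ) := by gcongr
      nlinarith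
    have hνw : (n : ℝ) * ε ^ 2 * (D : ℝ) ^ 12 ≤ c * (√(d : ℝ) * κ * ε ^ 2) ^ 2 := by
      have h2 := hn12.trans (hn.trans (mul_le_mul_of_nonneg_left (min_le_left _ _) hc0))
      have e3 : (√(d : ℝ) * κ * ε ^ 2) ^ 2 = (d * ε ^ 2 * κ ^ 2) * ε ^ 2 := by
        rw [mul_pow, mul_pow, hss]; ring
      rw [e3]
      nlinarith [mul_le_mul_of_nonneg_left h2 (sq_nonneg ε)]
    have key := term_bound_of_scale hX hkX hk hm hmk hc0 hc1 (by positivity) hz hνw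
    refine le_trans ?_ key
    have hsum := sum_pow_le_of_one_le hge k
    -- The top power `L = k` replaces the scale `ε² d` by `√d κ ε²`.
    have e4 : (d : ℝ)⁻¹ ^ k * ((ε ^ 2)⁻¹) ^ k * (√(d : ℝ) / κ) ^ k =
        (√(d : ℝ) * κ * ε ^ 2)⁻¹ ^ k := by
      rw [← mul_pow, ← mul_pow]
      congr 1
      have : (d : ℝ)⁻¹ = (√(d : ℝ))⁻¹ * (√(d : ℝ))⁻¹ := by
        rw [← mul_inv, Real.mul_self_sqrt hd0.le]
      rw [this]
      field_simp
    calc _ ≤ (n : ℝ) ^ m * (2 * (k : ℝ)) ^ k * (4 * (2 * (k : ℝ)) / d) ^ k *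
          ((ε ^ 2) ^ m * ((ε ^ 2)⁻¹) ^ k) * (2 * (k : ℝ)) ^ k *
            ((k + 1) * (√(d : ℝ) / κ) ^ k) * (D : ℝ) ^ 2 := by
          gcongr
      _ = _ := by
          rw [← e4, div_eq_mul_inv (4 * (2 * (k : ℝ))), mul_pow (4 * (2 * (k : ℝ))),
            mul_pow 4 (2 * (k : ℝ)), mul_pow (n : ℝ), e5]
          generalize (2 * (k : ℝ)) ^ k = P
          generalize (ε ^ 2)⁻¹ ^ k = Q
          generalize (√(d : ℝ) / κ) ^ k = R
          ring

/-- There are at most `D ^ 2` pairs `(p, m)`, each contributing at most `c / D ^ 2`; for `D < 4` the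
sum is empty. -/
lemma advantageSum_le {n d D : ℕ} (hd : 1 ≤ d) {ε κ c : ℝ} (h0 : 0 < ε) (h1 : ε < 1 / 2)
    (hκ : 1 ≤ κ) (hεκ : 1 - ε ≤ ε * κ) (hc0 : 0 ≤ c) (hc1 : c ≤ 1)
    (hD : (D : ℝ) ^ 13 ≤ ε * √(d : ℝ))
    (hn : (n : ℝ) * (D : ℝ) ^ 13 ≤ c * min (d * ε ^ 2 * κ ^ 2) (ε ^ 2 * d ^ 2)) :
    advantageSum n d D ε κ ≤ c := by
  rcases Nat.lt_or_ge D 4 with hD4 | hD4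
  · rw [advantageSum, Finset.Icc_eq_empty (by lia)]
    simpa using hc0
  have hX0 : (0 : ℝ) < D := by exact_mod_cast (by lia : 0 < D)
  calc advantageSum n d D ε κ
      ≤ ∑ p ∈ (Finset.Icc 4 D).filter Even, ∑ m ∈ Finset.Icc 1 (p / 4), c / (D : ℝ) ^ 2 := by
        refine Finset.sum_le_sum fun p hp => Finset.sum_le_sum fun m hm => ?_
        obtain ⟨hp1, k, rfl⟩ := Finset.mem_filter.1 hp
        obtain ⟨hp4, hpD⟩ := Finset.mem_Icc.1 hp1
        obtain ⟨hm1, hm4⟩ := Finset.mem_Icc.1 hm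
        rw [← two_mul, Nat.mul_div_cancel_left k two_pos]
        exact term_le hd h0 h1 hκ hεκ hc0 hc1 hD hn (by lia) (by lia) hm1 (by lia)
    _ ≤ ∑ p ∈ (Finset.Icc 4 D).filter Even, c / (D : ℝ) := by
        refine Finset.sum_le_sum fun p hp => ?_
        have hpD := (Finset.mem_Icc.1 (Finset.mem_filter.1 hp).1).2
        rw [Finset.sum_const, Nat.card_Icc, nsmul_eq_mul]
        have h2 : ((p / 4 + 1 - 1 : ℕ) : ℝ) ≤ D := by exact_mod_cast (by lia : p / 4 + 1 - 1 ≤ D)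
        calc ((p / 4 + 1 - 1 : ℕ) : ℝ) * (c / (D : ℝ) ^ 2) ≤ D * (c / (D : ℝ) ^ 2) := by gcongr
          _ = c / D := by field_simp
    _ ≤ D * (c / D) := by
        rw [Finset.sum_const, nsmul_eq_mul]
        gcongr
        refine (Finset.card_filter_le _ _).trans ?_
        rw [Nat.card_Icc]
        lia
    _ = c := by field_simp

lemma ParamRange.abs_hardAdvantage_sub_one_le {ε κ α σ c : ℝ} (h : ParamRange ε κ α σ)
    {n d D : ℕ} (hd : 1 ≤ d) (hc0 : 0 ≤ c) (hc1 : c ≤ 1)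
    (hD : (D : ℝ) ^ 13 ≤ ε * √(d : ℝ))
    (hn : (n : ℝ) * (D : ℝ) ^ 13 ≤ c * min (d * ε ^ 2 * κ ^ 2) (ε ^ 2 * d ^ 2)) :
    |hardAdvantage n d D ε κ α σ - 1| ≤ c := by
  have h1 := h.one_le_hardAdvantage n D hd
  have h2 := h.hardAdvantage_sq_le n D hd
  have h3 := advantageSum_le hd h.eps_pos h.eps_lt h.one_le_kappa h.eps_kappa hc0 hc1 hD hn
  rw [abs_of_nonneg (by linarith)]
  nlinarith

end RobustTesting

namespace RobustTesting

/-! ### Rank-one perturbations of the identity -/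

/-- The matrix acting as `t` on the line of `v` and as the identity on its orthogonal. -/
def spikeMatrix {d : ℕ} (t : ℝ) (v : UnitSphere d) : Matrix (Fin d) (Fin d) ℝ :=
  1 + (t - 1) • Matrix.vecMulVec v.1.ofLp v.1.ofLp

lemma hardCov_eq_spikeMatrix {d : ℕ} (κ : ℝ) (v : UnitSphere d) :
    hardCov κ v = spikeMatrix (1 / κ) v := by
  rw [hardCov, spikeMatrix]
  module

lemma spikeMatrix_mul {d : ℕ} (s t : ℝ) (v : UnitSphere d) :
    spikeMatrix s v * spikeMatrix t v = spikeMatrix (s * t) v := by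
  have h : Matrix.vecMulVec v.1.ofLp v.1.ofLp * Matrix.vecMulVec v.1.ofLp v.1.ofLp =
      Matrix.vecMulVec v.1.ofLp v.1.ofLp := by
    rw [Matrix.vecMulVec_mul_vecMulVec, sphere_dotProduct_self, one_smul]
  simp only [spikeMatrix, mul_add, add_mul, mul_one, one_mul, smul_mul_smul_comm, h]
  module

lemma spikeMatrix_inv {d : ℕ} {t : ℝ} (ht : t ≠ 0) (v : UnitSphere d) :
    (spikeMatrix t v)⁻¹ = spikeMatrix t⁻¹ v := by
  refine Matrix.inv_eq_right_inv ?_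
  rw [spikeMatrix_mul, mul_inv_cancel₀ ht]
  simp [spikeMatrix]

lemma toEuclideanCLM_spikeMatrix {d : ℕ} (t : ℝ) (v : UnitSphere d)
    (x : EuclideanSpace ℝ (Fin d)) :
    Matrix.toEuclideanCLM (𝕜 := ℝ) (spikeMatrix t v) x = x + ((t - 1) * inner ℝ v.1 x) • v.1 := by
  ext i
  rw [Matrix.ofLp_toEuclideanCLM, spikeMatrix, Matrix.add_mulVec, Matrix.smul_mulVec,
    vecMulVec_mulVec_self, Matrix.one_mulVec, EuclideanSpace.inner_eq_star_dotProduct,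
    star_trivial, dotProduct_comm]
  simp [mul_assoc]

lemma norm_sq_toEuclideanCLM_spikeMatrix {d : ℕ} (t : ℝ) (v : UnitSphere d)
    (x : EuclideanSpace ℝ (Fin d)) :
    ‖Matrix.toEuclideanCLM (𝕜 := ℝ) (spikeMatrix t v) x‖ ^ 2 =
      ‖x‖ ^ 2 + (t ^ 2 - 1) * inner ℝ v.1 x ^ 2 := by
  rw [toEuclideanCLM_spikeMatrix, norm_add_sq_real, norm_smul, inner_smul_right,
    norm_eq_of_mem_sphere, real_inner_comm x, mul_one, Real.norm_eq_abs, sq_abs]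
  ring

lemma inner_sphere_sq_le {d : ℕ} (v : UnitSphere d) (x : EuclideanSpace ℝ (Fin d)) :
    inner ℝ v.1 x ^ 2 ≤ ‖x‖ ^ 2 := by
  have h := abs_real_inner_le_norm v.1 x
  rw [norm_eq_of_mem_sphere, one_mul] at h
  exact sq_le_sq.2 (h.trans (le_abs_self _))

lemma exists_ne_zero_inner_eq_zero {d : ℕ} (hd : 2 ≤ d) (v : EuclideanSpace ℝ (Fin d)) :
    ∃ w : EuclideanSpace ℝ (Fin d), w ≠ 0 ∧ inner ℝ v w = 0 := by
  have hne : (ℝ ∙ v)ᗮ ≠ ⊥ := fun h => by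
    rw [Submodule.orthogonal_eq_bot_iff] at h
    have h1 := finrank_span_le_card (R := ℝ) ({v} : Set (EuclideanSpace ℝ (Fin d)))
    rw [h, finrank_top, finrank_euclideanSpace_fin] at h1
    simp only [Set.toFinset_singleton, Finset.card_singleton] at h1
    lia
  obtain ⟨w, hw, hw0⟩ := Submodule.exists_mem_ne_zero_of_ne_bot hne
  exact ⟨w, hw0, Submodule.mem_orthogonal_singleton_iff_inner_right.1 hw⟩

/-- The norm is attained on a vector orthogonal to `v`, which exists because `2 ≤ d`; in dimension
one the matrix is the scalar `t`. -/
lemma norm_spikeMatrix_of_le_one {d : ℕ} (hd : 2 ≤ d) {t : ℝ} (h0 : 0 ≤ t) (h1 : t ≤ 1)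
    (v : UnitSphere d) : ‖Matrix.toEuclideanCLM (𝕜 := ℝ) (spikeMatrix t v)‖ = 1 := by
  refine le_antisymm (ContinuousLinearMap.opNorm_le_bound _ zero_le_one fun x => ?_) ?_
  · rw [one_mul]
    refine le_of_sq_le_sq ?_ (norm_nonneg _)
    rw [norm_sq_toEuclideanCLM_spikeMatrix]
    nlinarith [mul_nonneg (sub_nonneg.2 (pow_le_one₀ (n := 2) h0 h1)) (sq_nonneg (inner ℝ v.1 x))]
  · obtain ⟨w, hw0, hw⟩ := exists_ne_zero_inner_eq_zero hd v.1
    have h := ContinuousLinearMap.le_opNorm (Matrix.toEuclideanCLM (𝕜 := ℝ) (spikeMatrix t v)) w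
    rw [toEuclideanCLM_spikeMatrix, hw, mul_zero, zero_smul, add_zero] at h
    exact (le_mul_iff_one_le_left (norm_pos_iff.2 hw0)).1 h

lemma norm_spikeMatrix_of_one_le {d : ℕ} {t : ℝ} (h1 : 1 ≤ t) (v : UnitSphere d) :
    ‖Matrix.toEuclideanCLM (𝕜 := ℝ) (spikeMatrix t v)‖ = t := by
  have h0 : 0 ≤ t := by linarith
  refine le_antisymm (ContinuousLinearMap.opNorm_le_bound _ h0 fun x => ?_) ?_
  · refine le_of_sq_le_sq ?_ (by positivity)
    rw [norm_sq_toEuclideanCLM_spikeMatrix]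
    nlinarith [mul_le_mul_of_nonneg_left (inner_sphere_sq_le v x)
      (sub_nonneg.2 (one_le_pow₀ (n := 2) h1))]
  · have h := ContinuousLinearMap.le_opNorm
      (Matrix.toEuclideanCLM (𝕜 := ℝ) (spikeMatrix t v)) v.1
    rw [toEuclideanCLM_spikeMatrix, real_inner_self_eq_norm_sq, norm_eq_of_mem_sphere, one_pow,
      mul_one, mul_one] at h
    have e : v.1 + (t - 1) • v.1 = t • v.1 := by module
    rw [e, norm_smul, norm_eq_of_mem_sphere, mul_one, Real.norm_of_nonneg h0] at h
    exact h

/-! ### The hard instance is valid -/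

lemma hardCov_posDef {d : ℕ} {κ : ℝ} (hκ : 1 ≤ κ) (v : UnitSphere d) : (hardCov κ v).PosDef := by
  have h0 : 0 < κ := by linarith
  refine Matrix.PosDef.of_dotProduct_mulVec_pos (hardCov_posSemidef hκ v).1 fun {x} hx => ?_
  rw [star_trivial, hardCov_quadForm]
  have h1 : (v.1.ofLp ⬝ᵥ x) ^ 2 ≤ x ⬝ᵥ x := by
    have h := inner_sphere_sq_le v (WithLp.toLp 2 x)
    rw [← real_inner_self_eq_norm_sq, EuclideanSpace.inner_eq_star_dotProduct,
      EuclideanSpace.inner_eq_star_dotProduct, star_trivial, star_trivial, dotProduct_comm] at h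
    exact h
  have h2 : 0 < x ⬝ᵥ x := by simpa using Matrix.dotProduct_star_self_pos_iff.2 hx
  have h3 : 0 < 1 / κ := by positivity
  have h4 : 1 / κ ≤ 1 := (div_le_one h0).2 hκ
  nlinarith [mul_le_mul_of_nonneg_left h1 (sub_nonneg.2 h4), mul_pos h3 h2]

/-- The covariance has top eigenvalue `1`, off the line of `v`, and its inverse has top eigenvalue
`κ`, on that line. -/
lemma condNumber_hardCov {d : ℕ} (hd : 2 ≤ d) {κ : ℝ} (hκ : 1 ≤ κ) (v : UnitSphere d) :
    condNumber (hardCov κ v) = κ := by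
  have h0 : 0 < κ := by linarith
  rw [condNumber, hardCov_eq_spikeMatrix, spikeMatrix_inv (by positivity), one_div, inv_inv,
    norm_spikeMatrix_of_le_one hd (by positivity) (inv_le_one_of_one_le₀ hκ),
    norm_spikeMatrix_of_one_le hκ, one_mul]

lemma mahalanobisNorm_hardCov {d : ℕ} {κ α : ℝ} (hκ : 0 < κ) (hα : 0 ≤ α) (v : UnitSphere d) :
    mahalanobisNorm (hardCov κ v) ((α * √κ) • v.1) = α := by
  rw [mahalanobisNorm, hardCov_quadForm, WithLp.ofLp_smul, dotProduct_smul, smul_dotProduct,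
    dotProduct_smul, sphere_dotProduct_self]
  simp only [smul_eq_mul, mul_one]
  have e : α * √κ * (α * √κ) - (1 - 1 / κ) * (α * √κ) ^ 2 = α ^ 2 := by
    rw [← sq, mul_pow, Real.sq_sqrt hκ.le]
    field_simp
    ring
  rw [e, Real.sqrt_sq hα]

lemma variance_label_hard {d : ℕ} {κ : ℝ} (hκ : 1 ≤ κ) (α σ : ℝ) (v : UnitSphere d) :
    variance (fun z : Sample d => z (Sum.inr ()))
      (linearModel (hardCov κ v) ((α * √κ) • v.1) σ) = α ^ 2 + σ ^ 2 := by
  rw [linearModel_hard_eq_gaussLaw hκ, ← multivariateGaussian_eq_gaussLaw _ rfl,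
    variance_eval_multivariateGaussian (posSemidef_mul_transpose _),
    spikeFactor_mul_transpose (sphere_dotProduct_self v), Matrix.fromBlocks_apply₂₂]
  rfl

/-- The hard instance satisfies the requirements of the testing problem. -/
lemma ParamRange.isValid_hardInstance {ε κ α σ : ℝ} (h : ParamRange ε κ α σ) {d : ℕ}
    (hd : 2 ≤ d) : (hardInstance d ε κ α σ).IsValid κ α σ where
  posDef v := hardCov_posDef h.one_le_kappa v
  condNumber_eq v := condNumber_hardCov hd h.one_le_kappa v
  mahalanobisNorm_eq v := mahalanobisNorm_hardCov h.kappa_pos h.alpha_pos.le v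
  isProbability _ := inferInstance
  variance_label v := variance_label_hard h.one_le_kappa α σ v

/-! ### Matching moments -/

/-- Orthogonality to the constant Hermite product. -/
lemma integral_scaledHerm_nullOne {d : ℕ} {α : ℝ} (hα : 0 < α) (σ : ℝ)
    (β : Fin d ⊕ Unit → ℕ) :
    ∫ z, scaledHerm (labelScale d (labelDev α σ)) β z ∂nullOne d α σ = if β = 0 then 1 else 0 := by
  have h := integral_scaledHerm_mul_diagonal
    (labelScale_ne_zero (d := d) (labelDev_pos (σ := σ) hα).ne') β 0
  rw [nullOne_eq_gaussLaw]
  simp only [scaledHerm, Pi.zero_apply, herm_zero, Polynomial.eval_one, Finset.prod_const_one,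
    mul_one] at h
  simp only [scaledHerm, h]
  split_ifs with h0
  · simp [h0]
  · rfl

lemma integrable_scaledHerm_nullOne {d : ℕ} (α σ : ℝ) (s : Fin d ⊕ Unit → ℝ)
    (β : Fin d ⊕ Unit → ℕ) : Integrable (scaledHerm s β) (nullOne d α σ) := by
  rw [nullOne_eq_gaussLaw]
  exact integrable_scaledHerm_gaussLaw _ _ _

/-- The Hermite moments of order at most three of the mixture and of the null agree. -/
lemma ParamRange.integral_scaledHerm_mixture_of_sum_le {ε κ α σ : ℝ} (h : ParamRange ε κ α σ)
    {d : ℕ} (v : UnitSphere d) {β : Fin d ⊕ Unit → ℕ} (hβ : ∑ j, β j ≤ 3) :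
    ∫ z, scaledHerm (labelScale d (labelDev α σ)) β z ∂(hardInstance d ε κ α σ).mixture ε σ v =
      ∫ z, scaledHerm (labelScale d (labelDev α σ)) β z ∂nullOne d α σ := by
  rw [h.integral_scaledHerm_mixture, integral_scaledHerm_nullOne h.alpha_pos]
  split_ifs with h0
  · simp [h0, mixHerm_zero_zero]
  · by_contra hne
    -- A nonzero moment has total degree `2 (j + e)` with `j + e = 0` or `j + e ≥ 2`; degree at most
    -- three leaves only the zero index.
    obtain ⟨e, he, he2⟩ := exists_of_mixHerm_ne_zero h.eps_pos.ne' (right_ne_zero_of_mul hne)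
    simp only [Fintype.sum_sum_type, Finset.univ_unique, Finset.sum_singleton,
      PUnit.default_eq_unit] at hβ
    refine h0 (funext fun j => ?_)
    have hsum : ∑ k, β (Sum.inl k) = 0 := by lia
    rcases j with k | u
    · exact Finset.sum_eq_zero_iff.1 hsum k (Finset.mem_univ k)
    · change β (Sum.inr ()) = 0
      lia

/-- The moments of order at most three of the mixture and of the null agree. -/
lemma ParamRange.integral_eval_mixture {ε κ α σ : ℝ} (h : ParamRange ε κ α σ) {d : ℕ}
    (v : UnitSphere d) {q : MvPolynomial (Fin d ⊕ Unit) ℝ} (hq : q.totalDegree ≤ 3) :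
    ∫ z, MvPolynomial.eval (fun j => z j) q ∂((hardInstance d ε κ α σ).mixture ε σ v) =
      ∫ z, MvPolynomial.eval (fun j => z j) q ∂(nullOne d α σ) := by
  obtain ⟨c, hc⟩ := exists_eval_eq_sum_herm
    (labelScale_ne_zero (d := d) (labelDev_pos (σ := σ) h.alpha_pos).ne') hq
  have hc' (z : Sample d) : MvPolynomial.eval (fun j => z j) q =
      ∑ β ∈ multiIdx (Fin d ⊕ Unit) 3, c β * scaledHerm (labelScale d (labelDev α σ)) β z := hc _
  simp_rw [hc']
  rw [integral_finsetSum _ fun β _ => (h.integrable_scaledHerm_mixture v _ β).const_mul (c β),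
    integral_finsetSum _ fun β _ => (integrable_scaledHerm_nullOne α σ _ β).const_mul (c β)]
  refine Finset.sum_congr rfl fun β hβ => ?_
  rw [integral_const_mul, integral_const_mul,
    h.integral_scaledHerm_mixture_of_sum_le v (mem_multiIdx.1 hβ)]

end RobustTesting

end

theorem mainTheorem3 :
    -- the hard instance is a legitimate instance of the testing problem
    (∀ (d : ℕ) (ε κ α σ : ℝ), 2 ≤ d → RobustTesting.ParamRange ε κ α σ →
      (RobustTesting.hardInstance d ε κ α σ).IsValid κ α σ) ∧
    -- its corruption covariance is positive semidefinite, its first three moments match those of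
    -- the null, and the alternative law has all moments
    (∀ (d : ℕ) (ε κ α σ : ℝ), 1 ≤ d → RobustTesting.ParamRange ε κ α σ →
      (∀ v : RobustTesting.UnitSphere d,
        (RobustTesting.corruptionCov ε κ (α * √κ) σ v).PosSemidef ∧
        ∀ q : MvPolynomial (Fin d ⊕ Unit) ℝ, q.totalDegree ≤ 3 →
          ∫ z, MvPolynomial.eval (fun j => z j) q
              ∂((RobustTesting.hardInstance d ε κ α σ).mixture ε σ v) =
            ∫ z, MvPolynomial.eval (fun j => z j) q ∂(RobustTesting.nullOne d α σ)) ∧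
      ∀ n : ℕ,
        IsProbabilityMeasure ((RobustTesting.hardInstance d ε κ α σ).alternativeLaw n ε σ) ∧
        ∀ f : RobustTesting.SamplePoly n d,
          Integrable f.value ((RobustTesting.hardInstance d ε κ α σ).alternativeLaw n ε σ)) ∧
    -- the explicit bound on the squared advantage, with an absolute constant
    (∃ C : ℝ, 0 < C ∧ ∀ (n d D : ℕ) (ε κ α σ : ℝ), 1 ≤ d →
      RobustTesting.ParamRange ε κ α σ →
      BddAbove (RobustTesting.advantageRatios
        ((RobustTesting.hardInstance d ε κ α σ).alternativeLaw n ε σ)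
        (RobustTesting.nullLaw n d α σ) D) ∧
      RobustTesting.hardAdvantage n d D ε κ α σ ^ 2 - 1 ≤
        C * RobustTesting.advantageSum n d D ε κ) ∧
    -- the advantage is `1 + o(1)`, uniformly in all parameters, as the ratio of `n * poly(D)` to
    -- `min (d ε² κ²) (ε² d²)` tends to `0`
    (∃ C : ℕ, ∀ η : ℝ, 0 < η → ∃ c : ℝ, 0 < c ∧ ∀ (n d D : ℕ) (ε κ α σ : ℝ), 1 ≤ d →
      RobustTesting.ParamRange ε κ α σ →
      (D : ℝ) ^ C ≤ ε * √(d : ℝ) →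
      (n : ℝ) * (D : ℝ) ^ C ≤ c * min (d * ε ^ 2 * κ ^ 2) (ε ^ 2 * d ^ 2) →
      |RobustTesting.hardAdvantage n d D ε κ α σ - 1| ≤ η) := by
  refine ⟨fun d ε κ α σ hd h => h.isValid_hardInstance hd, fun d ε κ α σ hd h => ⟨fun v => ⟨?_, ?_⟩,
    fun n => ⟨h.isProbabilityMeasure_alternativeLaw n hd,
      fun f => h.integrable_value_alternativeLaw hd f⟩⟩,
    ⟨1, one_pos, fun n d D ε κ α σ hd h => ⟨h.bddAbove_advantageRatios n D hd, ?_⟩⟩,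
    -- Capping `c` at one is what permits `c ^ m ≤ c` in `term_bound_of_scale`.
    ⟨13, fun η hη => ⟨min 1 η, by positivity, fun n d D ε κ α σ hd h hD hn => ?_⟩⟩⟩
  · rw [← h.corrupt_factor v]
    exact RobustTesting.posSemidef_mul_transpose _
  · exact fun q hq => h.integral_eval_mixture v hq
  · rw [one_mul]
    exact h.hardAdvantage_sq_le n D hd
  · exact (h.abs_hardAdvantage_sub_one_le hd (by positivity) (min_le_left 1 η) hD hn).trans
      (min_le_right 1 η)
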